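/- **Setting.** Let $n\ge1$, $p\ge 0$, $f_1,\dots,f_n:\mathbb R^p\to\mathbb R$, $f=\frac1n\sum_i f_i$, and let $x^*$ be a minimizer of $f$. A matrix $X\in\mathbb R^{n\times p}$ has rows $x_1,\dots,x_n$, and $\nabla F(X)$ is the matrix with rows $\nabla f_i(x_i)$; $\|\cdot\|$ is the Euclidean norm (the spectral norm $\|\cdot\|_2$ for $n\times n$ matrices) and $\|\cdot\|_F$ the Frobenius norm. *Network.* $R,C\in\mathbb R^{n\times n}$ are nonnegative, $R\mathbf 1=\mathbf 1$, $\mathbf 1^{\top}C=\mathbf 1^{\top}$, and there is a strongly connected digraph $\mathcal G$ that contains the edge $(j,i)$ whenever $R_{ij}>0$ or $C_{ij}>0$. For a nonnegative matrix $W$ let $\mathcal G_W$ have the edge $a\to b$ iff $W_{ba}>0$; some node is the root of a spanning tree both of $\mathcal G_R$ and of $\mathcal G_{C^{\top}}$. *Smoothness.* Each $f_i$ is differentiable, $\nabla f_i$ is $L_i$-Lipschitz, and $L=\max_i L_i>0$. *Compression.* A random operator $\mathcal C$ on a Euclidean space satisfies the compression assumption with the constants $C,\sigma^2,\sigma_r^2\ge0$,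 $r>0$, $\delta\in(0,1]$ if for all $x$ $$\mathbb E\|\mathcal C(x)-x\|^2\le C\|x\|^2+\sigma^2,\qquad \mathbb E\|\mathcal C(x)/r-x\|^2\le(1-\delta)\|x\|^2+\sigma_r^2 .$$ (The scalar $C$ is not to be confused with the matrix $C$.) *Algorithm (RCPP).* Let $\Lambda=\mathrm{diag}(\lambda_1,\dots,\lambda_n)$ with $\lambda_i\ge0$, $\hat\lambda=\max_i\lambda_i>0$, $\gamma_x,\gamma_y>0$, $\alpha_x,\alpha_y\in(0,\frac1r]$, $s_k^2=a_0a^k$ with $a_0>0$, $a\in(0,1)$. Start from any $X^0$ with $Y^0=\nabla F(X^0)$ and $H_x^0=H_y^0=H_R^0=H_C^0=0$. For $k=0,1,2,\dots$ put $$\begin{aligned} &\tilde X^k=X^k-\Lambda Y^k,\quad Q_x^k=s_k\,\mathcal C\big((\tilde X^k-H_x^k)/s_k\big),\quad \hat X^k=H_x^k+Q_x^k,\quad \hat X_R^k=H_R^k+RQ_x^k,\\ &H_x^{k+1}=(1-\alpha_x)H_x^k+\alpha_x\hat X^k,\quad H_R^{k+1}=(1-\alpha_x)H_R^k+\alpha_x\hat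 X_R^k,\quad X^{k+1}=\tilde X^k-\gamma_x(\hat X^k-\hat X_R^k),\\ &\tilde Y^k=Y^k+\nabla F(X^{k+1})-\nabla F(X^k),\quad Q_y^k=s_k\,\mathcal C\big((\tilde Y^k-H_y^k)/s_k\big),\quad \hat Y^k=H_y^k+Q_y^k,\quad \hat Y_C^k=H_C^k+CQ_y^k,\\ &H_y^{k+1}=(1-\alpha_y)H_y^k+\alpha_y\hat Y^k,\quad H_C^{k+1}=(1-\alpha_y)H_C^k+\alpha_y\hat Y_C^k,\quad Y^{k+1}=\tilde Y^k-\gamma_y(\hat Y^k-\hat Y_C^k), \end{aligned}$$ where the random seeds of all compressions are independent and identically distributed. Here $\mathcal C$ acts on $\mathbb R^{n\times p}$, and the compression assumption is imposed with the Frobenius norm. *Eigenvectors and norms.* Let $u_R,u_C\ge0$ satisfy $u_R^{\top}R=u_R^{\top}$, $Cu_C=u_C$, $u_R^{\top}\mathbf 1=u_C^{\top}\mathbf 1=n$, and let $\Pi_R=I-\frac1n\mathbf 1u_R^{\top}$, $\Pi_C=I-\frac1nu_C\mathbf 1^{\top}$, $R_\gamma=I-\gamma_x(I-R)$, $C_\gamma=I-\gamma_y(I-C)$.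 Let $\tilde R,\tilde C$ be invertible $n\times n$ matrices and $\delta_{R,2},\delta_{C,2}$ and $\theta_R,\theta_C\in(0,1]$ constants such that the norms $\|v\|_R=\|\tilde Rv\|$, $\|v\|_C=\|\tilde Cv\|$ and the induced matrix norms $\|A\|_R=\|\tilde RA\tilde R^{-1}\|_2$, $\|A\|_C=\|\tilde CA\tilde C^{-1}\|_2$ satisfy $\|v\|\le\|v\|_R\le\delta_{R,2}\|v\|$, $\|v\|\le\|v\|_C\le\delta_{C,2}\|v\|$ for all $v$, $\|\Pi_RR_\gamma\|_R\le1-\theta_R\gamma_x$, $\|\Pi_CC_\gamma\|_C\le1-\theta_C\gamma_y$, $\|\Pi_R\|_R,\|\Pi_C\|_C\le1$, $\|R\|_R,\|R_\gamma\|_R,\|C\|_C,\|C_\gamma\|_C\le2$ and $\|I-R\|_R,\|I-C\|_C\le3$. For matrices $X\in\mathbb R^{n\times p}$ let $\|X\|_R=\|\tilde RX\|_F$, $\|X\|_C=\|\tilde CX\|_F$. *Constants.* Let $M>0$ satisfy $\bar\lambda:=\frac1nu_R^{\top}\Lambda u_C\ge M\hat\lambda$, and put $E=\frac{\|u_R\|\|u_C\|}{n^2M}$,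 $\beta=\frac{\theta_R\gamma_x}8$, $\tilde c=\frac{a_0}{1-a}$, $e_1=2\delta_{C,2}^2(1+18C)$, $e_2=108C+112$, $e_3=\min\{\frac1{2\delta_{R,2}}\frac{\theta_R}{1-\theta_R\gamma_x},1\}$, $e_4=\min\{\frac{\theta_R}{36(1-\theta_R\gamma_x)},\frac1{3\sqrt3}\}$, $e_5=\min\{\frac{\theta_R}{432\sqrt2\,\delta_{R,2}},\frac1{72}\}$, $$A=\frac{\theta_C\gamma_y\theta_R}{108e_1\gamma_x},\quad B=\frac{L^2\alpha_xr\delta\theta_R}{1296\gamma_x},\quad D=\frac{\theta_C\gamma_y\alpha_yr\delta\theta_R}{108e_2\gamma_x},\quad \zeta_0=L^2\zeta_c+A\zeta_g+B\zeta_{cx}+D\zeta_{cy},$$ $$\zeta_c=\frac{18\delta_{R,2}^2\sigma^2}{\theta_R},\qquad \zeta_g=\frac{108\delta_{C,2}^2(1+18C)L^2\sigma^2}{\theta_C}+\frac{18\delta_{C,2}^2\sigma^2}{\theta_C},$$ $$\zeta_{cx}=2\alpha_xr\sigma_r^2+\sigma^2\Big(\frac1{4L^2}+18\Big)\frac{18}{\alpha_xr\delta},\qquad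 \zeta_{cy}=\sigma^2(18+9e_2L^2)\frac3{\alpha_yr\delta}+2\alpha_yr\sigma_r^2 .$$ *Step-sizes.* Assume (bounds with $C$ in the denominator being void if $C=0$) $$\begin{aligned} \hat\lambda&\le\min\Big\{\frac16,\frac1{6\sqrt C},\frac1M,\frac{\theta_C}{\sqrt{54e_1}},\frac{e_3\gamma_x}{\sqrt{96E}\,\|u_C\|},\frac{e_4\theta_C\gamma_y}{\sqrt{48e_1}}\Big\}\frac1L,\\ \gamma_x&\le\min\Big\{1,\frac{e_5\alpha_xr\delta}{\sqrt C},\frac{\sqrt{M\|u_C\|}}{\sqrt{108\|u_R\|e_1}}\theta_C\gamma_y\Big\},\\ \gamma_y&\le\min\Big\{1,\frac{\theta_Ce_2}{432e_1},\frac{\theta_C(\alpha_yr\delta)^2}{432e_2C},\frac{\alpha_yr\delta}{\sqrt{1728C}}\Big\}. \end{aligned}$$ *Lyapunov function.* With $\bar x^k=\frac1n(X^k)^{\top}u_R$ let $\Omega^k=\mathbb E[f(\bar x^k)-f(x^*)]+\frac{EM\hat\lambda}\beta V^k$, where $$V^k=\mathbb E\big[L^2\|\Pi_RX^k\|_R^2+A\|\Pi_CY^k\|_C^2+B\|\tilde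 X^k-H_x^k\|_F^2+D\|Y^k-H_y^k\|_F^2\big].$$ **Theorem.** (i) The vectors $u_R$ and $u_C$ exist and are unique, and for every $\Gamma\in(0,1)$ there are $\tilde R,\tilde C,\delta_{R,2},\delta_{C,2},\theta_R,\theta_C$ that have the properties listed above for all $\gamma_x,\gamma_y\in(0,\Gamma]$ simultaneously. (ii) For every such choice of norms, constants, parameters and compression operator as above, $\mathbb E\|\nabla f(\bar x^k)\|^2<\infty$ for all $k$, and for all $K\ge1$ $$\frac1K\sum_{k=0}^{K-1}\mathbb E\big[\|\nabla f(\bar x^k)\|^2\big]\le\frac{4\Omega^0}{M\hat\lambda K}+\frac{4E\tilde c\,\zeta_0}{\beta K}.$$ (iii) If instead each agent $i$ compresses its own row with a random operator $\mathcal C_i$ on $\mathbb R^p$ that satisfies the compression assumption with the constants $C,\sigma^2,r,\delta,\sigma_r^2$ (the operators of different agents may be dependent), the same holds with $n\sigma^2,n\sigma_r^2$ in place of $\sigma^2,\sigma_r^2$ in $\zeta_0$. -/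

import Mathlib

open MeasureTheory ProbabilityTheory

noncomputable section

namespace RCPP

/-! ### Stacked variables, mixing matrices, graphs -/

/-- Decision vectors, with the Euclidean norm. -/
abbrev Vec (p : ℕ) : Type := EuclideanSpace ℝ (Fin p)

/-- Matrices in `ℝ^{n × p}`, given by their rows (row `i` belongs to agent `i`); the norm of this
space is the Frobenius norm. -/
abbrev Stack (n p : ℕ) : Type := PiLp 2 (fun _ : Fin n => Vec p)

/-- The matrix product `W X` of `W ∈ ℝ^{n × n}` with `X ∈ ℝ^{n × p}`. -/
def mulStack {n p : ℕ} (W : Matrix (Fin n) (Fin n) ℝ) (X : Stack n p) : Stack n p :=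
  WithLp.toLp 2 (fun i => ∑ j, W i j • X j)

/-- `i` is the root of a spanning tree of the digraph induced by the nonnegative matrix `W`, which
has the edge `a → b` iff `0 < W b a`: every `j ≠ i` has a parent `par j`, and passing to parents
repeatedly leads from every node to `i`. -/
def IsSpanningTreeRoot {n : ℕ} (W : Matrix (Fin n) (Fin n) ℝ) (i : Fin n) : Prop :=
  ∃ par : Fin n → Fin n,
    (∀ j, j ≠ i → 0 < W j (par j)) ∧ ∀ j, ∃ m : ℕ, par^[m] j = i

/-- The assumption on the network: `R` and `C` are supported by the strongly connected digraph `G`,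
`R` is (nonnegative and) row stochastic, `C` is (nonnegative and) column stochastic, and the
digraphs induced by `R` and `Cᵀ` have a common root of spanning trees. -/
structure NetworkAssumption {n : ℕ} (G : Digraph (Fin n)) (R C : Matrix (Fin n) (Fin n) ℝ) :
    Prop where
  strongly_connected : ∀ i j, Relation.ReflTransGen G.Adj i j
  support_R : ∀ i j, 0 < R i j → G.Adj j i
  support_C : ∀ i j, 0 < C i j → G.Adj j i
  row_stochastic : R ∈ Matrix.rowStochastic ℝ (Fin n)
  col_stochastic : C ∈ Matrix.colStochastic ℝ (Fin n)
  common_root : ∃ i, IsSpanningTreeRoot R i ∧ IsSpanningTreeRoot C.transpose i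

/-- `u` is a nonnegative right eigenvector of `W` for the eigenvalue `1`, and its entries sum up
to `n`. -/
structure IsPerronVector {n : ℕ} (W : Matrix (Fin n) (Fin n) ℝ) (u : Vec n) : Prop where
  nonneg : ∀ i, 0 ≤ u i
  eigen : ∀ i, ∑ j, W i j * u j = u i
  sum_eq : ∑ i, u i = n

/-! ### The compression operator -/

/-- The constants `C, σ², r, δ, σ_r²` of a compression operator. -/
structure CompConst where
  C : ℝ
  sigmaSq : ℝ
  r : ℝ
  δ : ℝ
  sigmaRSq : ℝ

/-- The compression assumption for a random operator `𝒞` on a Euclidean space `E`; `𝒞 θ x` is the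
outcome for the input `x` when the random seed, which has law `ν`, equals `θ`. -/
structure CompressionAssumption {Θ E : Type*} [MeasurableSpace Θ] [NormedAddCommGroup E]
    [NormedSpace ℝ E] [MeasurableSpace E] (ν : Measure Θ) (𝒞 : Θ → E → E) (c : CompConst) :
    Prop where
  measurable : Measurable (fun z : Θ × E => 𝒞 z.1 z.2)
  C_nonneg : 0 ≤ c.C
  sigmaSq_nonneg : 0 ≤ c.sigmaSq
  r_pos : 0 < c.r
  δ_pos : 0 < c.δ
  δ_le_one : c.δ ≤ 1
  sigmaRSq_nonneg : 0 ≤ c.sigmaRSq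
  integrable : ∀ x, Integrable (fun θ => ‖𝒞 θ x - x‖ ^ 2) ν
  error_le : ∀ x, ∫ θ, ‖𝒞 θ x - x‖ ^ 2 ∂ν ≤ c.C * ‖x‖ ^ 2 + c.sigmaSq
  scaled_error_le : ∀ x,
    ∫ θ, ‖c.r⁻¹ • 𝒞 θ x - x‖ ^ 2 ∂ν ≤ (1 - c.δ) * ‖x‖ ^ 2 + c.sigmaRSq

/-- Compression of a stacked variable when each agent `i` compresses its own row with its own random
operator `c i`. The seed is shared, so that the agents' compression errors may be independent
(`θ` has independent parts, one for each agent) or dependent. -/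
def rowwise {Θ : Type*} {n p : ℕ} (c : Fin n → Θ → Vec p → Vec p) (θ : Θ) (Z : Stack n p) :
    Stack n p :=
  WithLp.toLp 2 (fun i => c i θ (Z i))

/-- The constants for `n` rows together: the absolute errors of the rows add up. -/
def CompConst.total (c : CompConst) (n : ℕ) : CompConst :=
  { c with sigmaSq := n * c.sigmaSq, sigmaRSq := n * c.sigmaRSq }

/-! ### The algorithm -/

/-- Objective functions and all inputs of the algorithm; `Lip i` is the Lipschitz constant of the
gradient of `f i`, and `lam i` is the step-size of agent `i`. -/
structure Input (n p : ℕ) where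
  f : Fin n → Vec p → ℝ
  Lip : Fin n → ℝ
  R : Matrix (Fin n) (Fin n) ℝ
  C : Matrix (Fin n) (Fin n) ℝ
  lam : Fin n → ℝ
  γx : ℝ
  γy : ℝ
  αx : ℝ
  αy : ℝ
  s : ℕ → ℝ
  X0 : Stack n p

namespace Input

variable {n p : ℕ} (D : Input n p)

/-- The global objective `f = (1/n) ∑ f_i`. -/
def obj (x : Vec p) : ℝ := (1 / (n : ℝ)) * ∑ i, D.f i x

/-- The aggregated gradient `∇F(X)`, with rows `∇f_i(x_i)`. -/
def gradF (X : Stack n p) : Stack n p := WithLp.toLp 2 (fun i => gradient (D.f i) (X i))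

/-- `Λ Y` with `Λ = diag(λ_1, …, λ_n)`. -/
def lamMul (Y : Stack n p) : Stack n p := mulStack (Matrix.diagonal D.lam) Y

/-- `L = max L_i`. -/
def L : ℝ := ⨆ i, D.Lip i

/-- `λ̂ = max λ_i`. -/
def lamHat : ℝ := ⨆ i, D.lam i

/-- Each local objective is differentiable with an `L_i`-Lipschitz gradient. -/
def SmoothAssumption : Prop :=
  ∀ i, Differentiable ℝ (D.f i) ∧
    ∀ x x', ‖gradient (D.f i) x - gradient (D.f i) x'‖ ≤ D.Lip i * ‖x - x'‖

end Input

/-- The variables that the algorithm carries from one iteration to the next. -/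
structure State (n p : ℕ) where
  X : Stack n p
  Y : Stack n p
  Hx : Stack n p
  Hy : Stack n p
  HR : Stack n p
  HC : Stack n p

/-- The local update `X̃ = X - Λ Y`. -/
def State.Xtilde {n p : ℕ} (D : Input n p) (S : State n p) : Stack n p := S.X - D.lamMul S.Y

/-- One iteration, with scaling parameter `s`; `cx` and `cy` are the realizations of the compression
operator that are used in this iteration for the `x`- and the `y`-variables. -/
def step {n p : ℕ} (D : Input n p) (s : ℝ) (cx cy : Stack n p → Stack n p) (S : State n p) :
    State n p :=
  let Xt := S.Xtilde D
  let Qx := s • cx (s⁻¹ • (Xt - S.Hx))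
  let Xh := S.Hx + Qx
  let XhR := S.HR + mulStack D.R Qx
  let Hx' := (1 - D.αx) • S.Hx + D.αx • Xh
  let HR' := (1 - D.αx) • S.HR + D.αx • XhR
  let X' := Xt - D.γx • (Xh - XhR)
  let Yt := S.Y + D.gradF X' - D.gradF S.X
  let Qy := s • cy (s⁻¹ • (Yt - S.Hy))
  let Yh := S.Hy + Qy
  let YhC := S.HC + mulStack D.C Qy
  let Hy' := (1 - D.αy) • S.Hy + D.αy • Yh
  let HC' := (1 - D.αy) • S.HC + D.αy • YhC
  let Y' := Yt - D.γy • (Yh - YhC)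
  { X := X', Y := Y', Hx := Hx', Hy := Hy', HR := HR', HC := HC' }

/-- The iterates; `seed k 0` and `seed k 1` are the seeds of the two compressions of iteration
`k`. -/
def iter {n p : ℕ} {Θ : Type*} (D : Input n p) (𝒞 : Θ → Stack n p → Stack n p)
    (seed : ℕ → Fin 2 → Θ) : ℕ → State n p
  | 0 => { X := D.X0, Y := D.gradF D.X0, Hx := 0, Hy := 0, HR := 0, HC := 0 }
  | k + 1 => step D (D.s k) (𝒞 (seed k 0)) (𝒞 (seed k 1)) (iter D 𝒞 seed k)

/-! ### Eigenvectors, weighted norms and their constants -/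

/-- The matrix norm induced by the vector norm `v ↦ ‖W v‖`, for an invertible matrix `W`. -/
def indNorm {n : ℕ} (W A : Matrix (Fin n) (Fin n) ℝ) : ℝ :=
  ‖Matrix.toEuclideanCLM (n := Fin n) (𝕜 := ℝ) (W * A * W⁻¹)‖

/-- `I - γ (I - W)`. -/
def relaxed {n : ℕ} (W : Matrix (Fin n) (Fin n) ℝ) (γ : ℝ) : Matrix (Fin n) (Fin n) ℝ :=
  1 - γ • (1 - W)

/-- `Π_R = I - 1 u_Rᵀ / n`. -/
def projR {n : ℕ} (uR : Vec n) : Matrix (Fin n) (Fin n) ℝ :=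
  1 - (1 / (n : ℝ)) • Matrix.of (fun _ j => uR j)

/-- `Π_C = I - u_C 1ᵀ / n`. -/
def projC {n : ℕ} (uC : Vec n) : Matrix (Fin n) (Fin n) ℝ :=
  1 - (1 / (n : ℝ)) • Matrix.of (fun i _ => uC i)

/-- For a mixing matrix `W` with projection `Pi`: the invertible matrix `T`, which defines the norm
`v ↦ ‖T v‖`, and the constants `d` (the norm equivalence constant) and `θ` (the contraction
constant) have the properties required of the weighted norm, with the contraction at the
consensus step-size `γ`. (`indNorm T Pi ≤ 1` means `= 1`, unless `n = 1` and `Pi = 0`.) -/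
structure IsWeightedNorm {n : ℕ} (W Pi T : Matrix (Fin n) (Fin n) ℝ) (d θ γ : ℝ) : Prop where
  isUnit : IsUnit T
  norm_le : ∀ v : Vec n, ‖v‖ ≤ ‖Matrix.toEuclideanCLM (n := Fin n) (𝕜 := ℝ) T v‖
  le_norm : ∀ v : Vec n, ‖Matrix.toEuclideanCLM (n := Fin n) (𝕜 := ℝ) T v‖ ≤ d * ‖v‖
  θ_pos : 0 < θ
  θ_le_one : θ ≤ 1
  contraction : indNorm T (Pi * relaxed W γ) ≤ 1 - θ * γ
  proj_le : indNorm T Pi ≤ 1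
  mixing_le : indNorm T W ≤ 2
  relaxed_le : indNorm T (relaxed W γ) ≤ 2
  sub_le : indNorm T (1 - W) ≤ 3

/-- The quantities of the analysis: the eigenvectors `u_R, u_C`, the matrices `R̃, C̃` of the weighted
norms, the constants `δ_{R,2}, δ_{C,2}, θ_R, θ_C` of these norms, and the constant `M`. -/
structure Aux (n : ℕ) where
  uR : Vec n
  uC : Vec n
  TR : Matrix (Fin n) (Fin n) ℝ
  TC : Matrix (Fin n) (Fin n) ℝ
  δR : ℝ
  δC : ℝ
  θR : ℝ
  θC : ℝ
  M : ℝ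

/-- `u_R`, `u_C` and the weighted norms are as required for `R, C`, with the contraction at `γx` and
`γy`. -/
structure Aux.Valid {n : ℕ} (W : Aux n) (R C : Matrix (Fin n) (Fin n) ℝ) (γx γy : ℝ) : Prop where
  uR : IsPerronVector R.transpose W.uR
  uC : IsPerronVector C W.uC
  normR : IsWeightedNorm R (projR W.uR) W.TR W.δR W.θR γx
  normC : IsWeightedNorm C (projC W.uC) W.TC W.δC W.θC γy

section Constants

variable {n p : ℕ} (D : Input n p) (W : Aux n) (c : CompConst)

/-- `λ̄ = u_Rᵀ Λ u_C / n`. -/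
def lamBar : ℝ := (1 / (n : ℝ)) * ∑ i, W.uR i * D.lam i * W.uC i

def e1 : ℝ := 2 * W.δC ^ 2 * (1 + 18 * c.C)

def e2 : ℝ := 108 * c.C + 112

def e3 : ℝ := min (1 / (2 * W.δR) * (W.θR / (1 - W.θR * D.γx))) 1

def e4 : ℝ := min (W.θR / (36 * (1 - W.θR * D.γx))) (1 / (3 * √3))

def e5 : ℝ := min (W.θR / (432 * √2 * W.δR)) (1 / 72)

def coefA : ℝ := W.θC * D.γy * W.θR / (108 * e1 W c * D.γx)

def coefB : ℝ := D.L ^ 2 * D.αx * c.r * c.δ * W.θR / (1296 * D.γx)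

def coefD : ℝ := W.θC * D.γy * D.αy * c.r * c.δ * W.θR / (108 * e2 c * D.γx)

def coefE : ℝ := ‖W.uR‖ * ‖W.uC‖ / ((n : ℝ) ^ 2 * W.M)

def β : ℝ := W.θR * D.γx / 8

def zetaC : ℝ := 18 * W.δR ^ 2 * c.sigmaSq / W.θR

def zetaG : ℝ :=
  108 * W.δC ^ 2 * (1 + 18 * c.C) * D.L ^ 2 * c.sigmaSq / W.θC + 18 * W.δC ^ 2 * c.sigmaSq / W.θC

def zetaCx : ℝ :=
  2 * D.αx * c.r * c.sigmaRSq
    + c.sigmaSq * (1 / (4 * D.L ^ 2) + 18) * (18 / (D.αx * c.r * c.δ))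

def zetaCy : ℝ :=
  c.sigmaSq * (18 + 9 * e2 c * D.L ^ 2) * (3 / (D.αy * c.r * c.δ)) + 2 * D.αy * c.r * c.sigmaRSq

def zeta0 : ℝ :=
  D.L ^ 2 * zetaC W c + coefA D W c * zetaG D W c + coefB D W c * zetaCx D c
    + coefD D W c * zetaCy D c

/-- The conditions on the consensus step-sizes `γx, γy` and on the maximum step-size `λ̂`. A bound
whose denominator contains the constant `C` of the compression operator is void if `C = 0`. -/
structure StepSizeCondition : Prop where
  lam_1 : D.lamHat ≤ (1 / 6) * (1 / D.L)
  lam_2 : 0 < c.C → D.lamHat ≤ (1 / (6 * √c.C)) * (1 / D.L)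
  lam_3 : D.lamHat ≤ (1 / W.M) * (1 / D.L)
  lam_4 : D.lamHat ≤ (W.θC / √(54 * e1 W c)) * (1 / D.L)
  lam_5 : D.lamHat ≤ (e3 D W * D.γx / (√(96 * coefE W) * ‖W.uC‖)) * (1 / D.L)
  lam_6 : D.lamHat ≤ (e4 D W * W.θC * D.γy / √(48 * e1 W c)) * (1 / D.L)
  γx_1 : D.γx ≤ 1
  γx_2 : 0 < c.C → D.γx ≤ e5 W * D.αx * c.r * c.δ / √c.C
  γx_3 : D.γx ≤ √(W.M * ‖W.uC‖) / √(108 * ‖W.uR‖ * e1 W c) * W.θC * D.γy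
  γy_1 : D.γy ≤ 1
  γy_2 : D.γy ≤ W.θC * e2 c / (432 * e1 W c)
  γy_3 : 0 < c.C → D.γy ≤ W.θC * (D.αy * c.r * c.δ) ^ 2 / (432 * e2 c * c.C)
  γy_4 : 0 < c.C → D.γy ≤ D.αy * c.r * c.δ / √(1728 * c.C)

end Constants

/-! ### Errors, the Lyapunov function, and the rate -/

/-- The weighted average `x̄ = Xᵀ u_R / n`. -/
def avg {n p : ℕ} (uR : Vec n) (X : Stack n p) : Vec p := (1 / (n : ℝ)) • ∑ i, uR i • X i

section Lyapunov

variable {n p : ℕ} {Θ Ω : Type*} [MeasurableSpace Ω] (D : Input n p) (W : Aux n) (c : CompConst)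
  (𝒞 : Θ → Stack n p → Stack n p) (P : Measure Ω) (ξ : ℕ → Fin 2 → Ω → Θ) (xstar : Vec p)

/-- The random iterates. -/
def iterω (k : ℕ) (ω : Ω) : State n p := iter D 𝒞 (fun l j => ξ l j ω) k

/-- Optimization error `Ω_o^k`. -/
def errO (k : ℕ) : ℝ := ∫ ω, (D.obj (avg W.uR (iterω D 𝒞 ξ k ω).X) - D.obj xstar) ∂P

/-- Consensus error `Ω_c^k`. -/
def errC (k : ℕ) : ℝ :=
  ∫ ω, ‖mulStack W.TR (mulStack (projR W.uR) (iterω D 𝒞 ξ k ω).X)‖ ^ 2 ∂P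

/-- Gradient tracking error `Ω_g^k`. -/
def errG (k : ℕ) : ℝ :=
  ∫ ω, ‖mulStack W.TC (mulStack (projC W.uC) (iterω D 𝒞 ξ k ω).Y)‖ ^ 2 ∂P

/-- Compression error `Ω_cx^k`. -/
def errCx (k : ℕ) : ℝ :=
  ∫ ω, ‖(iterω D 𝒞 ξ k ω).Xtilde D - (iterω D 𝒞 ξ k ω).Hx‖ ^ 2 ∂P

/-- Compression error `Ω_cy^k`. -/
def errCy (k : ℕ) : ℝ := ∫ ω, ‖(iterω D 𝒞 ξ k ω).Y - (iterω D 𝒞 ξ k ω).Hy‖ ^ 2 ∂P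

/-- `V^k`. -/
def V (k : ℕ) : ℝ :=
  D.L ^ 2 * errC D W 𝒞 P ξ k + coefA D W c * errG D W 𝒞 P ξ k + coefB D W c * errCx D 𝒞 P ξ k
    + coefD D W c * errCy D 𝒞 P ξ k

/-- The Lyapunov function `Ω^k`. -/
def lyapunov (k : ℕ) : ℝ :=
  errO D W 𝒞 P ξ xstar k + coefE W * W.M * D.lamHat / β D W * V D W c 𝒞 P ξ k

/-- The claimed rate: the squared gradient norms at the averages `x̄^k` have finite expectations, and
for every `K ≥ 1` their mean over the first `K` iterations obeys the bound. -/
def SublinearRate (a₀ a : ℝ) : Prop :=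
  (∀ k, Integrable (fun ω => ‖gradient D.obj (avg W.uR (iterω D 𝒞 ξ k ω).X)‖ ^ 2) P) ∧
  ∀ K : ℕ, 1 ≤ K →
    (1 / (K : ℝ)) *
        ∑ k ∈ Finset.range K, ∫ ω, ‖gradient D.obj (avg W.uR (iterω D 𝒞 ξ k ω).X)‖ ^ 2 ∂P
      ≤ 4 * lyapunov D W c 𝒞 P ξ xstar 0 / (W.M * D.lamHat * K)
        + 4 * coefE W * (a₀ / (1 - a)) * zeta0 D W c / (β D W * K)

end Lyapunov

end RCPP

end

namespace RCPP

/-! ### Linear algebra of stacked variables -/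

section StackAlgebra

variable {n p : ℕ}

@[simp] lemma mulStack_apply (W : Matrix (Fin n) (Fin n) ℝ) (X : Stack n p) (i : Fin n) :
    mulStack W X i = ∑ j, W i j • X j := rfl

lemma mulStack_add (W : Matrix (Fin n) (Fin n) ℝ) (X Y : Stack n p) :
    mulStack W (X + Y) = mulStack W X + mulStack W Y := by
  ext1 i
  simp [smul_add, Finset.sum_add_distrib]

lemma mulStack_sub (W : Matrix (Fin n) (Fin n) ℝ) (X Y : Stack n p) :
    mulStack W (X - Y) = mulStack W X - mulStack W Y := by
  ext1 i
  simp [smul_sub, Finset.sum_sub_distrib]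

lemma mulStack_smul (W : Matrix (Fin n) (Fin n) ℝ) (t : ℝ) (X : Stack n p) :
    mulStack W (t • X) = t • mulStack W X := by
  ext1 i
  simp only [mulStack_apply, PiLp.smul_apply, Finset.smul_sum]
  exact Finset.sum_congr rfl fun j _ => smul_comm _ _ _

@[simp] lemma mulStack_zero (W : Matrix (Fin n) (Fin n) ℝ) : mulStack W (0 : Stack n p) = 0 := by
  ext1 i
  simp

lemma sub_mulStack (V W : Matrix (Fin n) (Fin n) ℝ) (X : Stack n p) :
    mulStack (V - W) X = mulStack V X - mulStack W X := by
  ext1 i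
  simp [sub_smul, Finset.sum_sub_distrib]

lemma smul_mulStack (t : ℝ) (W : Matrix (Fin n) (Fin n) ℝ) (X : Stack n p) :
    mulStack (t • W) X = t • mulStack W X := by
  ext1 i
  simp [Finset.smul_sum, mul_smul]

@[simp] lemma one_mulStack (X : Stack n p) : mulStack 1 X = X := by
  ext1 i
  simp [Matrix.one_apply]

lemma mul_mulStack (V W : Matrix (Fin n) (Fin n) ℝ) (X : Stack n p) :
    mulStack (V * W) X = mulStack V (mulStack W X) := by
  ext1 i
  simp only [mulStack_apply, Matrix.mul_apply, Finset.sum_smul, Finset.smul_sum, mul_smul]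
  rw [Finset.sum_comm]

lemma relaxed_mulStack (W : Matrix (Fin n) (Fin n) ℝ) (γ : ℝ) (X : Stack n p) :
    mulStack (relaxed W γ) X = X - γ • mulStack (1 - W) X := by
  rw [relaxed, sub_mulStack, smul_mulStack, one_mulStack]

/-- The columns of a stacked variable. -/
def col (X : Stack n p) (c : Fin p) : Vec n := WithLp.toLp 2 (fun i => X i c)

lemma norm_sq_eq_sum_col (X : Stack n p) : ‖X‖ ^ 2 = ∑ c, ‖col X c‖ ^ 2 := by
  simp only [PiLp.norm_sq_eq_of_L2, col]
  rw [Finset.sum_comm]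

lemma col_mulStack (W : Matrix (Fin n) (Fin n) ℝ) (X : Stack n p) (c : Fin p) :
    col (mulStack W X) c = Matrix.toEuclideanCLM (n := Fin n) (𝕜 := ℝ) W (col X c) := by
  ext i
  simp [col, Matrix.mulVec, dotProduct]

lemma norm_mulStack_le_of_forall {A B : Matrix (Fin n) (Fin n) ℝ} {t : ℝ} (ht : 0 ≤ t)
    (h : ∀ v : Vec n, ‖Matrix.toEuclideanCLM (n := Fin n) (𝕜 := ℝ) A v‖
      ≤ t * ‖Matrix.toEuclideanCLM (n := Fin n) (𝕜 := ℝ) B v‖) (X : Stack n p) :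
    ‖mulStack A X‖ ≤ t * ‖mulStack B X‖ := by
  refine le_of_sq_le_sq ?_ (by positivity)
  rw [mul_pow, norm_sq_eq_sum_col, norm_sq_eq_sum_col, Finset.mul_sum]
  refine Finset.sum_le_sum fun c _ => ?_
  rw [col_mulStack, col_mulStack, ← mul_pow]
  exact pow_le_pow_left₀ (norm_nonneg _) (h _) 2

lemma norm_mulStack_diagonal_le {l : Fin n → ℝ} {t : ℝ} (h : ∀ i, |l i| ≤ t) (ht : 0 ≤ t)
    (X : Stack n p) : ‖mulStack (Matrix.diagonal l) X‖ ≤ t * ‖X‖ := by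
  refine le_of_sq_le_sq ?_ (by positivity)
  rw [mul_pow, PiLp.norm_sq_eq_of_L2, PiLp.norm_sq_eq_of_L2, Finset.mul_sum]
  refine Finset.sum_le_sum fun i _ => ?_
  have : mulStack (Matrix.diagonal l) X i = l i • X i := by
    simp [Matrix.diagonal_apply]
  rw [this, norm_smul, mul_pow]
  gcongr
  exact h i

lemma indNorm_nonneg (W A : Matrix (Fin n) (Fin n) ℝ) : 0 ≤ indNorm W A := norm_nonneg _

lemma norm_apply_le_indNorm {T : Matrix (Fin n) (Fin n) ℝ} (hT : IsUnit T)
    (A : Matrix (Fin n) (Fin n) ℝ) (v : Vec n) :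
    ‖Matrix.toEuclideanCLM (n := Fin n) (𝕜 := ℝ) (T * A) v‖
      ≤ indNorm T A * ‖Matrix.toEuclideanCLM (n := Fin n) (𝕜 := ℝ) T v‖ := by
  have hdet := (Matrix.isUnit_iff_isUnit_det T).1 hT
  have : T * A = T * A * T⁻¹ * T := by
    rw [Matrix.mul_assoc (T * A), Matrix.nonsing_inv_mul _ hdet, Matrix.mul_one]
  rw [this, map_mul, mul_apply_eq_comp]
  exact ContinuousLinearMap.le_opNorm _ _

lemma indNorm_le_of_forall {T A : Matrix (Fin n) (Fin n) ℝ} (hT : IsUnit T) {t : ℝ} (ht : 0 ≤ t)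
    (h : ∀ v : Vec n, ‖Matrix.toEuclideanCLM (n := Fin n) (𝕜 := ℝ) (T * A) v‖
      ≤ t * ‖Matrix.toEuclideanCLM (n := Fin n) (𝕜 := ℝ) T v‖) : indNorm T A ≤ t := by
  have hdet := (Matrix.isUnit_iff_isUnit_det T).1 hT
  refine ContinuousLinearMap.opNorm_le_bound _ ht fun v => ?_
  rw [map_mul, mul_apply_eq_comp]
  refine (h _).trans_eq ?_
  rw [← mul_apply_eq_comp, ← map_mul, Matrix.mul_nonsing_inv _ hdet, map_one,
    one_apply_eq_self]

lemma norm_mulStack_mulStack_le {T : Matrix (Fin n) (Fin n) ℝ} (hT : IsUnit T)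
    (A : Matrix (Fin n) (Fin n) ℝ) (X : Stack n p) :
    ‖mulStack T (mulStack A X)‖ ≤ indNorm T A * ‖mulStack T X‖ := by
  rw [← mul_mulStack]
  exact norm_mulStack_le_of_forall (indNorm_nonneg _ _) (norm_apply_le_indNorm hT A) X

namespace IsWeightedNorm

variable {W Pi T : Matrix (Fin n) (Fin n) ℝ} {d θ γ : ℝ}

lemma norm_le_stack (h : IsWeightedNorm W Pi T d θ γ) (X : Stack n p) :
    ‖X‖ ≤ ‖mulStack T X‖ := by
  have := norm_mulStack_le_of_forall (A := 1) (B := T) zero_le_one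
    (fun v => by simpa using h.norm_le v) X
  simpa using this

lemma one_le [NeZero n] (h : IsWeightedNorm W Pi T d θ γ) : 1 ≤ d := by
  have h1 := (h.norm_le (EuclideanSpace.single 0 1)).trans (h.le_norm _)
  simpa using h1

lemma stack_le_norm [NeZero n] (h : IsWeightedNorm W Pi T d θ γ) (X : Stack n p) :
    ‖mulStack T X‖ ≤ d * ‖X‖ := by
  have := norm_mulStack_le_of_forall (A := T) (B := 1) (zero_le_one.trans h.one_le)
    (fun v => by simpa using h.le_norm v) X
  simpa using this

lemma θ_mul_le_one (h : IsWeightedNorm W Pi T d θ γ) : θ * γ ≤ 1 := by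
  have := (indNorm_nonneg _ _).trans h.contraction
  linarith

/-- The complementary projection does not increase the weighted norm either. -/
lemma norm_compl_le (h : IsWeightedNorm W Pi T d θ γ) (hPi : Pi * Pi = Pi) (v : Vec n) :
    ‖Matrix.toEuclideanCLM (n := Fin n) (𝕜 := ℝ) (T * (1 - Pi)) v‖
      ≤ ‖Matrix.toEuclideanCLM (n := Fin n) (𝕜 := ℝ) T v‖ := by
  set φ := Matrix.toEuclideanCLM (n := Fin n) (𝕜 := ℝ) with hφ
  set a := φ (T * Pi) v with ha
  set b := φ (T * (1 - Pi)) v with hb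
  have hab : φ T v = a + b := by
    rw [ha, hb, ← add_apply, ← map_add, ← Matrix.mul_add]
    simp
  have key : ∀ t : ℝ, ‖a‖ ≤ ‖a + t • b‖ := by
    intro t
    have h1 := (norm_apply_le_indNorm h.isUnit Pi (φ Pi v + t • φ (1 - Pi) v)).trans
      (mul_le_of_le_one_left (norm_nonneg _) h.proj_le)
    have h2 : Matrix.toEuclideanCLM (n := Fin n) (𝕜 := ℝ) (T * Pi)
        (φ Pi v + t • φ (1 - Pi) v) = a := by
      rw [map_add, map_smul, ← hφ, ← mul_apply_eq_comp,
        ← mul_apply_eq_comp, ← map_mul, ← map_mul, Matrix.mul_assoc, hPi,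
        Matrix.mul_assoc T Pi (1 - Pi), Matrix.mul_sub, hPi]
      simp [ha]
    have h3 : Matrix.toEuclideanCLM (n := Fin n) (𝕜 := ℝ) T
        (φ Pi v + t • φ (1 - Pi) v) = a + t • b := by
      rw [map_add, map_smul, ← hφ, ← mul_apply_eq_comp,
        ← mul_apply_eq_comp, ← map_mul, ← map_mul]
    rwa [h2, h3] at h1
  have horth : inner ℝ a b = 0 := by
    have hsq : ∀ t : ℝ, 0 ≤ 2 * t * inner ℝ a b + t ^ 2 * ‖b‖ ^ 2 := by
      intro t
      have := pow_le_pow_left₀ (norm_nonneg _) (key t) 2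
      rw [norm_add_sq_real, inner_smul_right, norm_smul, mul_pow, Real.norm_eq_abs, sq_abs] at this
      linarith
    by_contra hne
    set s := inner ℝ a b
    have h1 := hsq (-s / (‖b‖ ^ 2 + 1))
    have hpos : 0 < ‖b‖ ^ 2 + 1 := by positivity
    have h2 : 2 * (-s / (‖b‖ ^ 2 + 1)) * s + (-s / (‖b‖ ^ 2 + 1)) ^ 2 * ‖b‖ ^ 2
        = -(s ^ 2 * (‖b‖ ^ 2 + 2)) / (‖b‖ ^ 2 + 1) ^ 2 := by
      field_simp
      ring
    rw [h2] at h1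
    have : 0 < s ^ 2 * (‖b‖ ^ 2 + 2) / (‖b‖ ^ 2 + 1) ^ 2 := by positivity
    rw [neg_div] at h1
    linarith
  rw [hab]
  refine le_of_sq_le_sq ?_ (norm_nonneg _)
  rw [norm_add_sq_real, horth]
  nlinarith [sq_nonneg ‖a‖]

end IsWeightedNorm

end StackAlgebra

/-! ### The projections and the averages -/

section Projections

variable {n p : ℕ}

lemma projR_apply (u : Vec n) (i j : Fin n) :
    projR u i j = (1 : Matrix (Fin n) (Fin n) ℝ) i j - (1 / (n : ℝ)) * u j := by
  simp [projR]

lemma projC_apply (u : Vec n) (i j : Fin n) :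
    projC u i j = (1 : Matrix (Fin n) (Fin n) ℝ) i j - (1 / (n : ℝ)) * u i := by
  simp [projC]

lemma projC_eq_transpose (u : Vec n) : projC u = (projR u).transpose := by
  ext i j
  simp [projR_apply, projC_apply, Matrix.one_apply, eq_comm]

lemma projR_mul_self [NeZero n] {u : Vec n} (hu : ∑ i, u i = n) :
    projR u * projR u = projR u := by
  have hn : (n : ℝ) ≠ 0 := NeZero.ne _
  have : Matrix.of (fun _ j => u j) * Matrix.of (fun _ j => u j)
      = (n : ℝ) • (Matrix.of (fun _ j => u j) : Matrix (Fin n) (Fin n) ℝ) := by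
    ext i j
    simp [Matrix.mul_apply, ← Finset.sum_mul, hu]
  rw [projR, Matrix.sub_mul, Matrix.mul_sub, Matrix.mul_sub, Matrix.one_mul, Matrix.mul_one,
    Matrix.one_mul, Matrix.smul_mul, Matrix.mul_smul, this, smul_smul, smul_smul]
  rw [show 1 / (n : ℝ) * (1 / n) * n = 1 / n by field_simp]
  abel

lemma projR_comm {W : Matrix (Fin n) (Fin n) ℝ} {u : Vec n} (hW : ∀ i, ∑ j, W i j = 1)
    (hu : ∀ j, ∑ i, u i * W i j = u j) : projR u * W = W * projR u := by
  rw [projR, Matrix.sub_mul, Matrix.mul_sub, Matrix.one_mul, Matrix.mul_one, Matrix.smul_mul,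
    Matrix.mul_smul]
  congr 2
  ext i j
  simp [Matrix.mul_apply, hu, ← Finset.sum_mul, hW]

lemma relaxed_comm {W Pi : Matrix (Fin n) (Fin n) ℝ} (h : Pi * W = W * Pi) (γ : ℝ) :
    Pi * relaxed W γ = relaxed W γ * Pi := by
  simp only [relaxed, Matrix.mul_sub, Matrix.sub_mul, Matrix.smul_mul, Matrix.mul_smul, h,
    Matrix.mul_one, Matrix.one_mul]

lemma relaxed_transpose (W : Matrix (Fin n) (Fin n) ℝ) (γ : ℝ) :
    relaxed W.transpose γ = (relaxed W γ).transpose := by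
  simp [relaxed, Matrix.transpose_sub, Matrix.transpose_smul]

lemma IsPerronVector.norm_pos [NeZero n] {W : Matrix (Fin n) (Fin n) ℝ} {u : Vec n}
    (h : IsPerronVector W u) : 0 < ‖u‖ := by
  rw [norm_pos_iff]
  rintro rfl
  have := h.sum_eq
  simp at this
  exact NeZero.ne n (by exact_mod_cast this.symm)

lemma projC_mul_self [NeZero n] {u : Vec n} (hu : ∑ i, u i = n) :
    projC u * projC u = projC u := by
  rw [projC_eq_transpose, ← Matrix.transpose_mul, projR_mul_self hu]

lemma projC_comm {W : Matrix (Fin n) (Fin n) ℝ} {u : Vec n} (hW : ∀ j, ∑ i, W i j = 1)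
    (hu : ∀ i, ∑ j, W i j * u j = u i) : projC u * W = W * projC u := by
  have := projR_comm (W := W.transpose) (u := u) (by simpa using hW)
    (by simpa [mul_comm] using hu)
  rw [projC_eq_transpose]
  apply Matrix.transpose_injective
  rw [Matrix.transpose_mul, Matrix.transpose_mul, Matrix.transpose_transpose, this]

lemma projR_mulStack (u : Vec n) (X : Stack n p) (i : Fin n) :
    mulStack (projR u) X i = X i - avg u X := by
  simp [projR_apply, sub_smul, Finset.sum_sub_distrib, Matrix.one_apply, avg, Finset.smul_sum,
    mul_smul]

lemma projC_mulStack (u : Vec n) (X : Stack n p) (i : Fin n) :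
    mulStack (projC u) X i = X i - u i • ((1 / (n : ℝ)) • ∑ j, X j) := by
  simp [projC_apply, sub_smul, Finset.sum_sub_distrib, Matrix.one_apply, Finset.smul_sum,
    mul_smul, smul_comm (u i)]

lemma avg_sub (u : Vec n) (X Y : Stack n p) : avg u (X - Y) = avg u X - avg u Y := by
  simp [avg, smul_sub, Finset.sum_sub_distrib]

lemma avg_smul (u : Vec n) (t : ℝ) (X : Stack n p) : avg u (t • X) = t • avg u X := by
  simp only [avg, PiLp.smul_apply, Finset.smul_sum]
  exact Finset.sum_congr rfl fun i _ => by rw [smul_comm t, smul_comm t]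

lemma avg_mulStack {W : Matrix (Fin n) (Fin n) ℝ} {u : Vec n}
    (hu : ∀ j, ∑ i, u i * W i j = u j) (X : Stack n p) : avg u (mulStack W X) = avg u X := by
  simp only [avg, mulStack_apply, Finset.smul_sum, smul_smul]
  rw [Finset.sum_comm]
  refine Finset.sum_congr rfl fun j _ => ?_
  rw [← Finset.sum_smul, ← hu j, Finset.mul_sum]

lemma sum_mulStack {W : Matrix (Fin n) (Fin n) ℝ} (hW : ∀ j, ∑ i, W i j = 1) (X : Stack n p) :
    ∑ i, mulStack W X i = ∑ i, X i := by
  simp only [mulStack_apply]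
  rw [Finset.sum_comm]
  refine Finset.sum_congr rfl fun j _ => ?_
  rw [← Finset.sum_smul, hW, one_smul]

lemma norm_sum_smul_le (u : Vec n) (X : Stack n p) : ‖∑ i, u i • X i‖ ≤ ‖u‖ * ‖X‖ := by
  calc ‖∑ i, u i • X i‖ ≤ ∑ i, ‖u i‖ * ‖X i‖ := by
        refine (norm_sum_le _ _).trans_eq ?_
        simp [norm_smul]
    _ ≤ √(∑ i, ‖u i‖ ^ 2) * √(∑ i, ‖X i‖ ^ 2) := Real.sum_mul_le_sqrt_mul_sqrt _ _ _
    _ = ‖u‖ * ‖X‖ := by rw [PiLp.norm_eq_of_L2, PiLp.norm_eq_of_L2]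

lemma norm_avg_le (u : Vec n) (X : Stack n p) : ‖avg u X‖ ≤ ‖u‖ / n * ‖X‖ := by
  rw [avg, norm_smul, Real.norm_of_nonneg (by positivity)]
  calc 1 / (n : ℝ) * ‖∑ i, u i • X i‖ ≤ 1 / n * (‖u‖ * ‖X‖) := by
        gcongr
        exact norm_sum_smul_le u X
    _ = ‖u‖ / n * ‖X‖ := by ring

/-- A weighted norm in which `Π_C` is a contraction has a large equivalence constant. -/
lemma norm_sq_le_projC [NeZero n] {W T : Matrix (Fin n) (Fin n) ℝ} {u : Vec n} {d θ γ : ℝ}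
    (h : IsWeightedNorm W (projC u) T d θ γ) (hu : ∑ i, u i = n) : ‖u‖ ^ 2 ≤ n * d ^ 2 := by
  have hn : (n : ℝ) ≠ 0 := NeZero.ne _
  set e : Vec n := WithLp.toLp 2 (fun _ => 1) with he
  have he2 : ‖e‖ ^ 2 = n := by simp [he, EuclideanSpace.norm_sq_eq]
  have h1 := h.norm_compl_le (projC_mul_self hu) e
  have h2 : Matrix.toEuclideanCLM (n := Fin n) (𝕜 := ℝ) (1 - projC u) e = u := by
    ext i
    simp [projC, Matrix.mulVec, dotProduct, he]
    field_simp
  rw [map_mul, mul_apply_eq_comp, h2] at h1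
  have h3 := ((h.norm_le u).trans h1).trans (h.le_norm e)
  calc ‖u‖ ^ 2 ≤ (d * ‖e‖) ^ 2 := pow_le_pow_left₀ (norm_nonneg _) h3 2
    _ = n * d ^ 2 := by rw [mul_pow, he2]; ring

lemma norm_sq_le_projR [NeZero n] {W T : Matrix (Fin n) (Fin n) ℝ} {u : Vec n} {d θ γ : ℝ}
    (h : IsWeightedNorm W (projR u) T d θ γ) (hu : ∑ i, u i = n) : ‖u‖ ^ 2 ≤ n * d ^ 2 := by
  have hn : (0 : ℝ) < n := by exact_mod_cast NeZero.pos n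
  set e : Vec n := WithLp.toLp 2 (fun _ => 1) with he
  have he2 : ‖e‖ ^ 2 = n := by simp [he, EuclideanSpace.norm_sq_eq]
  have h1 := h.norm_compl_le (projR_mul_self hu) u
  have h2 : Matrix.toEuclideanCLM (n := Fin n) (𝕜 := ℝ) (1 - projR u) u
      = (‖u‖ ^ 2 / n) • e := by
    ext i
    simp only [projR, sub_sub_cancel, Matrix.ofLp_toEuclideanCLM, Matrix.mulVec, dotProduct, he,
      EuclideanSpace.norm_sq_eq, Matrix.smul_apply, Matrix.of_apply, PiLp.smul_apply, smul_eq_mul,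
      mul_one, Real.norm_eq_abs, sq_abs, Finset.sum_div]
    refine Finset.sum_congr rfl fun j _ => ?_
    ring
  rw [map_mul, mul_apply_eq_comp, h2] at h1
  have h3 := ((h.norm_le _).trans h1).trans (h.le_norm u)
  rw [norm_smul, Real.norm_of_nonneg (by positivity)] at h3
  rcases eq_or_lt_of_le (norm_nonneg u) with h0 | h0
  · rw [← h0, zero_pow two_ne_zero]
    positivity
  have h4 : ‖u‖ * ‖e‖ ≤ n * d := by
    have : ‖u‖ * (‖u‖ * ‖e‖) ≤ ‖u‖ * (n * d) := by
      rw [div_mul_eq_mul_div, div_le_iff₀ hn] at h3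
      linarith
    exact le_of_mul_le_mul_left this h0
  have h5 := pow_le_pow_left₀ (by positivity) h4 2
  rw [mul_pow, he2, mul_pow] at h5
  have h6 : (n : ℝ) * ‖u‖ ^ 2 ≤ n * (n * d ^ 2) := by linarith
  exact le_of_mul_le_mul_left h6 hn

end Projections

/-! ### One mixing step in the weighted norm -/

lemma sq_norm_add_add_le {E : Type*} [SeminormedAddCommGroup E] (a b c : E) :
    ‖a + b + c‖ ^ 2 ≤ 3 * (‖a‖ ^ 2 + ‖b‖ ^ 2 + ‖c‖ ^ 2) := by
  have h := norm_add₃_le (a := a) (b := b) (c := c)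
  have h2 := pow_le_pow_left₀ (norm_nonneg _) h 2
  nlinarith [sq_nonneg (‖a‖ - ‖b‖), sq_nonneg (‖a‖ - ‖c‖), sq_nonneg (‖b‖ - ‖c‖)]

lemma sq_norm_add_le_two {E : Type*} [SeminormedAddCommGroup E] (a b : E) :
    ‖a + b‖ ^ 2 ≤ 2 * (‖a‖ ^ 2 + ‖b‖ ^ 2) := by
  have h2 := pow_le_pow_left₀ (norm_nonneg _) (norm_add_le a b) 2
  nlinarith [sq_nonneg (‖a‖ - ‖b‖)]

lemma sq_norm_add_le_young {E : Type*} [SeminormedAddCommGroup E] (a b : E) {t : ℝ} (ht : 0 < t) :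
    ‖a + b‖ ^ 2 ≤ (1 + t) * ‖a‖ ^ 2 + (1 + 1 / t) * ‖b‖ ^ 2 := by
  have h2 := pow_le_pow_left₀ (norm_nonneg _) (norm_add_le a b) 2
  have h3 : t * ‖a‖ ^ 2 + 1 / t * ‖b‖ ^ 2 - 2 * ‖a‖ * ‖b‖ = (t * ‖a‖ - ‖b‖) ^ 2 / t := by
    field_simp
    ring
  have h4 : 0 ≤ (t * ‖a‖ - ‖b‖) ^ 2 / t := by positivity
  nlinarith

section Mixing

variable {n p : ℕ} {W Pi T : Matrix (Fin n) (Fin n) ℝ} {d θ γ : ℝ}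

lemma IsWeightedNorm.norm_sub_mixing_le (h : IsWeightedNorm W Pi T d θ γ) (X : Stack n p) :
    ‖mulStack T (mulStack (1 - W) X)‖ ≤ 3 * ‖mulStack T X‖ :=
  (norm_mulStack_mulStack_le h.isUnit _ X).trans
    (mul_le_mul_of_nonneg_right h.sub_le (norm_nonneg _))

variable [NeZero n]

/-- Contraction of the disagreement in one perturbed mixing step. -/
lemma IsWeightedNorm.mixing_sq_le (h : IsWeightedNorm W Pi T d θ γ) (hγ : 0 < γ)
    (hPi : Pi * Pi = Pi) (hcomm : Pi * W = W * Pi) (U Z e : Stack n p) :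
    ‖mulStack T (mulStack Pi (mulStack (relaxed W γ) (U + Z) - γ • mulStack (1 - W) e))‖ ^ 2
      ≤ (1 - θ * γ) * ‖mulStack T (mulStack Pi U)‖ ^ 2
        + 2 * (1 - θ * γ) ^ 2 * d ^ 2 / (θ * γ) * ‖Z‖ ^ 2 + 18 * γ * d ^ 2 / θ * ‖e‖ ^ 2 := by
  have hθ := h.θ_pos
  have hκ : 0 < θ * γ := mul_pos hθ hγ
  have hκ1 := h.θ_mul_le_one
  have hd := h.one_le
  set x := ‖mulStack T (mulStack Pi U)‖ with hx
  have hP : Pi * relaxed W γ * Pi = Pi * relaxed W γ := by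
    rw [relaxed_comm hcomm, Matrix.mul_assoc, hPi]
  have hsplit : mulStack T (mulStack Pi (mulStack (relaxed W γ) (U + Z) - γ • mulStack (1 - W) e))
      = mulStack T (mulStack (Pi * relaxed W γ) (mulStack Pi U))
        + mulStack T (mulStack (Pi * relaxed W γ) Z)
        + (-γ) • mulStack T (mulStack Pi (mulStack (1 - W) e)) := by
    rw [← mul_mulStack (Pi * relaxed W γ) Pi, hP]
    simp only [mulStack_sub, mulStack_add, mulStack_smul, mul_mulStack, neg_smul]
    abel
  have h1 : ‖mulStack T (mulStack (Pi * relaxed W γ) (mulStack Pi U))‖ ≤ (1 - θ * γ) * x :=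
    (norm_mulStack_mulStack_le h.isUnit _ _).trans
      (mul_le_mul_of_nonneg_right h.contraction (norm_nonneg _))
  have h2 : ‖mulStack T (mulStack (Pi * relaxed W γ) Z)‖ ≤ (1 - θ * γ) * (d * ‖Z‖) :=
    (norm_mulStack_mulStack_le h.isUnit _ _).trans
      (mul_le_mul h.contraction (h.stack_le_norm Z) (norm_nonneg _) (by linarith))
  have h3 : ‖(-γ) • mulStack T (mulStack Pi (mulStack (1 - W) e))‖ ≤ γ * (3 * (d * ‖e‖)) := by
    rw [norm_smul, norm_neg, Real.norm_of_nonneg hγ.le]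
    refine mul_le_mul_of_nonneg_left ?_ hγ.le
    refine ((norm_mulStack_mulStack_le h.isUnit _ _).trans
      (mul_le_of_le_one_left (norm_nonneg _) h.proj_le)).trans ((h.norm_sub_mixing_le e).trans ?_)
    exact mul_le_mul_of_nonneg_left (h.stack_le_norm e) (by norm_num)
  have h4 : ‖mulStack T (mulStack Pi (mulStack (relaxed W γ) (U + Z) - γ • mulStack (1 - W) e))‖
      ≤ (1 - θ * γ) * x + ((1 - θ * γ) * (d * ‖Z‖) + γ * (3 * (d * ‖e‖))) := by
    rw [hsplit]
    refine norm_add₃_le.trans ?_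
    linarith
  refine (pow_le_pow_left₀ (norm_nonneg _) h4 2).trans ?_
  set κ := θ * γ with hκdef
  set P := (1 - κ) * (d * ‖Z‖)
  set Q := γ * (3 * (d * ‖e‖))
  have e1 : 2 * (1 - κ) ^ 2 * d ^ 2 / κ * ‖Z‖ ^ 2 = 2 * P ^ 2 / κ := by
    simp only [P]
    ring
  have e2 : 18 * γ * d ^ 2 / θ * ‖e‖ ^ 2 = 2 * Q ^ 2 / κ := by
    simp only [Q, hκdef]
    field_simp
    ring
  rw [e1, e2]
  have e3 : (P + Q) ^ 2 / κ ≤ 2 * P ^ 2 / κ + 2 * Q ^ 2 / κ := by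
    rw [← add_div]
    gcongr
    nlinarith [sq_nonneg (P - Q)]
  have e4 : (1 - κ) * x ^ 2 + (P + Q) ^ 2 / κ - ((1 - κ) * x + (P + Q)) ^ 2
      = (1 - κ) * (κ * x - (P + Q)) ^ 2 / κ := by
    field_simp
    ring
  have e5 : 0 ≤ (1 - κ) * (κ * x - (P + Q)) ^ 2 / κ :=
    div_nonneg (mul_nonneg (by linarith) (sq_nonneg _)) hκ.le
  linarith

/-- The length of one perturbed mixing step. -/
lemma IsWeightedNorm.mixing_sub_sq_le (h : IsWeightedNorm W Pi T d θ γ) (hγ : 0 < γ)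
    (hker : (1 - W) * Pi = 1 - W) (U Z e : Stack n p) :
    ‖mulStack (relaxed W γ) (U + Z) - γ • mulStack (1 - W) e - U‖ ^ 2
      ≤ 12 * d ^ 2 * ‖Z‖ ^ 2 + 27 * γ ^ 2 * ‖mulStack T (mulStack Pi U)‖ ^ 2
        + 27 * γ ^ 2 * d ^ 2 * ‖e‖ ^ 2 := by
  have hd := h.one_le
  have hsplit : mulStack (relaxed W γ) (U + Z) - γ • mulStack (1 - W) e - U
      = mulStack (relaxed W γ) Z + (-γ) • mulStack (1 - W) (mulStack Pi U)
        + (-γ) • mulStack (1 - W) e := by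
    rw [← mul_mulStack (1 - W) Pi, hker, mulStack_add, relaxed_mulStack W γ U]
    simp only [neg_smul]
    abel
  have h1 : ‖mulStack (relaxed W γ) Z‖ ≤ 2 * (d * ‖Z‖) :=
    (h.norm_le_stack _).trans <| (norm_mulStack_mulStack_le h.isUnit _ _).trans
      (mul_le_mul h.relaxed_le (h.stack_le_norm Z) (norm_nonneg _) (by norm_num))
  have h2 : ‖(-γ) • mulStack (1 - W) (mulStack Pi U)‖
      ≤ γ * (3 * ‖mulStack T (mulStack Pi U)‖) := by
    rw [norm_smul, norm_neg, Real.norm_of_nonneg hγ.le]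
    exact mul_le_mul_of_nonneg_left ((h.norm_le_stack _).trans (h.norm_sub_mixing_le _)) hγ.le
  have h3 : ‖(-γ) • mulStack (1 - W) e‖ ≤ γ * (3 * (d * ‖e‖)) := by
    rw [norm_smul, norm_neg, Real.norm_of_nonneg hγ.le]
    refine mul_le_mul_of_nonneg_left ?_ hγ.le
    exact ((h.norm_le_stack _).trans (h.norm_sub_mixing_le _)).trans
      (mul_le_mul_of_nonneg_left (h.stack_le_norm e) (by norm_num))
  rw [hsplit]
  refine (sq_norm_add_add_le _ _ _).trans ?_
  have k1 := pow_le_pow_left₀ (norm_nonneg _) h1 2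
  have k2 := pow_le_pow_left₀ (norm_nonneg _) h2 2
  have k3 := pow_le_pow_left₀ (norm_nonneg _) h3 2
  linarith

lemma IsWeightedNorm.smul_mixing_sq_le (h : IsWeightedNorm W Pi T d θ γ) (hγ : 0 < γ)
    (hker : (1 - W) * Pi = 1 - W) (U Z e : Stack n p) :
    ‖γ • mulStack (1 - W) (U + Z + e)‖ ^ 2
      ≤ 27 * γ ^ 2 * (‖mulStack T (mulStack Pi U)‖ ^ 2 + d ^ 2 * ‖Z‖ ^ 2 + d ^ 2 * ‖e‖ ^ 2) := by
  have hd := h.one_le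
  have hsplit : mulStack (1 - W) (U + Z + e) = mulStack (1 - W) (mulStack Pi U)
      + mulStack (1 - W) Z + mulStack (1 - W) e := by
    rw [← mul_mulStack (1 - W) Pi, hker, mulStack_add, mulStack_add]
  have h0 : ∀ Z : Stack n p, ‖mulStack (1 - W) Z‖ ≤ 3 * ‖mulStack T Z‖ := fun Z =>
    (h.norm_le_stack _).trans (h.norm_sub_mixing_le _)
  have h1 : ∀ Z : Stack n p, ‖mulStack (1 - W) Z‖ ≤ 3 * (d * ‖Z‖) := fun Z =>
    (h0 Z).trans (mul_le_mul_of_nonneg_left (h.stack_le_norm Z) (by norm_num))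
  rw [norm_smul, Real.norm_of_nonneg hγ.le, mul_pow, hsplit]
  have k0 := sq_norm_add_add_le (mulStack (1 - W) (mulStack Pi U)) (mulStack (1 - W) Z)
    (mulStack (1 - W) e)
  have k1 := pow_le_pow_left₀ (norm_nonneg _) (h0 (mulStack Pi U)) 2
  have k2 := pow_le_pow_left₀ (norm_nonneg _) (h1 Z) 2
  have k3 := pow_le_pow_left₀ (norm_nonneg _) (h1 e) 2
  calc _ ≤ γ ^ 2 * (27 * (‖mulStack T (mulStack Pi U)‖ ^ 2 + d ^ 2 * ‖Z‖ ^ 2 + d ^ 2 * ‖e‖ ^ 2)) := by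
        refine mul_le_mul_of_nonneg_left ?_ (sq_nonneg _)
        linarith
    _ = _ := by ring

end Mixing

/-! ### Smoothness -/

/-- The quadratic upper bound for a function with Lipschitz gradient. -/
lemma le_add_of_lipschitz_gradient {E : Type*} [NormedAddCommGroup E] [InnerProductSpace ℝ E]
    [CompleteSpace E] {f : E → ℝ} {L : ℝ} (hf : Differentiable ℝ f)
    (hL : ∀ x y, ‖gradient f x - gradient f y‖ ≤ L * ‖x - y‖) (x d : E) :
    f (x + d) ≤ f x + inner ℝ (gradient f x) d + L / 2 * ‖d‖ ^ 2 := by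
  have hderiv : ∀ t : ℝ, HasDerivAt
      (fun t : ℝ => f (x + t • d) - t * inner ℝ (gradient f x) d - L / 2 * ‖d‖ ^ 2 * t ^ 2)
      (inner ℝ (gradient f (x + t • d)) d - inner ℝ (gradient f x) d - L * ‖d‖ ^ 2 * t) t := by
    intro t
    have h1 : HasDerivAt (fun t : ℝ => x + t • d) d t := by
      simpa using ((hasDerivAt_id t).smul_const d).const_add x
    have h2 := ((hf (x + t • d)).hasGradientAt.hasFDerivAt).comp_hasDerivAt t h1
    have h3 := (h2.sub ((hasDerivAt_id t).mul_const (inner ℝ (gradient f x) d))).sub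
      ((hasDerivAt_pow 2 t).const_mul (L / 2 * ‖d‖ ^ 2))
    refine (h3.congr_deriv ?_)
    simp
    ring
  have hanti : AntitoneOn
      (fun t : ℝ => f (x + t • d) - t * inner ℝ (gradient f x) d - L / 2 * ‖d‖ ^ 2 * t ^ 2)
      (Set.Icc 0 1) := by
    refine antitoneOn_of_deriv_nonpos (convex_Icc 0 1)
      (fun t _ => (hderiv t).continuousAt.continuousWithinAt)
      (fun t _ => (hderiv t).differentiableAt.differentiableWithinAt) fun t ht => ?_
    rw [interior_Icc] at ht
    rw [(hderiv t).deriv, ← inner_sub_left]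
    have h1 := real_inner_le_norm (gradient f (x + t • d) - gradient f x) d
    have h2 := hL (x + t • d) x
    rw [add_sub_cancel_left, norm_smul, Real.norm_of_nonneg ht.1.le] at h2
    nlinarith [mul_le_mul_of_nonneg_right h2 (norm_nonneg d)]
  have := hanti (Set.left_mem_Icc.2 zero_le_one) (Set.right_mem_Icc.2 zero_le_one) zero_le_one
  simp only [one_smul, one_mul, one_pow, mul_one, zero_smul, add_zero, zero_mul, sub_zero,
    ne_eq, OfNat.ofNat_ne_zero, not_false_eq_true, zero_pow, mul_zero] at this
  linarith

namespace Input

variable {n p : ℕ} {D : Input n p}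

lemma Lip_le_L (D : Input n p) (i : Fin n) : D.Lip i ≤ D.L :=
  le_ciSup (Set.finite_range D.Lip).bddAbove i

lemma lam_le_lamHat (D : Input n p) (i : Fin n) : D.lam i ≤ D.lamHat :=
  le_ciSup (Set.finite_range D.lam).bddAbove i

lemma SmoothAssumption.gradient_sub_le (h : D.SmoothAssumption) (i : Fin n) (x y : Vec p) :
    ‖gradient (D.f i) x - gradient (D.f i) y‖ ≤ D.L * ‖x - y‖ :=
  ((h i).2 x y).trans (mul_le_mul_of_nonneg_right (D.Lip_le_L i) (norm_nonneg _))

lemma SmoothAssumption.gradF_sub_le (h : D.SmoothAssumption) (hL : 0 ≤ D.L) (X Y : Stack n p) :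
    ‖D.gradF X - D.gradF Y‖ ≤ D.L * ‖X - Y‖ := by
  refine le_of_sq_le_sq ?_ (by positivity)
  rw [mul_pow, PiLp.norm_sq_eq_of_L2, PiLp.norm_sq_eq_of_L2, Finset.mul_sum]
  refine Finset.sum_le_sum fun i _ => ?_
  rw [← mul_pow]
  exact pow_le_pow_left₀ (norm_nonneg _) (h.gradient_sub_le i _ _) 2

lemma SmoothAssumption.hasGradientAt_obj (h : D.SmoothAssumption) (x : Vec p) :
    HasGradientAt D.obj ((1 / (n : ℝ)) • ∑ i, gradient (D.f i) x) x := by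
  rw [hasGradientAt_iff_hasFDerivAt, map_smul, map_sum]
  exact (HasFDerivAt.fun_sum fun i _ => ((h i).1 x).hasGradientAt.hasFDerivAt).const_mul _

lemma SmoothAssumption.gradient_obj (h : D.SmoothAssumption) (x : Vec p) :
    gradient D.obj x = (1 / (n : ℝ)) • ∑ i, gradient (D.f i) x :=
  (h.hasGradientAt_obj x).gradient

lemma SmoothAssumption.differentiable_obj (h : D.SmoothAssumption) : Differentiable ℝ D.obj :=
  fun x => (h.hasGradientAt_obj x).hasFDerivAt.differentiableAt

lemma SmoothAssumption.gradient_obj_sub_le [NeZero n] (h : D.SmoothAssumption) (x y : Vec p) :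
    ‖gradient D.obj x - gradient D.obj y‖ ≤ D.L * ‖x - y‖ := by
  have hn : (n : ℝ) ≠ 0 := NeZero.ne _
  rw [h.gradient_obj, h.gradient_obj, ← smul_sub, ← Finset.sum_sub_distrib, norm_smul,
    Real.norm_of_nonneg (by positivity)]
  calc 1 / (n : ℝ) * ‖∑ i, (gradient (D.f i) x - gradient (D.f i) y)‖
      ≤ 1 / n * ∑ _i : Fin n, D.L * ‖x - y‖ := by
        gcongr
        exact norm_sum_le_of_le _ fun i _ => h.gradient_sub_le i x y
    _ = D.L * ‖x - y‖ := by
        rw [Finset.sum_const, Finset.card_univ, Fintype.card_fin, nsmul_eq_mul]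
        field_simp

/-- The average of the local gradients is close to the gradient at the average. -/
lemma SmoothAssumption.avg_gradient_sub_sq_le [NeZero n] (h : D.SmoothAssumption)
    (u : Vec n) (X : Stack n p) :
    ‖(1 / (n : ℝ)) • ∑ i, gradient (D.f i) (X i) - gradient D.obj (avg u X)‖ ^ 2
      ≤ D.L ^ 2 / n * ‖mulStack (projR u) X‖ ^ 2 := by
  have hn : (0 : ℝ) < n := by exact_mod_cast NeZero.pos n
  rw [h.gradient_obj, ← smul_sub, ← Finset.sum_sub_distrib, norm_smul,
    Real.norm_of_nonneg (by positivity)]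
  have h1 : ‖∑ i, (gradient (D.f i) (X i) - gradient (D.f i) (avg u X))‖
      ≤ ∑ i, D.L * ‖mulStack (projR u) X i‖ := by
    refine norm_sum_le_of_le _ fun i _ => ?_
    rw [projR_mulStack]
    exact h.gradient_sub_le i _ _
  calc (1 / (n : ℝ) * ‖∑ i, (gradient (D.f i) (X i) - gradient (D.f i) (avg u X))‖) ^ 2
      ≤ (1 / n * ∑ i, D.L * ‖mulStack (projR u) X i‖) ^ 2 := by gcongr
    _ = D.L ^ 2 / n ^ 2 * (∑ i, ‖mulStack (projR u) X i‖) ^ 2 := by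
        rw [← Finset.mul_sum]
        ring
    _ ≤ D.L ^ 2 / n ^ 2 * (n * ∑ i, ‖mulStack (projR u) X i‖ ^ 2) := by
        gcongr
        simpa using sq_sum_le_card_mul_sum_sq (s := Finset.univ)
          (f := fun i => ‖mulStack (projR u) X i‖)
    _ = D.L ^ 2 / n * ‖mulStack (projR u) X‖ ^ 2 := by
        rw [PiLp.norm_sq_eq_of_L2]
        field_simp

lemma norm_lamMul_le {D : Input n p} (hlam : ∀ i, 0 ≤ D.lam i) (hpos : 0 ≤ D.lamHat)
    (Y : Stack n p) : ‖D.lamMul Y‖ ≤ D.lamHat * ‖Y‖ :=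
  norm_mulStack_diagonal_le (fun i => by rw [abs_of_nonneg (hlam i)]; exact D.lam_le_lamHat i)
    hpos Y

end Input

/-! ### One iteration, for given outcomes of the compressions -/

/-- The standing assumptions that do not concern the compression operator. -/
structure Setting {n p : ℕ} (D : Input n p) (W : Aux n) : Prop where
  smooth : D.SmoothAssumption
  L_pos : 0 < D.L
  lam_nonneg : ∀ i, 0 ≤ D.lam i
  lamHat_pos : 0 < D.lamHat
  γx_pos : 0 < D.γx
  γy_pos : 0 < D.γy
  row_sum : ∀ i, ∑ j, D.R i j = 1
  col_sum : ∀ j, ∑ i, D.C i j = 1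
  valid : W.Valid D.R D.C D.γx D.γy
  M_pos : 0 < W.M
  M_le : W.M * D.lamHat ≤ lamBar D W

/-- Relations between the variables that every iteration preserves. -/
structure Invariant {n p : ℕ} (D : Input n p) (S : State n p) : Prop where
  HR : S.HR = mulStack D.R S.Hx
  HC : S.HC = mulStack D.C S.Hy
  tracking : ∑ i, S.Y i = ∑ i, gradient (D.f i) (S.X i)

noncomputable section Quantities

variable {n p : ℕ} (D : Input n p) (W : Aux n)

/-- The error of the compression of the `x`-variables. -/
def errX (s : ℝ) (cx : Stack n p → Stack n p) (S : State n p) : Stack n p :=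
  S.Hx + s • cx (s⁻¹ • (S.Xtilde D - S.Hx)) - S.Xtilde D

/-- The intermediate variable `Ỹ`, if `S'` is the next state. -/
def yTilde (S S' : State n p) : Stack n p := S.Y + D.gradF S'.X - D.gradF S.X

/-- The error of the compression of the `y`-variables, if `S'` is the next state. -/
def errY (s : ℝ) (cy : Stack n p → Stack n p) (S S' : State n p) : Stack n p :=
  S.Hy + s • cy (s⁻¹ • (yTilde D S S' - S.Hy)) - yTilde D S S'

/-- Squared weighted consensus error. -/
def consensus (S : State n p) : ℝ := ‖mulStack W.TR (mulStack (projR W.uR) S.X)‖ ^ 2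

/-- Squared weighted gradient tracking error. -/
def trackingErr (S : State n p) : ℝ := ‖mulStack W.TC (mulStack (projC W.uC) S.Y)‖ ^ 2

end Quantities

section Step

variable {n p : ℕ} {D : Input n p} {W : Aux n} {s : ℝ} {cx cy : Stack n p → Stack n p}
  {S : State n p}

lemma step_X (hS : Invariant D S) :
    (step D s cx cy S).X = mulStack (relaxed D.R D.γx) (S.X + -D.lamMul S.Y)
      - D.γx • mulStack (1 - D.R) (errX D s cx S) := by
  have h : (step D s cx cy S).X = S.Xtilde D
      - D.γx • (S.Hx + s • cx (s⁻¹ • (S.Xtilde D - S.Hx))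
        - (S.HR + mulStack D.R (s • cx (s⁻¹ • (S.Xtilde D - S.Hx))))) := rfl
  rw [h, hS.HR, errX, relaxed_mulStack]
  set Q := s • cx (s⁻¹ • (S.Xtilde D - S.Hx))
  have hX : S.X + -D.lamMul S.Y = S.Xtilde D := (sub_eq_add_neg _ _).symm
  rw [hX]
  simp only [mulStack_sub, mulStack_add, sub_mulStack, one_mulStack, smul_sub, smul_add]
  abel

lemma step_Y (hS : Invariant D S) :
    (step D s cx cy S).Y = mulStack (relaxed D.C D.γy)
        (S.Y + (D.gradF (step D s cx cy S).X - D.gradF S.X))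
      - D.γy • mulStack (1 - D.C) (errY D s cy S (step D s cx cy S)) := by
  set S' := step D s cx cy S with hS'
  have h : S'.Y = yTilde D S S' - D.γy • (S.Hy + s • cy (s⁻¹ • (yTilde D S S' - S.Hy))
        - (S.HC + mulStack D.C (s • cy (s⁻¹ • (yTilde D S S' - S.Hy))))) := rfl
  rw [h, hS.HC, errY, relaxed_mulStack]
  set Q := s • cy (s⁻¹ • (yTilde D S S' - S.Hy))
  have hY : S.Y + (D.gradF S'.X - D.gradF S.X) = yTilde D S S' := by
    rw [yTilde]
    abel
  rw [hY]
  simp only [mulStack_sub, mulStack_add, sub_mulStack, one_mulStack, smul_sub, smul_add]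
  abel

lemma Xtilde_sub_step_Hx : S.Xtilde D - (step D s cx cy S).Hx
    = S.Xtilde D - S.Hx - D.αx • s • cx (s⁻¹ • (S.Xtilde D - S.Hx)) := by
  have h : (step D s cx cy S).Hx = (1 - D.αx) • S.Hx
      + D.αx • (S.Hx + s • cx (s⁻¹ • (S.Xtilde D - S.Hx))) := rfl
  rw [h, sub_smul, one_smul, smul_add]
  abel

lemma yTilde_sub_step_Hy : yTilde D S (step D s cx cy S) - (step D s cx cy S).Hy
    = yTilde D S (step D s cx cy S) - S.Hy
      - D.αy • s • cy (s⁻¹ • (yTilde D S (step D s cx cy S) - S.Hy)) := by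
  have h : (step D s cx cy S).Hy = (1 - D.αy) • S.Hy
      + D.αy • (S.Hy + s • cy (s⁻¹ • (yTilde D S (step D s cx cy S) - S.Hy))) := rfl
  rw [h, sub_smul, one_smul, smul_add]
  abel

lemma sum_sub_mulStack {A : Matrix (Fin n) (Fin n) ℝ} (hA : ∀ j, ∑ i, A i j = 1)
    (X : Stack n p) : ∑ i, mulStack (1 - A) X i = 0 := by
  simp only [sub_mulStack, one_mulStack, PiLp.sub_apply, Finset.sum_sub_distrib, sum_mulStack hA,
    sub_self]

lemma Invariant.step (hS : Invariant D S) (hC : ∀ j, ∑ i, D.C i j = 1) :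
    Invariant D (step D s cx cy S) where
  HR := by
    have h1 : (RCPP.step D s cx cy S).HR = (1 - D.αx) • S.HR
        + D.αx • (S.HR + mulStack D.R (s • cx (s⁻¹ • (S.Xtilde D - S.Hx)))) := rfl
    have h2 : (RCPP.step D s cx cy S).Hx = (1 - D.αx) • S.Hx
        + D.αx • (S.Hx + s • cx (s⁻¹ • (S.Xtilde D - S.Hx))) := rfl
    rw [h1, h2, hS.HR]
    simp only [mulStack_add, mulStack_smul]
  HC := by
    set S' := RCPP.step D s cx cy S with hS'
    have h1 : S'.HC = (1 - D.αy) • S.HC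
        + D.αy • (S.HC + mulStack D.C (s • cy (s⁻¹ • (yTilde D S S' - S.Hy)))) := rfl
    have h2 : S'.Hy = (1 - D.αy) • S.Hy
        + D.αy • (S.Hy + s • cy (s⁻¹ • (yTilde D S S' - S.Hy))) := rfl
    rw [h1, h2, hS.HC]
    simp only [mulStack_add, mulStack_smul]
  tracking := by
    rw [step_Y hS, relaxed_mulStack]
    simp only [PiLp.sub_apply, PiLp.smul_apply, PiLp.add_apply, Finset.sum_sub_distrib,
      Finset.sum_add_distrib, ← Finset.smul_sum, sum_sub_mulStack hC, smul_zero, sub_zero,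
      hS.tracking, Input.gradF]
    abel

lemma invariant_iter {Θ : Type*} {𝒞 : Θ → Stack n p → Stack n p} (seed : ℕ → Fin 2 → Θ)
    (hC : ∀ j, ∑ i, D.C i j = 1) (k : ℕ) : Invariant D (iter D 𝒞 seed k) := by
  induction k with
  | zero => exact ⟨(mulStack_zero _).symm, (mulStack_zero _).symm, rfl⟩
  | succ k ih => exact ih.step hC

namespace Setting

lemma uR_eigen (h : Setting D W) (j : Fin n) : ∑ i, W.uR i * D.R i j = W.uR j := by
  have := h.valid.uR.eigen j
  simpa [mul_comm] using this

lemma sub_R_mul_projR (h : Setting D W) : (1 - D.R) * projR W.uR = 1 - D.R := by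
  have : D.R * Matrix.of (fun _ j => W.uR j) = Matrix.of (fun _ j => W.uR j) := by
    ext i j
    simp [Matrix.mul_apply, ← Finset.sum_mul, h.row_sum]
  rw [projR, Matrix.mul_sub, Matrix.mul_one, Matrix.mul_smul, Matrix.sub_mul, this,
    Matrix.one_mul, sub_self, smul_zero, sub_zero]

lemma sub_C_mul_projC (h : Setting D W) : (1 - D.C) * projC W.uC = 1 - D.C := by
  have : D.C * Matrix.of (fun i (_ : Fin n) => W.uC i) = Matrix.of (fun i _ => W.uC i) := by
    ext i j
    simp [Matrix.mul_apply, h.valid.uC.eigen]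
  rw [projC, Matrix.mul_sub, Matrix.mul_one, Matrix.mul_smul, Matrix.sub_mul, this,
    Matrix.one_mul, sub_self, smul_zero, sub_zero]

lemma consensus_step_le [NeZero n] (h : Setting D W) (hS : Invariant D S) :
    consensus W (step D s cx cy S)
      ≤ (1 - W.θR * D.γx) * consensus W S
        + 2 * (1 - W.θR * D.γx) ^ 2 * W.δR ^ 2 / (W.θR * D.γx) * (D.lamHat ^ 2 * ‖S.Y‖ ^ 2)
        + 18 * D.γx * W.δR ^ 2 / W.θR * ‖errX D s cx S‖ ^ 2 := by
  have hN := h.valid.normR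
  have hκ : 0 < W.θR * D.γx := mul_pos hN.θ_pos h.γx_pos
  rw [consensus, step_X hS]
  refine (hN.mixing_sq_le h.γx_pos (projR_mul_self h.valid.uR.sum_eq)
    (projR_comm h.row_sum h.uR_eigen) _ _ _).trans ?_
  have h1 := pow_le_pow_left₀ (norm_nonneg _)
    (Input.norm_lamMul_le h.lam_nonneg h.lamHat_pos.le S.Y) 2
  rw [mul_pow] at h1
  rw [norm_neg, consensus]
  gcongr

lemma move_sq_le [NeZero n] (h : Setting D W) (hS : Invariant D S) :
    ‖(step D s cx cy S).X - S.X‖ ^ 2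
      ≤ 12 * W.δR ^ 2 * (D.lamHat ^ 2 * ‖S.Y‖ ^ 2) + 27 * D.γx ^ 2 * consensus W S
        + 27 * D.γx ^ 2 * W.δR ^ 2 * ‖errX D s cx S‖ ^ 2 := by
  rw [step_X hS]
  refine (h.valid.normR.mixing_sub_sq_le h.γx_pos h.sub_R_mul_projR _ _ _).trans ?_
  have h1 := pow_le_pow_left₀ (norm_nonneg _)
    (Input.norm_lamMul_le h.lam_nonneg h.lamHat_pos.le S.Y) 2
  rw [mul_pow] at h1
  rw [norm_neg, consensus]
  gcongr

lemma gradF_move_sq_le (h : Setting D W) (S S' : State n p) :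
    ‖D.gradF S'.X - D.gradF S.X‖ ^ 2 ≤ D.L ^ 2 * ‖S'.X - S.X‖ ^ 2 := by
  rw [← mul_pow]
  exact pow_le_pow_left₀ (norm_nonneg _) (h.smooth.gradF_sub_le h.L_pos.le _ _) 2

lemma trackingErr_step_le [NeZero n] (h : Setting D W) (hS : Invariant D S) :
    trackingErr W (step D s cx cy S)
      ≤ (1 - W.θC * D.γy) * trackingErr W S
        + 2 * W.δC ^ 2 / (W.θC * D.γy) * (D.L ^ 2 * ‖(step D s cx cy S).X - S.X‖ ^ 2)
        + 18 * D.γy * W.δC ^ 2 / W.θC * ‖errY D s cy S (step D s cx cy S)‖ ^ 2 := by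
  have hN := h.valid.normC
  have hκ : 0 < W.θC * D.γy := mul_pos hN.θ_pos h.γy_pos
  have hκ1 := hN.θ_mul_le_one
  have h1 := h.gradF_move_sq_le S (step D s cx cy S)
  rw [trackingErr, step_Y hS]
  refine (hN.mixing_sq_le h.γy_pos (projC_mul_self h.valid.uC.sum_eq)
    (projC_comm h.col_sum h.valid.uC.eigen) _ _ _).trans ?_
  rw [trackingErr]
  have h2 : 2 * (1 - W.θC * D.γy) ^ 2 * W.δC ^ 2 ≤ 2 * W.δC ^ 2 := by
    have : (1 - W.θC * D.γy) ^ 2 ≤ 1 := pow_le_one₀ (by linarith) (by linarith)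
    nlinarith [sq_nonneg W.δC]
  gcongr

lemma moveY_sq_le [NeZero n] (h : Setting D W) (hS : Invariant D S) :
    ‖(step D s cx cy S).Y - S.Y‖ ^ 2
      ≤ 12 * W.δC ^ 2 * (D.L ^ 2 * ‖(step D s cx cy S).X - S.X‖ ^ 2)
        + 27 * D.γy ^ 2 * trackingErr W S
        + 27 * D.γy ^ 2 * W.δC ^ 2 * ‖errY D s cy S (step D s cx cy S)‖ ^ 2 := by
  have h1 := h.gradF_move_sq_le S (step D s cx cy S)
  rw [step_Y hS]
  refine (h.valid.normC.mixing_sub_sq_le h.γy_pos h.sub_C_mul_projC _ _ _).trans ?_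
  rw [trackingErr]
  gcongr

lemma yTilde_sub_sq_le (h : Setting D W) (S S' : State n p) {t : ℝ} (ht : 0 < t) :
    ‖yTilde D S S' - S.Hy‖ ^ 2
      ≤ (1 + t) * ‖S.Y - S.Hy‖ ^ 2 + (1 + 1 / t) * (D.L ^ 2 * ‖S'.X - S.X‖ ^ 2) := by
  have h1 := h.gradF_move_sq_le S S'
  have h2 : yTilde D S S' - S.Hy = (S.Y - S.Hy) + (D.gradF S'.X - D.gradF S.X) := by
    rw [yTilde]
    abel
  rw [h2]
  refine (sq_norm_add_le_young _ _ ht).trans ?_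
  gcongr

lemma compressX_step_le (h : Setting D W) {t : ℝ} (ht : 0 < t) (ht1 : t ≤ 1) :
    ‖(step D s cx cy S).Xtilde D - (step D s cx cy S).Hx‖ ^ 2
      ≤ (1 + t / 2) * ‖S.Xtilde D - (step D s cx cy S).Hx‖ ^ 2
        + 3 / t * (2 * ‖(step D s cx cy S).X - S.X‖ ^ 2
          + 2 * (D.lamHat ^ 2 * ‖(step D s cx cy S).Y - S.Y‖ ^ 2)) := by
  set S' := step D s cx cy S
  have h1 : S'.Xtilde D - S'.Hx = (S.Xtilde D - S'.Hx)
      + ((S'.X - S.X) + -D.lamMul (S'.Y - S.Y)) := by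
    simp only [State.Xtilde, Input.lamMul, mulStack_sub]
    abel
  rw [h1]
  refine (sq_norm_add_le_young _ _ (half_pos ht)).trans ?_
  have h2 := sq_norm_add_le_two (S'.X - S.X) (-D.lamMul (S'.Y - S.Y))
  have h3 := pow_le_pow_left₀ (norm_nonneg _)
    (Input.norm_lamMul_le h.lam_nonneg h.lamHat_pos.le (S'.Y - S.Y)) 2
  rw [mul_pow] at h3
  rw [norm_neg] at h2
  have h4 : 1 + 1 / (t / 2) ≤ 3 / t := by
    rw [one_div_div, ← sub_nonneg]
    have : 3 / t - (1 + 2 / t) = (1 - t) / t := by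
      field_simp
      ring
    rw [this]
    exact div_nonneg (by linarith) ht.le
  gcongr
  linarith

lemma compressY_step_le [NeZero n] (h : Setting D W) (hS : Invariant D S) {t : ℝ} (ht : 0 < t)
    (ht1 : t ≤ 1) :
    ‖(step D s cx cy S).Y - (step D s cx cy S).Hy‖ ^ 2
      ≤ (1 + t / 2) * ‖yTilde D S (step D s cx cy S) - (step D s cx cy S).Hy‖ ^ 2
        + 3 / t * (27 * D.γy ^ 2 * (trackingErr W S
          + W.δC ^ 2 * (D.L ^ 2 * ‖(step D s cx cy S).X - S.X‖ ^ 2)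
          + W.δC ^ 2 * ‖errY D s cy S (step D s cx cy S)‖ ^ 2)) := by
  set S' := step D s cx cy S with hS'
  have h0 := h.gradF_move_sq_le S S'
  have h1 : S'.Y - S'.Hy = (yTilde D S S' - S'.Hy)
      + -(D.γy • mulStack (1 - D.C) (S.Y + (D.gradF S'.X - D.gradF S.X) + errY D s cy S S')) := by
    have : S'.Y = _ := step_Y hS
    rw [this, relaxed_mulStack, ← hS', yTilde, mulStack_add _ (S.Y + _) (errY D s cy S S'),
      smul_add]
    abel
  rw [h1]
  refine (sq_norm_add_le_young _ _ (half_pos ht)).trans ?_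
  have h3 := h.valid.normC.smul_mixing_sq_le h.γy_pos h.sub_C_mul_projC S.Y
    (D.gradF S'.X - D.gradF S.X) (errY D s cy S S')
  rw [norm_neg, trackingErr]
  have h4 : 1 + 1 / (t / 2) ≤ 3 / t := by
    rw [one_div_div, ← sub_nonneg]
    have : 3 / t - (1 + 2 / t) = (1 - t) / t := by
      field_simp
      ring
    rw [this]
    exact div_nonneg (by linarith) ht.le
  gcongr
  refine h3.trans ?_
  gcongr

lemma consensus_ge (h : Setting D W) (S : State n p) :
    ‖mulStack (projR W.uR) S.X‖ ^ 2 ≤ consensus W S :=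
  pow_le_pow_left₀ (norm_nonneg _) (h.valid.normR.norm_le_stack _) 2

lemma trackingErr_ge (h : Setting D W) (S : State n p) :
    ‖mulStack (projC W.uC) S.Y‖ ^ 2 ≤ trackingErr W S :=
  pow_le_pow_left₀ (norm_nonneg _) (h.valid.normC.norm_le_stack _) 2

/-- The mean of the tracking variables is close to the gradient at the average. -/
lemma mean_sub_gradient_sq_le [NeZero n] (h : Setting D W) (hS : Invariant D S) :
    ‖(1 / (n : ℝ)) • ∑ i, S.Y i - gradient D.obj (avg W.uR S.X)‖ ^ 2
      ≤ D.L ^ 2 / n * consensus W S := by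
  rw [hS.tracking]
  refine (h.smooth.avg_gradient_sub_sq_le W.uR S.X).trans ?_
  have := h.consensus_ge S
  gcongr

lemma norm_Y_sq_le [NeZero n] (h : Setting D W) (hS : Invariant D S) :
    ‖S.Y‖ ^ 2 ≤ 3 * (trackingErr W S + ‖W.uC‖ ^ 2 * ‖gradient D.obj (avg W.uR S.X)‖ ^ 2
      + ‖W.uC‖ ^ 2 * (D.L ^ 2 / n * consensus W S)) := by
  set ym := (1 / (n : ℝ)) • ∑ i, S.Y i with hym
  set G := gradient D.obj (avg W.uR S.X)
  let tens : Vec p → Stack n p := fun v => WithLp.toLp 2 (fun i => W.uC i • v)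
  have htens : ∀ v, ‖tens v‖ ^ 2 = ‖W.uC‖ ^ 2 * ‖v‖ ^ 2 := fun v => by
    rw [PiLp.norm_sq_eq_of_L2, PiLp.norm_sq_eq_of_L2, Finset.sum_mul]
    exact Finset.sum_congr rfl fun i _ => by rw [← mul_pow, ← norm_smul]
  have hY : S.Y = mulStack (projC W.uC) S.Y + tens G + tens (ym - G) := by
    ext1 i
    rw [PiLp.add_apply, PiLp.add_apply, projC_mulStack, ← hym]
    simp only [tens, smul_sub]
    abel
  have h1 := sq_norm_add_add_le (mulStack (projC W.uC) S.Y) (tens G) (tens (ym - G))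
  rw [← hY, htens, htens] at h1
  refine h1.trans ?_
  have h2 := h.trackingErr_ge S
  have h3 := h.mean_sub_gradient_sq_le hS
  gcongr

lemma lamBar_pos (h : Setting D W) : 0 < lamBar D W :=
  (mul_pos h.M_pos h.lamHat_pos).trans_le h.M_le

lemma lamBar_le (h : Setting D W) :
    lamBar D W ≤ D.lamHat * (‖W.uR‖ * ‖W.uC‖) / n := by
  have h1 : ∑ i, W.uR i * D.lam i * W.uC i ≤ D.lamHat * ∑ i, W.uR i * W.uC i := by
    rw [Finset.mul_sum]
    refine Finset.sum_le_sum fun i _ => ?_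
    have := mul_nonneg (h.valid.uR.nonneg i) (h.valid.uC.nonneg i)
    nlinarith [D.lam_le_lamHat i]
  have h2 : ∑ i, W.uR i * W.uC i ≤ ‖W.uR‖ * ‖W.uC‖ := by
    have := real_inner_le_norm W.uC W.uR
    simpa [PiLp.inner_apply, mul_comm] using this
  rw [lamBar, one_div, inv_mul_eq_div]
  gcongr
  exact h1.trans (mul_le_mul_of_nonneg_left h2 h.lamHat_pos.le)

/-- Descent of the objective function at the averages. -/
lemma obj_step_le [NeZero n] (h : Setting D W) (hS : Invariant D S) (hLl : D.L * lamBar D W ≤ 1 / 2) :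
    D.obj (avg W.uR (step D s cx cy S).X)
      ≤ D.obj (avg W.uR S.X)
        - 2 / 5 * (W.M * D.lamHat) * ‖gradient D.obj (avg W.uR S.X)‖ ^ 2
        + D.lamHat * (‖W.uR‖ * ‖W.uC‖) / n / 2 * (D.L ^ 2 / n * consensus W S)
        + 3 * (‖W.uR‖ ^ 2 * D.lamHat / (n ^ 2 * W.M)) * trackingErr W S := by
  have hn : (0 : ℝ) < n := by exact_mod_cast NeZero.pos n
  have hM := h.M_pos
  have hlh := h.lamHat_pos
  have hl := h.lamBar_pos
  set ym := (1 / (n : ℝ)) • ∑ i, S.Y i with hym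
  set G := gradient D.obj (avg W.uR S.X) with hG
  set l := lamBar D W with hldef
  set w := avg W.uR (D.lamMul (mulStack (projC W.uC) S.Y)) with hw
  have havg : avg W.uR (step D s cx cy S).X = avg W.uR S.X + -(l • ym + w) := by
    have h1 : avg W.uR (D.lamMul S.Y) = l • ym + w := by
      have h2 : ∀ Y : Stack n p, ∀ i, D.lamMul Y i = D.lam i • Y i := fun Y i => by
        simp [Input.lamMul, Matrix.diagonal_apply]
      have h3 : ∀ i, D.lamMul S.Y i = (D.lam i * W.uC i) • ym
          + D.lamMul (mulStack (projC W.uC) S.Y) i := fun i => by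
        rw [h2, h2, projC_mulStack, ← hym, smul_sub, smul_smul (D.lam i) (W.uC i)]
        abel
      rw [avg]
      simp only [h3, smul_add, Finset.sum_add_distrib, smul_smul]
      rw [← Finset.sum_smul, smul_smul, hw, avg, hldef, lamBar]
      simp only [mul_assoc]
    rw [step_X hS, avg_sub, avg_smul, relaxed_mulStack, avg_sub, avg_smul]
    have h4 : ∀ Z : Stack n p, avg W.uR (mulStack (1 - D.R) Z) = 0 := fun Z => by
      rw [sub_mulStack, one_mulStack, avg_sub, avg_mulStack h.uR_eigen, sub_self]
    rw [h4, h4, smul_zero, sub_zero, sub_zero, ← sub_eq_add_neg, ← sub_eq_add_neg, avg_sub, h1]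
  have hdesc := le_add_of_lipschitz_gradient h.smooth.differentiable_obj
    h.smooth.gradient_obj_sub_le (avg W.uR S.X) (-(l • ym + w))
  rw [← havg, ← hG, inner_neg_right, norm_neg, inner_add_right, inner_smul_right] at hdesc
  have hGy : inner ℝ G ym = (‖G‖ ^ 2 + ‖ym‖ ^ 2 - ‖ym - G‖ ^ 2) / 2 := by
    rw [norm_sub_sq_real, real_inner_comm]
    ring
  have hGw : -inner ℝ G w ≤ l / 10 * ‖G‖ ^ 2 + 5 / 2 * (‖w‖ ^ 2 / l) := by
    have h1 := (neg_le_abs _).trans (abs_real_inner_le_norm G w)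
    have h2 : l / 10 * ‖G‖ ^ 2 + 5 / 2 * (‖w‖ ^ 2 / l) - ‖G‖ * ‖w‖
        = (l * ‖G‖ - 5 * ‖w‖) ^ 2 / (10 * l) := by
      field_simp
      ring
    have h3 : 0 ≤ (l * ‖G‖ - 5 * ‖w‖) ^ 2 / (10 * l) := by positivity
    linarith
  have hsq : D.L / 2 * ‖l • ym + w‖ ^ 2 ≤ l / 2 * ‖ym‖ ^ 2 + 1 / 2 * (‖w‖ ^ 2 / l) := by
    have h1 := sq_norm_add_le_two (l • ym) w
    rw [norm_smul, mul_pow, Real.norm_of_nonneg hl.le] at h1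
    have h2 := mul_le_mul_of_nonneg_left h1 (half_pos h.L_pos).le
    have h3 : D.L * (l ^ 2 * ‖ym‖ ^ 2) ≤ l / 2 * ‖ym‖ ^ 2 := by
      have := mul_le_mul_of_nonneg_right hLl (mul_nonneg hl.le (sq_nonneg ‖ym‖))
      nlinarith
    have h4 : D.L * ‖w‖ ^ 2 ≤ 1 / 2 * (‖w‖ ^ 2 / l) := by
      have : 1 / 2 * (‖w‖ ^ 2 / l) - D.L * ‖w‖ ^ 2 = (1 / 2 - D.L * l) * (‖w‖ ^ 2 / l) := by
        field_simp
      have h5 : 0 ≤ (1 / 2 - D.L * l) * (‖w‖ ^ 2 / l) :=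
        mul_nonneg (by linarith) (by positivity)
      linarith
    linarith
  have he := h.mean_sub_gradient_sq_le hS
  rw [← hym, ← hG] at he
  have hwle : ‖w‖ ^ 2 / l ≤ ‖W.uR‖ ^ 2 * D.lamHat / (n ^ 2 * W.M) * trackingErr W S := by
    have h1 : ‖w‖ ≤ ‖W.uR‖ / n * (D.lamHat * ‖mulStack (projC W.uC) S.Y‖) :=
      (norm_avg_le _ _).trans (mul_le_mul_of_nonneg_left
        (Input.norm_lamMul_le h.lam_nonneg hlh.le _) (by positivity))
    have h2 := pow_le_pow_left₀ (norm_nonneg _) h1 2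
    have h3 := h.trackingErr_ge S
    calc ‖w‖ ^ 2 / l ≤ (‖W.uR‖ / n * (D.lamHat * ‖mulStack (projC W.uC) S.Y‖)) ^ 2
          / (W.M * D.lamHat) := by
          gcongr
          exact h.M_le
      _ = ‖W.uR‖ ^ 2 * D.lamHat / (n ^ 2 * W.M) * ‖mulStack (projC W.uC) S.Y‖ ^ 2 := by
          field_simp
      _ ≤ _ := by gcongr
  have hle : l / 2 * ‖ym - G‖ ^ 2
      ≤ D.lamHat * (‖W.uR‖ * ‖W.uC‖) / n / 2 * (D.L ^ 2 / n * consensus W S) := by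
    have h1 := h.lamBar_le
    gcongr
  have hG2 : W.M * D.lamHat * ‖G‖ ^ 2 ≤ l * ‖G‖ ^ 2 := by
    have := h.M_le
    gcongr
  rw [hGy] at hdesc
  nlinarith

end Setting

end Step

/-! ### Expected compression errors -/

lemma sq_norm_convex_le {E : Type*} [NormedAddCommGroup E] [NormedSpace ℝ E] {t : ℝ} (h0 : 0 ≤ t)
    (h1 : t ≤ 1) (a b : E) :
    ‖(1 - t) • a + t • b‖ ^ 2 ≤ (1 - t) * ‖a‖ ^ 2 + t * ‖b‖ ^ 2 := by
  have h : ‖(1 - t) • a + t • b‖ ≤ (1 - t) * ‖a‖ + t * ‖b‖ := by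
    refine (norm_add_le _ _).trans_eq ?_
    rw [norm_smul, norm_smul, Real.norm_of_nonneg h0, Real.norm_of_nonneg (by linarith)]
  have h2 := pow_le_pow_left₀ (norm_nonneg _) h 2
  nlinarith [mul_nonneg (mul_nonneg h0 (sub_nonneg.2 h1)) (sq_nonneg (‖a‖ - ‖b‖))]

section Compression

variable {Θ Ω E : Type*} [MeasurableSpace Θ] [MeasurableSpace Ω] {ν : Measure Θ} {P : Measure Ω}
  [IsProbabilityMeasure ν] [IsProbabilityMeasure P]

/-- A bound for the expectation over a seed carries over to inputs that are independent of it. -/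
lemma integral_comp_indep_le [NormedAddCommGroup E] [MeasurableSpace E] {g : Θ × E → ℝ}
    (hg : Measurable g) (hg0 : ∀ z, 0 ≤ g z) {A B : ℝ}
    (hint : ∀ x, Integrable (fun θ => g (θ, x)) ν)
    (hle : ∀ x, ∫ θ, g (θ, x) ∂ν ≤ A * ‖x‖ ^ 2 + B) {ξ : Ω → Θ} {Z : Ω → E}
    (hξ : Measurable ξ) (hlaw : P.map ξ = ν) (hZ : Measurable Z) (hind : IndepFun ξ Z P)
    (hZ2 : Integrable (fun ω => ‖Z ω‖ ^ 2) P) (hnorm : Measurable (fun x : E => ‖x‖)) :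
    Integrable (fun ω => g (ξ ω, Z ω)) P ∧
      ∫ ω, g (ξ ω, Z ω) ∂P ≤ A * ∫ ω, ‖Z ω‖ ^ 2 ∂P + B := by
  have hpair : P.map (fun ω => (ξ ω, Z ω)) = ν.prod (P.map Z) := by
    rw [(indepFun_iff_map_prod_eq_prod_map_map hξ.aemeasurable hZ.aemeasurable).1 hind, hlaw]
  have : IsProbabilityMeasure (P.map Z) := Measure.isProbabilityMeasure_map hZ.aemeasurable
  have hmeas : Measurable (fun ω => (ξ ω, Z ω)) := hξ.prodMk hZ
  have hZ2' : Integrable (fun x => ‖x‖ ^ 2) (P.map Z) :=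
    (integrable_map_measure (hnorm.pow_const 2).aestronglyMeasurable hZ.aemeasurable).2 hZ2
  have hbound : Integrable (fun x => A * ‖x‖ ^ 2 + B) (P.map Z) :=
    (hZ2'.const_mul A).add (integrable_const B)
  have hgm : AEStronglyMeasurable g (ν.prod (P.map Z)) := hg.aestronglyMeasurable
  have hgi : Integrable g (ν.prod (P.map Z)) := by
    rw [integrable_prod_iff' hgm]
    refine ⟨Filter.Eventually.of_forall hint, ?_⟩
    refine hbound.mono' hgm.norm.prod_swap.integral_prod_right' (Filter.Eventually.of_forall ?_)
    intro x
    have h0 : ∫ θ, ‖g (θ, x)‖ ∂ν = ∫ θ, g (θ, x) ∂ν :=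
      integral_congr_ae (Filter.Eventually.of_forall fun θ => Real.norm_of_nonneg (hg0 _))
    change ‖∫ θ, ‖g (θ, x)‖ ∂ν‖ ≤ _
    rw [h0, Real.norm_of_nonneg (integral_nonneg fun θ => hg0 _)]
    exact hle x
  have hgi' : Integrable g (P.map (fun ω => (ξ ω, Z ω))) := hpair ▸ hgi
  refine ⟨hgi'.comp_measurable hmeas, ?_⟩
  have h1 : ∫ ω, g (ξ ω, Z ω) ∂P = ∫ z, g z ∂(P.map (fun ω => (ξ ω, Z ω))) :=
    (integral_map hmeas.aemeasurable hg.aestronglyMeasurable).symm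
  rw [h1, hpair, integral_prod_symm g hgi]
  calc ∫ x, ∫ θ, g (θ, x) ∂ν ∂(P.map Z) ≤ ∫ x, (A * ‖x‖ ^ 2 + B) ∂(P.map Z) :=
        integral_mono hgi.integral_prod_right hbound hle
    _ = A * ∫ ω, ‖Z ω‖ ^ 2 ∂P + B := by
        rw [integral_add (hZ2'.const_mul A) (integrable_const B), integral_const_mul,
          integral_map hZ.aemeasurable (hnorm.pow_const 2).aestronglyMeasurable]
        simp

variable [NormedAddCommGroup E] [InnerProductSpace ℝ E] [MeasurableSpace E] [BorelSpace E]
  {𝒞 : Θ → E → E} {c : CompConst}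

lemma CompressionAssumption.integrable_scaled (h : CompressionAssumption ν 𝒞 c) (x : E) :
    Integrable (fun θ => ‖c.r⁻¹ • 𝒞 θ x - x‖ ^ 2) ν := by
  have hm : Measurable (fun θ => 𝒞 θ x) := h.measurable.comp (measurable_id.prodMk measurable_const)
  have hb : Integrable (fun θ => 2 * (‖c.r⁻¹‖ ^ 2 * ‖𝒞 θ x - x‖ ^ 2 + ‖c.r⁻¹ • x - x‖ ^ 2)) ν :=
    (((h.integrable x).const_mul _).add (integrable_const _)).const_mul 2
  refine hb.mono' (((hm.const_smul c.r⁻¹).sub_const x).norm.pow_const 2).aestronglyMeasurable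
    (Filter.Eventually.of_forall fun θ => ?_)
  rw [Real.norm_of_nonneg (sq_nonneg _), ← mul_pow, ← norm_smul]
  refine le_trans (le_of_eq ?_) (sq_norm_add_le_two _ _)
  rw [smul_sub]
  abel_nf

variable [SecondCountableTopology E] {ξ : Ω → Θ} {U : Ω → E} {s : ℝ}

lemma CompressionAssumption.error_expectation_le (h : CompressionAssumption ν 𝒞 c)
    (hξ : Measurable ξ) (hlaw : P.map ξ = ν) (hU : Measurable U) (hind : IndepFun ξ U P)
    (hU2 : Integrable (fun ω => ‖U ω‖ ^ 2) P) (hs : s ≠ 0) :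
    Integrable (fun ω => ‖s • 𝒞 (ξ ω) (s⁻¹ • U ω) - U ω‖ ^ 2) P ∧
      ∫ ω, ‖s • 𝒞 (ξ ω) (s⁻¹ • U ω) - U ω‖ ^ 2 ∂P
        ≤ c.C * ∫ ω, ‖U ω‖ ^ 2 ∂P + s ^ 2 * c.sigmaSq := by
  have hZ : Measurable (fun ω => s⁻¹ • U ω) := hU.const_smul _
  have hind' : IndepFun ξ (fun ω => s⁻¹ • U ω) P :=
    hind.comp measurable_id (measurable_const_smul s⁻¹)
  have hsq : ∀ x : E, ‖s⁻¹ • x‖ ^ 2 = (s⁻¹) ^ 2 * ‖x‖ ^ 2 := fun x => by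
    rw [norm_smul, mul_pow, Real.norm_eq_abs, sq_abs]
  have hZ2 : Integrable (fun ω => ‖s⁻¹ • U ω‖ ^ 2) P := by
    simp only [hsq]
    exact hU2.const_mul _
  obtain ⟨h1, h2⟩ := integral_comp_indep_le (g := fun z : Θ × E => ‖𝒞 z.1 z.2 - z.2‖ ^ 2)
    ((h.measurable.sub measurable_snd).norm.pow_const 2) (fun z => sq_nonneg _)
    h.integrable h.error_le hξ hlaw hZ hind' hZ2 measurable_norm
  have hrw : ∀ ω, ‖s • 𝒞 (ξ ω) (s⁻¹ • U ω) - U ω‖ ^ 2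
      = s ^ 2 * ‖𝒞 (ξ ω) (s⁻¹ • U ω) - s⁻¹ • U ω‖ ^ 2 := fun ω => by
    rw [← sq_abs s, ← Real.norm_eq_abs, ← mul_pow, ← norm_smul, smul_sub, smul_inv_smul₀ hs]
  simp only [hrw]
  refine ⟨h1.const_mul _, ?_⟩
  rw [integral_const_mul]
  refine (mul_le_mul_of_nonneg_left h2 (sq_nonneg s)).trans_eq ?_
  simp only [hsq]
  rw [integral_const_mul]
  field_simp

lemma CompressionAssumption.contraction_expectation_le (h : CompressionAssumption ν 𝒞 c)
    (hξ : Measurable ξ) (hlaw : P.map ξ = ν) (hU : Measurable U) (hind : IndepFun ξ U P)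
    (hU2 : Integrable (fun ω => ‖U ω‖ ^ 2) P) (hs : s ≠ 0) {α : ℝ} (hα : 0 < α)
    (hα1 : α ≤ 1 / c.r) :
    Integrable (fun ω => ‖U ω - α • s • 𝒞 (ξ ω) (s⁻¹ • U ω)‖ ^ 2) P ∧
      ∫ ω, ‖U ω - α • s • 𝒞 (ξ ω) (s⁻¹ • U ω)‖ ^ 2 ∂P
        ≤ (1 - α * c.r * c.δ) * ∫ ω, ‖U ω‖ ^ 2 ∂P + α * c.r * (s ^ 2 * c.sigmaRSq) := by
  have hr := h.r_pos
  have ht0 : 0 ≤ α * c.r := by positivity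
  have ht1 : α * c.r ≤ 1 := by rwa [le_div_iff₀ hr] at hα1
  have hZ : Measurable (fun ω => s⁻¹ • U ω) := hU.const_smul _
  have hind' : IndepFun ξ (fun ω => s⁻¹ • U ω) P :=
    hind.comp measurable_id (measurable_const_smul s⁻¹)
  have hsq : ∀ x : E, ‖s⁻¹ • x‖ ^ 2 = (s⁻¹) ^ 2 * ‖x‖ ^ 2 := fun x => by
    rw [norm_smul, mul_pow, Real.norm_eq_abs, sq_abs]
  have hZ2 : Integrable (fun ω => ‖s⁻¹ • U ω‖ ^ 2) P := by
    simp only [hsq]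
    exact hU2.const_mul _
  obtain ⟨h1, h2⟩ := integral_comp_indep_le
    (g := fun z : Θ × E => ‖c.r⁻¹ • 𝒞 z.1 z.2 - z.2‖ ^ 2)
    (((h.measurable.const_smul c.r⁻¹).sub measurable_snd).norm.pow_const 2) (fun z => sq_nonneg _)
    h.integrable_scaled h.scaled_error_le hξ hlaw hZ hind' hZ2 measurable_norm
  have hpt : ∀ ω, ‖U ω - α • s • 𝒞 (ξ ω) (s⁻¹ • U ω)‖ ^ 2
      ≤ (1 - α * c.r) * ‖U ω‖ ^ 2
        + α * c.r * (s ^ 2 * ‖c.r⁻¹ • 𝒞 (ξ ω) (s⁻¹ • U ω) - s⁻¹ • U ω‖ ^ 2) := fun ω => by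
    have e1 : U ω - α • s • 𝒞 (ξ ω) (s⁻¹ • U ω) = (1 - α * c.r) • U ω
        + (α * c.r) • (s • (s⁻¹ • U ω - c.r⁻¹ • 𝒞 (ξ ω) (s⁻¹ • U ω))) := by
      rw [smul_sub s, smul_inv_smul₀ hs, smul_sub, sub_smul, one_smul, smul_smul s, smul_smul,
        smul_smul (α * c.r) (s * c.r⁻¹), show α * c.r * (s * c.r⁻¹) = α * s by field_simp]
      abel
    rw [e1]
    refine (sq_norm_convex_le ht0 ht1 _ _).trans_eq ?_
    rw [norm_smul, mul_pow, Real.norm_eq_abs, sq_abs, norm_sub_rev]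
  have hbound : Integrable (fun ω => (1 - α * c.r) * ‖U ω‖ ^ 2
      + α * c.r * (s ^ 2 * ‖c.r⁻¹ • 𝒞 (ξ ω) (s⁻¹ • U ω) - s⁻¹ • U ω‖ ^ 2)) P :=
    (hU2.const_mul _).add ((h1.const_mul _).const_mul _)
  have hm : Measurable (fun ω => 𝒞 (ξ ω) (s⁻¹ • U ω)) := h.measurable.comp (hξ.prodMk hZ)
  have hint : Integrable (fun ω => ‖U ω - α • s • 𝒞 (ξ ω) (s⁻¹ • U ω)‖ ^ 2) P := by
    refine hbound.mono'
      ((hU.sub ((hm.const_smul s).const_smul α)).norm.pow_const 2).aestronglyMeasurable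
      (Filter.Eventually.of_forall fun ω => ?_)
    rw [Real.norm_of_nonneg (sq_nonneg _)]
    exact hpt ω
  refine ⟨hint, (integral_mono hint hbound hpt).trans ?_⟩
  rw [integral_add (hU2.const_mul _) ((h1.const_mul _).const_mul _), integral_const_mul,
    integral_const_mul, integral_const_mul]
  have h3 : s ^ 2 * ∫ ω, ‖c.r⁻¹ • 𝒞 (ξ ω) (s⁻¹ • U ω) - s⁻¹ • U ω‖ ^ 2 ∂P
      ≤ (1 - c.δ) * ∫ ω, ‖U ω‖ ^ 2 ∂P + s ^ 2 * c.sigmaRSq := by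
    refine (mul_le_mul_of_nonneg_left h2 (sq_nonneg s)).trans_eq ?_
    simp only [hsq]
    rw [integral_const_mul]
    field_simp
  have h4 := mul_le_mul_of_nonneg_left h3 ht0
  linarith

end Compression

/-! ### Measurability and independence of the iterates -/

section Iterates

variable {n p : ℕ} {D : Input n p}

/-- A random state all of whose components are measurable. -/
structure MeasurableState {α : Type*} [MeasurableSpace α] (F : α → State n p) : Prop where
  X : Measurable fun a => (F a).X
  Y : Measurable fun a => (F a).Y
  Hx : Measurable fun a => (F a).Hx
  Hy : Measurable fun a => (F a).Hy
  HR : Measurable fun a => (F a).HR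
  HC : Measurable fun a => (F a).HC

lemma continuous_mulStack (A : Matrix (Fin n) (Fin n) ℝ) :
    Continuous (mulStack A : Stack n p → Stack n p) := by
  unfold mulStack
  fun_prop

lemma Input.SmoothAssumption.continuous_gradF (h : D.SmoothAssumption) (hL : 0 ≤ D.L) :
    Continuous D.gradF :=
  (LipschitzWith.of_dist_le_mul (K := ⟨D.L, hL⟩) fun X Y => by
    rw [dist_eq_norm, dist_eq_norm]
    exact h.gradF_sub_le hL X Y).continuous

section Measurability

variable {α Θ : Type*} [MeasurableSpace α] [MeasurableSpace Θ] {𝒞 : Θ → Stack n p → Stack n p}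
  {F : α → State n p} {s : ℝ} {ξx ξy : α → Θ}

lemma measurable_mulStack {Z : α → Stack n p} (hZ : Measurable Z)
    (A : Matrix (Fin n) (Fin n) ℝ) : Measurable fun a => mulStack A (Z a) :=
  (continuous_mulStack A).measurable.comp hZ

lemma MeasurableState.xtilde (hF : MeasurableState F) : Measurable fun a => (F a).Xtilde D :=
  hF.X.sub (measurable_mulStack hF.Y _)

lemma MeasurableState.step_X (h𝒞 : Measurable fun z : Θ × Stack n p => 𝒞 z.1 z.2)
    (hx : Measurable ξx) (hF : MeasurableState F) :
    Measurable fun a => (step D s (𝒞 (ξx a)) (𝒞 (ξy a)) (F a)).X := by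
  have hQ : Measurable fun a => s • 𝒞 (ξx a) (s⁻¹ • ((F a).Xtilde D - (F a).Hx)) :=
    (h𝒞.comp (hx.prodMk ((hF.xtilde.sub hF.Hx).const_smul s⁻¹))).const_smul s
  exact hF.xtilde.sub (((hF.Hx.add hQ).sub
    (hF.HR.add (measurable_mulStack hQ _))).const_smul D.γx)

lemma MeasurableState.step (hsm : D.SmoothAssumption) (hL : 0 ≤ D.L)
    (h𝒞 : Measurable fun z : Θ × Stack n p => 𝒞 z.1 z.2) (hx : Measurable ξx)
    (hy : Measurable ξy) (hF : MeasurableState F) :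
    MeasurableState fun a => step D s (𝒞 (ξx a)) (𝒞 (ξy a)) (F a) := by
  have hg := (hsm.continuous_gradF hL).measurable
  have hQ : Measurable fun a => s • 𝒞 (ξx a) (s⁻¹ • ((F a).Xtilde D - (F a).Hx)) :=
    (h𝒞.comp (hx.prodMk ((hF.xtilde.sub hF.Hx).const_smul s⁻¹))).const_smul s
  have hX' : Measurable fun a => (RCPP.step D s (𝒞 (ξx a)) (𝒞 (ξy a)) (F a)).X :=
    hF.step_X h𝒞 hx
  have hYt : Measurable fun a => yTilde D (F a) (RCPP.step D s (𝒞 (ξx a)) (𝒞 (ξy a)) (F a)) :=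
    (hF.Y.add (hg.comp hX')).sub (hg.comp hF.X)
  have hQy : Measurable fun a => s • 𝒞 (ξy a) (s⁻¹ •
      (yTilde D (F a) (RCPP.step D s (𝒞 (ξx a)) (𝒞 (ξy a)) (F a)) - (F a).Hy)) :=
    (h𝒞.comp (hy.prodMk ((hYt.sub hF.Hy).const_smul s⁻¹))).const_smul s
  exact
    { X := hX'
      Y := hYt.sub (((hF.Hy.add hQy).sub
        (hF.HC.add (measurable_mulStack hQy _))).const_smul D.γy)
      Hx := (hF.Hx.const_smul (1 - D.αx)).add ((hF.Hx.add hQ).const_smul D.αx)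
      Hy := (hF.Hy.const_smul (1 - D.αy)).add ((hF.Hy.add hQy).const_smul D.αy)
      HR := (hF.HR.const_smul (1 - D.αx)).add
        ((hF.HR.add (measurable_mulStack hQ _)).const_smul D.αx)
      HC := (hF.HC.const_smul (1 - D.αy)).add
        ((hF.HC.add (measurable_mulStack hQy _)).const_smul D.αy) }

lemma measurableState_iter (hsm : D.SmoothAssumption) (hL : 0 ≤ D.L)
    (h𝒞 : Measurable fun z : Θ × Stack n p => 𝒞 z.1 z.2) (k : ℕ) :
    MeasurableState fun seed : ℕ → Fin 2 → Θ => iter D 𝒞 seed k := by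
  have hm : ∀ l j, Measurable fun seed : ℕ → Fin 2 → Θ => seed l j := fun l j =>
    (measurable_pi_apply j).comp (measurable_pi_apply l)
  induction k with
  | zero => exact ⟨measurable_const, measurable_const, measurable_const, measurable_const,
      measurable_const, measurable_const⟩
  | succ k ih => exact ih.step hsm hL h𝒞 (hm k 0) (hm k 1)

lemma MeasurableState.comp {β : Type*} [MeasurableSpace β] (hF : MeasurableState F) {φ : β → α}
    (hφ : Measurable φ) : MeasurableState fun b => F (φ b) :=
  ⟨hF.X.comp hφ, hF.Y.comp hφ, hF.Hx.comp hφ, hF.Hy.comp hφ, hF.HR.comp hφ, hF.HC.comp hφ⟩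

end Measurability

lemma iter_congr {Θ : Type*} {𝒞 : Θ → Stack n p → Stack n p} {τ τ' : ℕ → Fin 2 → Θ} {k : ℕ}
    (h : ∀ l < k, ∀ j, τ l j = τ' l j) : iter D 𝒞 τ k = iter D 𝒞 τ' k := by
  induction k with
  | zero => rfl
  | succ k ih =>
    rw [iter, iter, ih fun l hl => h l (hl.trans k.lt_succ_self), h k k.lt_succ_self,
      h k k.lt_succ_self]

/-- A quantity that depends on finitely many seeds is independent of any other seed. -/
lemma indepFun_of_depends {Θ Ω β : Type*} [MeasurableSpace Θ] [MeasurableSpace Ω]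
    [MeasurableSpace β] {P : Measure Ω} [IsProbabilityMeasure P] {ξ : ℕ → Fin 2 → Ω → Θ}
    (hξ : ∀ k j, Measurable (ξ k j)) (hindep : iIndepFun (fun q : ℕ × Fin 2 => ξ q.1 q.2) P)
    {Φ : (ℕ → Fin 2 → Θ) → β} (hΦ : Measurable Φ) (T : Finset (ℕ × Fin 2))
    (hdep : ∀ τ τ', (∀ q ∈ T, τ q.1 q.2 = τ' q.1 q.2) → Φ τ = Φ τ') {k : ℕ} {j : Fin 2}
    (hq : (k, j) ∉ T) : IndepFun (ξ k j) (fun ω => Φ fun l i => ξ l i ω) P := by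
  classical
  obtain ⟨ω₀⟩ : Nonempty Ω := nonempty_of_isProbabilityMeasure P
  let ext : (T → Θ) → ℕ → Fin 2 → Θ := fun τ l i =>
    if h : (l, i) ∈ T then τ ⟨(l, i), h⟩ else ξ l i ω₀
  have hext : Measurable ext := by
    refine measurable_pi_lambda _ fun l => measurable_pi_lambda _ fun i => ?_
    by_cases h : (l, i) ∈ T
    · simpa only [ext, h, dif_pos] using measurable_pi_apply _
    · simp only [ext, h, dif_neg, not_false_eq_true, measurable_const]
  have hdisj : Disjoint {(k, j)} T := Finset.disjoint_singleton_left.2 hq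
  have h1 := (hindep.indepFun_finset {(k, j)} T hdisj fun q => hξ q.1 q.2).comp
    (measurable_pi_apply (⟨(k, j), Finset.mem_singleton_self _⟩ : ({(k, j)} : Finset (ℕ × Fin 2))))
    (hΦ.comp hext)
  have h2 : (fun ω => Φ fun l i => ξ l i ω) = (Φ ∘ ext) ∘ fun ω (q : T) => ξ q.1.1 q.1.2 ω := by
    funext ω
    refine hdep _ _ fun q hqT => ?_
    have : (q.1, q.2) ∈ T := hqT
    simp only [ext, this, dif_pos]
  rw [h2]
  exact h1

lemma iterω_succ {Θ Ω : Type*} (𝒞 : Θ → Stack n p → Stack n p) (ξ : ℕ → Fin 2 → Ω → Θ) (k : ℕ)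
    (ω : Ω) : iterω D 𝒞 ξ (k + 1) ω
      = step D (D.s k) (𝒞 (ξ k 0 ω)) (𝒞 (ξ k 1 ω)) (iterω D 𝒞 ξ k ω) := rfl

section Independence

variable {Θ Ω : Type*} [MeasurableSpace Θ] [MeasurableSpace Ω] {P : Measure Ω}
  [IsProbabilityMeasure P] {ξ : ℕ → Fin 2 → Ω → Θ} {𝒞 : Θ → Stack n p → Stack n p}

lemma measurableState_iterω (hsm : D.SmoothAssumption) (hL : 0 ≤ D.L)
    (h𝒞 : Measurable fun z : Θ × Stack n p => 𝒞 z.1 z.2) (hξ : ∀ k j, Measurable (ξ k j))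
    (k : ℕ) : MeasurableState fun ω => iterω D 𝒞 ξ k ω :=
  (measurableState_iter hsm hL h𝒞 k).comp
    (measurable_pi_lambda _ fun l => measurable_pi_lambda _ fun j => hξ l j)

lemma indepFun_inputX (hsm : D.SmoothAssumption) (hL : 0 ≤ D.L)
    (h𝒞 : Measurable fun z : Θ × Stack n p => 𝒞 z.1 z.2) (hξ : ∀ k j, Measurable (ξ k j))
    (hindep : iIndepFun (fun q : ℕ × Fin 2 => ξ q.1 q.2) P) (k : ℕ) :
    IndepFun (ξ k 0)
      (fun ω => (iterω D 𝒞 ξ k ω).Xtilde D - (iterω D 𝒞 ξ k ω).Hx) P := by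
  have hm := measurableState_iter (𝒞 := 𝒞) hsm hL h𝒞 k
  refine indepFun_of_depends hξ hindep
    (Φ := fun τ => (iter D 𝒞 τ k).Xtilde D - (iter D 𝒞 τ k).Hx) (hm.xtilde.sub hm.Hx)
    (Finset.range k ×ˢ Finset.univ) (fun τ τ' h => ?_) (by simp)
  have : iter D 𝒞 τ k = iter D 𝒞 τ' k := iter_congr fun l hl j => h (l, j) (by simpa using hl)
  simp only [this]

lemma indepFun_inputY (hsm : D.SmoothAssumption) (hL : 0 ≤ D.L)
    (h𝒞 : Measurable fun z : Θ × Stack n p => 𝒞 z.1 z.2) (hξ : ∀ k j, Measurable (ξ k j))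
    (hindep : iIndepFun (fun q : ℕ × Fin 2 => ξ q.1 q.2) P) (k : ℕ) :
    IndepFun (ξ k 1) (fun ω => yTilde D (iterω D 𝒞 ξ k ω) (iterω D 𝒞 ξ (k + 1) ω)
      - (iterω D 𝒞 ξ k ω).Hy) P := by
  have hm := measurableState_iter (𝒞 := 𝒞) hsm hL h𝒞 k
  have hm' := measurableState_iter (𝒞 := 𝒞) hsm hL h𝒞 (k + 1)
  have hg := (hsm.continuous_gradF hL).measurable
  refine indepFun_of_depends hξ hindep
    (Φ := fun τ => yTilde D (iter D 𝒞 τ k) (iter D 𝒞 τ (k + 1)) - (iter D 𝒞 τ k).Hy)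
    (((hm.Y.add (hg.comp hm'.X)).sub (hg.comp hm.X)).sub hm.Hy)
    (insert (k, 0) (Finset.range k ×ˢ Finset.univ)) (fun τ τ' h => ?_) (by simp)
  have h1 : iter D 𝒞 τ k = iter D 𝒞 τ' k := iter_congr fun l hl j => h (l, j) (by simp [hl])
  have h2 : (iter D 𝒞 τ (k + 1)).X = (iter D 𝒞 τ' (k + 1)).X := by
    have h3 : ∀ τ : ℕ → Fin 2 → Θ, (iter D 𝒞 τ (k + 1)).X
        = (step D (D.s k) (𝒞 (τ k 0)) (𝒞 (τ k 0)) (iter D 𝒞 τ k)).X := fun τ => rfl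
    rw [h3, h3, h1, h (k, 0) (by simp)]
  simp only [yTilde, h1, h2]

end Independence

end Iterates

/-! ### Square integrability of the iterates -/

lemma integrable_sq_norm {Ω E : Type*} [MeasurableSpace Ω] {P : Measure Ω} [NormedAddCommGroup E]
    {f : Ω → E} (hf : MemLp f 2 P) : Integrable (fun ω => ‖f ω‖ ^ 2) P :=
  (memLp_two_iff_integrable_sq_norm hf.1).1 hf

/-- The output of a scaled compression of a square integrable input is square integrable. -/
lemma CompressionAssumption.memLp_output {Θ Ω E : Type*} [MeasurableSpace Θ] [MeasurableSpace Ω]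
    {ν : Measure Θ} {P : Measure Ω} [IsProbabilityMeasure ν] [IsProbabilityMeasure P]
    [NormedAddCommGroup E] [InnerProductSpace ℝ E] [MeasurableSpace E] [BorelSpace E]
    [SecondCountableTopology E] {𝒞 : Θ → E → E} {c : CompConst} {ξ : Ω → Θ} {U : Ω → E} {s : ℝ}
    (h : CompressionAssumption ν 𝒞 c) (hξ : Measurable ξ) (hlaw : P.map ξ = ν)
    (hU : Measurable U) (hind : IndepFun ξ U P) (hU2 : MemLp U 2 P) (hs : s ≠ 0) :
    MemLp (fun ω => s • 𝒞 (ξ ω) (s⁻¹ • U ω)) 2 P := by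
  have hm : Measurable (fun ω => s • 𝒞 (ξ ω) (s⁻¹ • U ω)) :=
    (h.measurable.comp (hξ.prodMk (hU.const_smul s⁻¹))).const_smul s
  have h1 : MemLp (fun ω => s • 𝒞 (ξ ω) (s⁻¹ • U ω) - U ω) 2 P :=
    (memLp_two_iff_integrable_sq_norm (hm.sub hU).aestronglyMeasurable).2
      (h.error_expectation_le hξ hlaw hU hind (integrable_sq_norm hU2) hs).1
  refine (h1.add hU2).ae_eq (Filter.Eventually.of_forall fun ω => ?_)
  simp only [Pi.add_apply, sub_add_cancel]

section Integrability

variable {n p : ℕ} {D : Input n p} {W : Aux n} {c : CompConst} {Θ Ω : Type*} [MeasurableSpace Θ]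
  [MeasurableSpace Ω] {𝒞 : Θ → Stack n p → Stack n p} {ν : Measure Θ} {P : Measure Ω}
  {ξ : ℕ → Fin 2 → Ω → Θ}

lemma memLp_mulStack {Z : Ω → Stack n p} (hZ : MemLp Z 2 P) (A : Matrix (Fin n) (Fin n) ℝ) :
    MemLp (fun ω => mulStack A (Z ω)) 2 P := by
  refine hZ.of_le_mul (c := ‖Matrix.toEuclideanCLM (n := Fin n) (𝕜 := ℝ) A‖)
    ((continuous_mulStack A).comp_aestronglyMeasurable hZ.1) (Filter.Eventually.of_forall fun ω => ?_)
  have := norm_mulStack_le_of_forall (A := A) (B := 1) (norm_nonneg _)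
    (fun v => by
      simpa using (Matrix.toEuclideanCLM (n := Fin n) (𝕜 := ℝ) A).le_opNorm v) (Z ω)
  simpa only [one_mulStack] using this

lemma memLp_gradF_sub (hsm : D.SmoothAssumption) (hL : 0 ≤ D.L) {Z Z' : Ω → Stack n p}
    (hZ : MemLp Z 2 P) (hZ' : MemLp Z' 2 P) :
    MemLp (fun ω => D.gradF (Z' ω) - D.gradF (Z ω)) 2 P :=
  (hZ'.sub hZ).of_le_mul (c := D.L)
    (((hsm.continuous_gradF hL).comp_aestronglyMeasurable hZ'.1).sub
      ((hsm.continuous_gradF hL).comp_aestronglyMeasurable hZ.1))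
    (Filter.Eventually.of_forall fun _ => hsm.gradF_sub_le hL _ _)

lemma memLp_avg {Z : Ω → Stack n p} (hZ : MemLp Z 2 P) (u : Vec n) :
    MemLp (fun ω => avg u (Z ω)) 2 P := by
  have hc : Continuous (avg u : Stack n p → Vec p) := by
    unfold avg
    fun_prop
  exact hZ.of_le_mul (hc.comp_aestronglyMeasurable hZ.1)
    (Filter.Eventually.of_forall fun ω => norm_avg_le u (Z ω))

/-- All assumptions on the algorithm and its random seeds. -/
structure RandomSetting (D : Input n p) (W : Aux n) (c : CompConst)
    (𝒞 : Θ → Stack n p → Stack n p) (ν : Measure Θ) (P : Measure Ω)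
    (ξ : ℕ → Fin 2 → Ω → Θ) : Prop extends Setting D W where
  compression : CompressionAssumption ν 𝒞 c
  s_ne_zero : ∀ k, D.s k ≠ 0
  seed_measurable : ∀ k j, Measurable (ξ k j)
  law : ∀ k j, P.map (ξ k j) = ν
  indep : iIndepFun (fun q : ℕ × Fin 2 => ξ q.1 q.2) P
  αx_pos : 0 < D.αx
  αx_le : D.αx ≤ 1 / c.r
  αy_pos : 0 < D.αy
  αy_le : D.αy ≤ 1 / c.r

/-- The random state has square integrable components. -/
structure SquareIntegrable (P : Measure Ω) (F : Ω → State n p) : Prop where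
  X : MemLp (fun ω => (F ω).X) 2 P
  Y : MemLp (fun ω => (F ω).Y) 2 P
  Hx : MemLp (fun ω => (F ω).Hx) 2 P
  Hy : MemLp (fun ω => (F ω).Hy) 2 P

lemma SquareIntegrable.xtilde {F : Ω → State n p} (h : SquareIntegrable P F) :
    MemLp (fun ω => (F ω).Xtilde D) 2 P := h.X.sub (memLp_mulStack h.Y _)

namespace RandomSetting

lemma measurableState (h : RandomSetting D W c 𝒞 ν P ξ) (k : ℕ) :
    MeasurableState fun ω => iterω D 𝒞 ξ k ω :=
  measurableState_iterω h.smooth h.L_pos.le h.compression.measurable h.seed_measurable k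

lemma invariant (h : RandomSetting D W c 𝒞 ν P ξ) (k : ℕ) (ω : Ω) :
    Invariant D (iterω D 𝒞 ξ k ω) := invariant_iter _ h.col_sum k

lemma measurable_inputX (h : RandomSetting D W c 𝒞 ν P ξ) (k : ℕ) :
    Measurable fun ω => (iterω D 𝒞 ξ k ω).Xtilde D - (iterω D 𝒞 ξ k ω).Hx :=
  (h.measurableState k).xtilde.sub (h.measurableState k).Hx

lemma measurable_inputY (h : RandomSetting D W c 𝒞 ν P ξ) (k : ℕ) :
    Measurable fun ω => yTilde D (iterω D 𝒞 ξ k ω) (iterω D 𝒞 ξ (k + 1) ω)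
      - (iterω D 𝒞 ξ k ω).Hy := by
  have hg := (h.smooth.continuous_gradF h.L_pos.le).measurable
  exact (((h.measurableState k).Y.add (hg.comp (h.measurableState (k + 1)).X)).sub
    (hg.comp (h.measurableState k).X)).sub (h.measurableState k).Hy

variable [IsProbabilityMeasure ν] [IsProbabilityMeasure P]

lemma memLp_outputX (h : RandomSetting D W c 𝒞 ν P ξ) {k : ℕ}
    (hk : SquareIntegrable P (iterω D 𝒞 ξ k)) :
    MemLp (fun ω => D.s k • 𝒞 (ξ k 0 ω) ((D.s k)⁻¹ •
      ((iterω D 𝒞 ξ k ω).Xtilde D - (iterω D 𝒞 ξ k ω).Hx))) 2 P :=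
  h.compression.memLp_output (h.seed_measurable k 0) (h.law k 0) (h.measurable_inputX k)
    (indepFun_inputX h.smooth h.L_pos.le h.compression.measurable h.seed_measurable h.indep k)
    (hk.xtilde.sub hk.Hx) (h.s_ne_zero k)

lemma memLp_errX (h : RandomSetting D W c 𝒞 ν P ξ) {k : ℕ}
    (hk : SquareIntegrable P (iterω D 𝒞 ξ k)) :
    MemLp (fun ω => errX D (D.s k) (𝒞 (ξ k 0 ω)) (iterω D 𝒞 ξ k ω)) 2 P :=
  (hk.Hx.add (h.memLp_outputX hk)).sub hk.xtilde

lemma memLp_X_succ (h : RandomSetting D W c 𝒞 ν P ξ) {k : ℕ}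
    (hk : SquareIntegrable P (iterω D 𝒞 ξ k)) :
    MemLp (fun ω => (iterω D 𝒞 ξ (k + 1) ω).X) 2 P := by
  simp only [iterω_succ, step_X (h.invariant k _)]
  exact (memLp_mulStack (hk.X.add (memLp_mulStack hk.Y _).neg) _).sub
    ((memLp_mulStack (h.memLp_errX hk) _).const_smul D.γx)

lemma memLp_yTilde (h : RandomSetting D W c 𝒞 ν P ξ) {k : ℕ}
    (hk : SquareIntegrable P (iterω D 𝒞 ξ k)) :
    MemLp (fun ω => yTilde D (iterω D 𝒞 ξ k ω) (iterω D 𝒞 ξ (k + 1) ω)) 2 P := by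
  have := hk.Y.add (memLp_gradF_sub h.smooth h.L_pos.le hk.X (h.memLp_X_succ hk))
  refine this.ae_eq (Filter.Eventually.of_forall fun ω => ?_)
  simp only [yTilde, Pi.add_apply]
  abel

lemma memLp_outputY (h : RandomSetting D W c 𝒞 ν P ξ) {k : ℕ}
    (hk : SquareIntegrable P (iterω D 𝒞 ξ k)) :
    MemLp (fun ω => D.s k • 𝒞 (ξ k 1 ω) ((D.s k)⁻¹ •
      (yTilde D (iterω D 𝒞 ξ k ω) (iterω D 𝒞 ξ (k + 1) ω) - (iterω D 𝒞 ξ k ω).Hy))) 2 P :=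
  h.compression.memLp_output (h.seed_measurable k 1) (h.law k 1) (h.measurable_inputY k)
    (indepFun_inputY h.smooth h.L_pos.le h.compression.measurable h.seed_measurable h.indep k)
    ((h.memLp_yTilde hk).sub hk.Hy) (h.s_ne_zero k)

lemma memLp_errY (h : RandomSetting D W c 𝒞 ν P ξ) {k : ℕ}
    (hk : SquareIntegrable P (iterω D 𝒞 ξ k)) :
    MemLp (fun ω => errY D (D.s k) (𝒞 (ξ k 1 ω)) (iterω D 𝒞 ξ k ω) (iterω D 𝒞 ξ (k + 1) ω)) 2 P :=
  (hk.Hy.add (h.memLp_outputY hk)).sub (h.memLp_yTilde hk)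

lemma squareIntegrable (h : RandomSetting D W c 𝒞 ν P ξ) (k : ℕ) :
    SquareIntegrable P (iterω D 𝒞 ξ k) := by
  induction k with
  | zero => exact ⟨memLp_const _, memLp_const _, memLp_const _, memLp_const _⟩
  | succ k hk =>
    have hX := h.memLp_X_succ hk
    refine ⟨hX, ?_, ?_, ?_⟩
    · simp only [iterω_succ, step_Y (h.invariant k _)]
      exact (memLp_mulStack (hk.Y.add (memLp_gradF_sub h.smooth h.L_pos.le hk.X hX)) _).sub
        ((memLp_mulStack (h.memLp_errY hk) _).const_smul D.γy)
    · exact (hk.Hx.const_smul (1 - D.αx)).add ((hk.Hx.add (h.memLp_outputX hk)).const_smul D.αx)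
    · exact (hk.Hy.const_smul (1 - D.αy)).add ((hk.Hy.add (h.memLp_outputY hk)).const_smul D.αy)

/-! ### Expected compression errors of the iterates -/

lemma integral_errX_le (h : RandomSetting D W c 𝒞 ν P ξ) (k : ℕ) :
    ∫ ω, ‖errX D (D.s k) (𝒞 (ξ k 0 ω)) (iterω D 𝒞 ξ k ω)‖ ^ 2 ∂P
      ≤ c.C * errCx D 𝒞 P ξ k + D.s k ^ 2 * c.sigmaSq := by
  have hk := h.squareIntegrable k
  have h1 := (h.compression.error_expectation_le (h.seed_measurable k 0) (h.law k 0)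
    (h.measurable_inputX k)
    (indepFun_inputX h.smooth h.L_pos.le h.compression.measurable h.seed_measurable h.indep k)
    (integrable_sq_norm (hk.xtilde.sub hk.Hx)) (h.s_ne_zero k)).2
  refine (le_of_eq ?_).trans h1
  congr 1 with ω
  rw [errX]
  congr 2
  abel

lemma integral_contractX_le (h : RandomSetting D W c 𝒞 ν P ξ) (k : ℕ) :
    ∫ ω, ‖(iterω D 𝒞 ξ k ω).Xtilde D - (iterω D 𝒞 ξ (k + 1) ω).Hx‖ ^ 2 ∂P
      ≤ (1 - D.αx * c.r * c.δ) * errCx D 𝒞 P ξ k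
        + D.αx * c.r * (D.s k ^ 2 * c.sigmaRSq) := by
  have hk := h.squareIntegrable k
  have h1 := (h.compression.contraction_expectation_le (h.seed_measurable k 0) (h.law k 0)
    (h.measurable_inputX k)
    (indepFun_inputX h.smooth h.L_pos.le h.compression.measurable h.seed_measurable h.indep k)
    (integrable_sq_norm (hk.xtilde.sub hk.Hx)) (h.s_ne_zero k) h.αx_pos h.αx_le).2
  simpa only [iterω_succ, Xtilde_sub_step_Hx, errCx] using h1

lemma integral_errY_le (h : RandomSetting D W c 𝒞 ν P ξ) (k : ℕ) :
    ∫ ω, ‖errY D (D.s k) (𝒞 (ξ k 1 ω)) (iterω D 𝒞 ξ k ω) (iterω D 𝒞 ξ (k + 1) ω)‖ ^ 2 ∂P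
      ≤ c.C * ∫ ω, ‖yTilde D (iterω D 𝒞 ξ k ω) (iterω D 𝒞 ξ (k + 1) ω)
          - (iterω D 𝒞 ξ k ω).Hy‖ ^ 2 ∂P + D.s k ^ 2 * c.sigmaSq := by
  have hk := h.squareIntegrable k
  have h1 := (h.compression.error_expectation_le (h.seed_measurable k 1) (h.law k 1)
    (h.measurable_inputY k)
    (indepFun_inputY h.smooth h.L_pos.le h.compression.measurable h.seed_measurable h.indep k)
    (integrable_sq_norm ((h.memLp_yTilde hk).sub hk.Hy)) (h.s_ne_zero k)).2
  refine (le_of_eq ?_).trans h1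
  congr 1 with ω
  rw [errY]
  congr 2
  abel

lemma integral_contractY_le (h : RandomSetting D W c 𝒞 ν P ξ) (k : ℕ) :
    ∫ ω, ‖yTilde D (iterω D 𝒞 ξ k ω) (iterω D 𝒞 ξ (k + 1) ω)
        - (iterω D 𝒞 ξ (k + 1) ω).Hy‖ ^ 2 ∂P
      ≤ (1 - D.αy * c.r * c.δ) * ∫ ω, ‖yTilde D (iterω D 𝒞 ξ k ω) (iterω D 𝒞 ξ (k + 1) ω)
          - (iterω D 𝒞 ξ k ω).Hy‖ ^ 2 ∂P + D.αy * c.r * (D.s k ^ 2 * c.sigmaRSq) := by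
  have hk := h.squareIntegrable k
  have h1 := (h.compression.contraction_expectation_le (h.seed_measurable k 1) (h.law k 1)
    (h.measurable_inputY k)
    (indepFun_inputY h.smooth h.L_pos.le h.compression.measurable h.seed_measurable h.indep k)
    (integrable_sq_norm ((h.memLp_yTilde hk).sub hk.Hy)) (h.s_ne_zero k) h.αy_pos h.αy_le).2
  simpa only [iterω_succ, yTilde_sub_step_Hy] using h1

end RandomSetting

/-! ### Integrability of objective values and gradients -/

lemma gradient_minimizer {xstar : Vec p} (hx : ∀ x, D.obj xstar ≤ D.obj x) :
    gradient D.obj xstar = 0 := by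
  have : IsLocalMin D.obj xstar := Filter.Eventually.of_forall hx
  rw [gradient, this.fderiv_eq_zero, map_zero]

lemma memLp_gradient_obj [NeZero n] [IsFiniteMeasure P] (hsm : D.SmoothAssumption) (hL : 0 ≤ D.L)
    {Z : Ω → Vec p} (hZ : MemLp Z 2 P) : MemLp (fun ω => gradient D.obj (Z ω)) 2 P := by
  have hc : Continuous (gradient D.obj) :=
    (LipschitzWith.of_dist_le_mul (K := ⟨D.L, hL⟩) fun X Y => by
      rw [dist_eq_norm, dist_eq_norm]
      exact hsm.gradient_obj_sub_le X Y).continuous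
  have h0 : MemLp (fun ω => gradient D.obj (Z ω) - gradient D.obj 0) 2 P :=
    hZ.of_le_mul (c := D.L) ((hc.comp_aestronglyMeasurable hZ.1).sub aestronglyMeasurable_const)
      (Filter.Eventually.of_forall fun ω => by
        simpa using hsm.gradient_obj_sub_le (Z ω) 0)
  refine (h0.add (memLp_const (gradient D.obj 0))).ae_eq (Filter.Eventually.of_forall fun ω => ?_)
  simp only [Pi.add_apply, sub_add_cancel]

lemma integrable_obj [NeZero n] [IsFiniteMeasure P] (hsm : D.SmoothAssumption)
    {xstar : Vec p} (hx : ∀ x, D.obj xstar ≤ D.obj x) {Z : Ω → Vec p} (hZ : MemLp Z 2 P) :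
    Integrable (fun ω => D.obj (Z ω) - D.obj xstar) P := by
  have h1 : Integrable (fun ω => D.L / 2 * ‖Z ω - xstar‖ ^ 2) P :=
    (integrable_sq_norm (hZ.sub (memLp_const xstar))).const_mul _
  refine h1.mono' ((hsm.differentiable_obj.continuous.comp_aestronglyMeasurable hZ.1).sub
    aestronglyMeasurable_const) (Filter.Eventually.of_forall fun ω => ?_)
  rw [Real.norm_of_nonneg (sub_nonneg.2 (hx _))]
  have h2 := le_add_of_lipschitz_gradient hsm.differentiable_obj hsm.gradient_obj_sub_le xstar
    (Z ω - xstar)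
  rw [gradient_minimizer hx, inner_zero_left, add_sub_cancel] at h2
  linarith

end Integrability

/-! ### Linear bounds for expectations -/

lemma integral_le_four {Ω : Type*} [MeasurableSpace Ω] {P : Measure Ω} {f g₁ g₂ g₃ g₄ : Ω → ℝ}
    {a₁ a₂ a₃ a₄ : ℝ} (hf : Integrable f P) (h₁ : Integrable g₁ P) (h₂ : Integrable g₂ P)
    (h₃ : Integrable g₃ P) (h₄ : Integrable g₄ P)
    (h : ∀ ω, f ω ≤ a₁ * g₁ ω + a₂ * g₂ ω + a₃ * g₃ ω + a₄ * g₄ ω) :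
    ∫ ω, f ω ∂P ≤ a₁ * ∫ ω, g₁ ω ∂P + a₂ * ∫ ω, g₂ ω ∂P + a₃ * ∫ ω, g₃ ω ∂P
      + a₄ * ∫ ω, g₄ ω ∂P := by
  have i₁ := h₁.const_mul a₁
  have i₂ := h₂.const_mul a₂
  have i₃ := h₃.const_mul a₃
  have i₄ := h₄.const_mul a₄
  refine (integral_mono hf (((i₁.add i₂).add i₃).add i₄) h).trans_eq ?_
  have e₁ : ∫ ω, (a₁ * g₁ ω + a₂ * g₂ ω + a₃ * g₃ ω + a₄ * g₄ ω) ∂P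
      = ∫ ω, (a₁ * g₁ ω + a₂ * g₂ ω + a₃ * g₃ ω) ∂P + ∫ ω, a₄ * g₄ ω ∂P :=
    integral_add ((i₁.add i₂).add i₃) i₄
  have e₂ : ∫ ω, (a₁ * g₁ ω + a₂ * g₂ ω + a₃ * g₃ ω) ∂P
      = ∫ ω, (a₁ * g₁ ω + a₂ * g₂ ω) ∂P + ∫ ω, a₃ * g₃ ω ∂P := integral_add (i₁.add i₂) i₃
  have e₃ : ∫ ω, (a₁ * g₁ ω + a₂ * g₂ ω) ∂P = ∫ ω, a₁ * g₁ ω ∂P + ∫ ω, a₂ * g₂ ω ∂P :=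
    integral_add i₁ i₂
  change ∫ ω, (a₁ * g₁ ω + a₂ * g₂ ω + a₃ * g₃ ω + a₄ * g₄ ω) ∂P = _
  rw [e₁, e₂, e₃, integral_const_mul, integral_const_mul, integral_const_mul, integral_const_mul]

lemma integral_le_three {Ω : Type*} [MeasurableSpace Ω] {P : Measure Ω} {f g₁ g₂ g₃ : Ω → ℝ}
    {a₁ a₂ a₃ : ℝ} (hf : Integrable f P) (h₁ : Integrable g₁ P) (h₂ : Integrable g₂ P)
    (h₃ : Integrable g₃ P) (h : ∀ ω, f ω ≤ a₁ * g₁ ω + a₂ * g₂ ω + a₃ * g₃ ω) :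
    ∫ ω, f ω ∂P ≤ a₁ * ∫ ω, g₁ ω ∂P + a₂ * ∫ ω, g₂ ω ∂P + a₃ * ∫ ω, g₃ ω ∂P := by
  simpa using integral_le_four (a₄ := 0) hf h₁ h₂ h₃ (integrable_zero _ _ _) (by simpa using h)

/-! ### Consequences of the step-size conditions -/

section StepSizes

variable {n p : ℕ} {D : Input n p} {W : Aux n} {c : CompConst}

lemma StepSizeCondition.γy_mul_C_le (hc : StepSizeCondition D W c) (hC : 0 ≤ c.C)
    (hθ : 0 ≤ W.θC) :
    D.γy * c.C * (432 * e2 c) ≤ W.θC * (D.αy * c.r * c.δ) ^ 2 := by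
  rcases hC.eq_or_lt with h0 | h0
  · rw [← h0, mul_zero, zero_mul]
    positivity
  · have he : 0 < e2 c := by
      rw [e2]
      linarith
    have h1 := hc.γy_3 h0
    rw [le_div_iff₀ (by positivity)] at h1
    linarith

variable [NeZero n]

namespace Setting

lemma one_le_δR (h : Setting D W) : 1 ≤ W.δR := h.valid.normR.one_le

lemma one_le_δC (h : Setting D W) : 1 ≤ W.δC := h.valid.normC.one_le

lemma two_mul_le_e1 (h : Setting D W) (hC : 0 ≤ c.C) : 2 * (1 + 18 * c.C) ≤ e1 W c := by
  have := one_le_pow₀ (n := 2) h.one_le_δC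
  rw [e1]
  nlinarith

lemma e1_pos (h : Setting D W) (hC : 0 ≤ c.C) : 0 < e1 W c := by
  have := h.two_mul_le_e1 hC
  linarith

lemma norm_uR_pos (h : Setting D W) : 0 < ‖W.uR‖ := h.valid.uR.norm_pos

lemma norm_uC_pos (h : Setting D W) : 0 < ‖W.uC‖ := h.valid.uC.norm_pos

lemma n_pos (_ : Setting D W) : (0 : ℝ) < n := by exact_mod_cast NeZero.pos n

lemma n_mul_M_le (h : Setting D W) : n * W.M ≤ ‖W.uR‖ * ‖W.uC‖ := by
  have hn := h.n_pos
  have h1 := h.M_le.trans h.lamBar_le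
  rw [le_div_iff₀ hn] at h1
  have h2 : D.lamHat * (n * W.M) ≤ D.lamHat * (‖W.uR‖ * ‖W.uC‖) := by linarith
  exact le_of_mul_le_mul_left h2 h.lamHat_pos

lemma coefE_pos (h : Setting D W) : 0 < coefE W := by
  have := h.norm_uR_pos
  have := h.norm_uC_pos
  have := h.M_pos
  have := h.n_pos
  rw [coefE]
  positivity

lemma coefE_mul (h : Setting D W) : coefE W * (n ^ 2 * W.M) = ‖W.uR‖ * ‖W.uC‖ := by
  have := h.M_pos
  have := h.n_pos
  rw [coefE]
  field_simp

lemma one_le_n_mul_coefE (h : Setting D W) : 1 ≤ n * coefE W := by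
  have hM := h.M_pos
  have hn := h.n_pos
  have h1 : n * W.M * 1 ≤ n * W.M * (n * coefE W) := by
    have := h.coefE_mul
    have := h.n_mul_M_le
    nlinarith
  exact le_of_mul_le_mul_left h1 (by positivity)

lemma γx_sq_le_of_step (h : Setting D W) (hC : 0 ≤ c.C) (hc : StepSizeCondition D W c) :
    D.γx ^ 2 * (108 * ‖W.uR‖ * e1 W c) ≤ W.M * ‖W.uC‖ * (W.θC * D.γy) ^ 2 := by
  have he := h.e1_pos hC
  have hr := h.norm_uR_pos
  have hcc := h.norm_uC_pos
  have hM := h.M_pos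
  have h1 := pow_le_pow_left₀ h.γx_pos.le hc.γx_3 2
  rw [mul_assoc, mul_pow, div_pow, Real.sq_sqrt (by positivity), Real.sq_sqrt (by positivity),
    div_mul_eq_mul_div, le_div_iff₀ (by positivity)] at h1
  exact h1

lemma γx_le (h : Setting D W) (hC : 0 ≤ c.C) (hc : StepSizeCondition D W c) :
    D.γx ≤ 1 / 14 := by
  have he := h.e1_pos hC
  have hr := h.norm_uR_pos
  have hcc := h.norm_uC_pos
  have hM := h.M_pos
  have hn := h.n_pos
  have hτ : W.θC * D.γy ≤ 1 := h.valid.normC.θ_mul_le_one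
  have hτ0 : 0 < W.θC * D.γy := mul_pos h.valid.normC.θ_pos h.γy_pos
  have hb : ‖W.uC‖ ^ 2 ≤ n * W.δC ^ 2 := norm_sq_le_projC h.valid.normC h.valid.uC.sum_eq
  have h1 : D.γx ^ 2 * (108 * ‖W.uR‖ * e1 W c) ≤ W.M * ‖W.uC‖ := by
    refine (h.γx_sq_le_of_step hC hc).trans (mul_le_of_le_one_right (by positivity) ?_)
    exact pow_le_one₀ hτ0.le hτ
  have h2 : n * (W.M * ‖W.uC‖) ≤ ‖W.uR‖ * (n * W.δC ^ 2) := by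
    have := mul_le_mul_of_nonneg_right h.n_mul_M_le hcc.le
    nlinarith
  have h3 : D.γx ^ 2 * (216 * W.δC ^ 2) ≤ D.γx ^ 2 * (108 * e1 W c) := by
    refine mul_le_mul_of_nonneg_left ?_ (sq_nonneg _)
    rw [e1]
    nlinarith [sq_nonneg W.δC, mul_nonneg (sq_nonneg W.δC) hC]
  have h4 : (n * ‖W.uR‖ * W.δC ^ 2) * (D.γx ^ 2 * 216) ≤ (n * ‖W.uR‖ * W.δC ^ 2) * 1 := by
    have h5 := mul_le_mul_of_nonneg_left h1 hn.le
    have h6 := mul_le_mul_of_nonneg_left h3 (mul_pos hn hr).le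
    linarith
  have hδ : 0 < W.δC := by linarith [h.one_le_δC]
  have h7 := le_of_mul_le_mul_left h4 (by positivity)
  nlinarith [h.γx_pos]

lemma θγx_le (h : Setting D W) (hC : 0 ≤ c.C) (hc : StepSizeCondition D W c) :
    W.θR * D.γx ≤ 1 / 14 :=
  (mul_le_of_le_one_left h.γx_pos.le h.valid.normR.θ_le_one).trans (h.γx_le hC hc)

lemma lamHat_sq_le_consensus (h : Setting D W) (hC : 0 ≤ c.C) (hc : StepSizeCondition D W c) :
    D.L ^ 2 * D.lamHat ^ 2 * W.δR ^ 2 * (1 - W.θR * D.γx) ^ 2 * (384 * coefE W * ‖W.uC‖ ^ 2)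
      ≤ (W.θR * D.γx) ^ 2 := by
  have hE := h.coefE_pos
  have hcc := h.norm_uC_pos
  have hL := h.L_pos
  have hl := h.lamHat_pos
  have hδ : 0 < W.δR := by linarith [h.one_le_δR]
  have hκ := h.θγx_le hC hc
  have hκ' : 0 < 1 - W.θR * D.γx := by linarith
  have he3 : e3 D W * D.γx ≤ 1 / (2 * W.δR) * (W.θR / (1 - W.θR * D.γx)) * D.γx :=
    mul_le_mul_of_nonneg_right (min_le_left _ _) h.γx_pos.le
  have h1 : D.lamHat ≤ (1 / (2 * W.δR) * (W.θR / (1 - W.θR * D.γx)) * D.γx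
      / (√(96 * coefE W) * ‖W.uC‖)) * (1 / D.L) := by
    refine hc.lam_5.trans ?_
    gcongr
  have h2 : D.lamHat * D.L * W.δR * (1 - W.θR * D.γx) * (2 * √(96 * coefE W) * ‖W.uC‖)
      ≤ W.θR * D.γx := by
    have hs : 0 < √(96 * coefE W) := by positivity
    have e : (1 / (2 * W.δR) * (W.θR / (1 - W.θR * D.γx)) * D.γx
        / (√(96 * coefE W) * ‖W.uC‖)) * (1 / D.L)
        = W.θR * D.γx
          / (D.L * W.δR * (1 - W.θR * D.γx) * (2 * √(96 * coefE W) * ‖W.uC‖)) := by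
      field_simp
    rw [e, le_div_iff₀ (by positivity)] at h1
    linarith
  have h3 := pow_le_pow_left₀ (by positivity) h2 2
  refine le_trans (le_of_eq ?_) h3
  have hs : √(96 * coefE W) ^ 2 = 96 * coefE W := Real.sq_sqrt (by positivity)
  have : (D.lamHat * D.L * W.δR * (1 - W.θR * D.γx) * (2 * √(96 * coefE W) * ‖W.uC‖)) ^ 2
      = D.L ^ 2 * D.lamHat ^ 2 * W.δR ^ 2 * (1 - W.θR * D.γx) ^ 2
        * (4 * √(96 * coefE W) ^ 2 * ‖W.uC‖ ^ 2) := by ring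
  rw [this, hs]
  ring

lemma lamHat_sq_le_tracking (h : Setting D W) (hC : 0 ≤ c.C) (hc : StepSizeCondition D W c) :
    D.L ^ 2 * D.lamHat ^ 2 * (1296 * e1 W c) ≤ (W.θC * D.γy) ^ 2 := by
  have he := h.e1_pos hC
  have hL := h.L_pos
  have hl := h.lamHat_pos
  have hτ0 : 0 < W.θC * D.γy := mul_pos h.valid.normC.θ_pos h.γy_pos
  have hs : 0 < √(48 * e1 W c) := by positivity
  have he4 : e4 D W ≤ 1 / (3 * √3) := min_le_right _ _
  have h1 : D.lamHat ≤ (1 / (3 * √3) * (W.θC * D.γy) / √(48 * e1 W c)) * (1 / D.L) := by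
    refine hc.lam_6.trans ?_
    rw [mul_assoc (e4 D W)]
    gcongr
  have e : (1 / (3 * √3) * (W.θC * D.γy) / √(48 * e1 W c)) * (1 / D.L)
      = W.θC * D.γy / (D.L * (3 * √3) * √(48 * e1 W c)) := by
    field_simp
  rw [e, le_div_iff₀ (by positivity)] at h1
  have h3 := pow_le_pow_left₀ (by positivity) h1 2
  refine le_trans (le_of_eq ?_) h3
  have hs2 : √(48 * e1 W c) ^ 2 = 48 * e1 W c := Real.sq_sqrt (by positivity)
  have hs3 : √(3 : ℝ) ^ 2 = 3 := Real.sq_sqrt (by norm_num)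
  have : (D.lamHat * (D.L * (3 * √3) * √(48 * e1 W c))) ^ 2
      = D.L ^ 2 * D.lamHat ^ 2 * (9 * √(3 : ℝ) ^ 2 * √(48 * e1 W c) ^ 2) := by ring
  rw [this, hs2, hs3]
  ring

lemma γy_mul_e1_le (h : Setting D W) (hC : 0 ≤ c.C) (hc : StepSizeCondition D W c) :
    D.γy * (432 * e1 W c) ≤ W.θC * e2 c := by
  have he := h.e1_pos hC
  have h1 := hc.γy_2
  rwa [le_div_iff₀ (by positivity)] at h1

lemma γy_le (h : Setting D W) (hC : 0 ≤ c.C) (hc : StepSizeCondition D W c) :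
    D.γy ≤ 7 / 54 := by
  have h1 := h.γy_mul_e1_le hC hc
  have h2 := h.two_mul_le_e1 hC
  have h3 := h.valid.normC.θ_le_one
  have h4 : W.θC * e2 c ≤ 112 * (1 + 18 * c.C) := by
    have : e2 c ≤ 112 * (1 + 18 * c.C) := by
      rw [e2]
      linarith
    have h0 : 0 ≤ e2 c := by
      rw [e2]
      linarith
    nlinarith
  have h5 : D.γy * (432 * (2 * (1 + 18 * c.C))) ≤ 112 * (1 + 18 * c.C) :=
    (mul_le_mul_of_nonneg_left (by linarith) h.γy_pos.le).trans (h1.trans h4)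
  have h6 : (1 + 18 * c.C) * D.γy ≤ (1 + 18 * c.C) * (7 / 54) := by linarith
  exact le_of_mul_le_mul_left h6 (by linarith)

lemma γx_sq_mul_C_le (h : Setting D W) (hC : 0 ≤ c.C) (ht : 0 ≤ D.αx * c.r * c.δ)
    (hc : StepSizeCondition D W c) :
    D.γx ^ 2 * W.δR ^ 2 * c.C * 373248 ≤ W.θR ^ 2 * (D.αx * c.r * c.δ) ^ 2 := by
  have hδ : 0 < W.δR := by linarith [h.one_le_δR]
  rcases hC.eq_or_lt with h0 | h0
  · rw [← h0, mul_zero, zero_mul]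
    positivity
  · have he5 : e5 W ≤ W.θR / (432 * √2 * W.δR) := min_le_left _ _
    have h1 : D.γx ≤ W.θR / (432 * √2 * W.δR) * (D.αx * c.r * c.δ) / √c.C := by
      refine (hc.γx_2 h0).trans ?_
      rw [mul_assoc (e5 W), mul_assoc (e5 W)]
      gcongr
    have hs : 0 < √c.C := by positivity
    have e : W.θR / (432 * √2 * W.δR) * (D.αx * c.r * c.δ) / √c.C
        = W.θR * (D.αx * c.r * c.δ) / (432 * √2 * W.δR * √c.C) := by
      field_simp
    rw [e, le_div_iff₀ (by positivity)] at h1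
    have h3 := pow_le_pow_left₀ (mul_nonneg h.γx_pos.le (by positivity)) h1 2
    rw [mul_pow W.θR] at h3
    refine le_trans (le_of_eq ?_) h3
    have hs2 : √c.C ^ 2 = c.C := Real.sq_sqrt hC
    have hs3 : √(2 : ℝ) ^ 2 = 2 := Real.sq_sqrt (by norm_num)
    have : (D.γx * (432 * √2 * W.δR * √c.C)) ^ 2
        = D.γx ^ 2 * W.δR ^ 2 * (186624 * √(2 : ℝ) ^ 2 * √c.C ^ 2) := by ring
    rw [this, hs2, hs3]
    ring

/-- The effective step-size `λ̄` is at most `1 / (2 L)`. -/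
lemma L_mul_lamBar_le (h : Setting D W) (hC : 0 ≤ c.C) (hc : StepSizeCondition D W c) :
    D.L * lamBar D W ≤ 1 / 2 := by
  have hL := h.L_pos
  have hl := h.lamHat_pos
  have hn := h.n_pos
  have hr := h.norm_uR_pos
  have hcc := h.norm_uC_pos
  have hE := h.coefE_pos
  have hκ := h.θγx_le hC hc
  have hκ0 : 0 < W.θR * D.γx := mul_pos h.valid.normR.θ_pos h.γx_pos
  have ha : ‖W.uR‖ ^ 2 ≤ n * W.δR ^ 2 := norm_sq_le_projR h.valid.normR h.valid.uR.sum_eq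
  have h1 := h.lamHat_sq_le_consensus hC hc
  set Q := D.L * D.lamHat * (‖W.uR‖ * ‖W.uC‖) / n with hQ
  have hQ0 : 0 ≤ Q := by positivity
  have h2 : D.L * lamBar D W ≤ Q := by
    refine (mul_le_mul_of_nonneg_left h.lamBar_le hL.le).trans_eq ?_
    rw [hQ]
    ring
  have h3 : Q ^ 2 ≤ D.L ^ 2 * D.lamHat ^ 2 * W.δR ^ 2 * (coefE W * ‖W.uC‖ ^ 2) := by
    have e1 : Q ^ 2 = D.L ^ 2 * D.lamHat ^ 2 * ‖W.uC‖ ^ 2 * (‖W.uR‖ ^ 2 / n) / n := by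
      rw [hQ]
      field_simp
    have e2 : ‖W.uR‖ ^ 2 / n ≤ W.δR ^ 2 := by
      rw [div_le_iff₀ hn]
      linarith
    have e3 : 1 / n ≤ coefE W := by
      rw [div_le_iff₀ hn]
      linarith [h.one_le_n_mul_coefE]
    calc Q ^ 2 = D.L ^ 2 * D.lamHat ^ 2 * ‖W.uC‖ ^ 2 * (‖W.uR‖ ^ 2 / n) * (1 / n) := by
          rw [e1]
          ring
      _ ≤ D.L ^ 2 * D.lamHat ^ 2 * ‖W.uC‖ ^ 2 * W.δR ^ 2 * coefE W := by gcongr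
      _ = _ := by ring
  have h4 : (1 / 4 : ℝ) ≤ (1 - W.θR * D.γx) ^ 2 := by nlinarith
  set Z := D.L ^ 2 * D.lamHat ^ 2 * W.δR ^ 2 * (coefE W * ‖W.uC‖ ^ 2) with hZ
  have hZ0 : 0 ≤ Z := by positivity
  have h5 : 96 * Z ≤ 1 := by
    have : D.L ^ 2 * D.lamHat ^ 2 * W.δR ^ 2 * (1 - W.θR * D.γx) ^ 2
        * (384 * coefE W * ‖W.uC‖ ^ 2) = 384 * Z * (1 - W.θR * D.γx) ^ 2 := by
      rw [hZ]
      ring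
    rw [this] at h1
    nlinarith
  have h6 : Q ≤ 1 / 2 := by nlinarith
  exact h2.trans h6

end Setting

end StepSizes

/-! ### Arithmetic of the Lyapunov function -/

/-- Elimination of the auxiliary quantities from the recursions of the four errors. -/
lemma lyapunov_combine {L2 κ τ A B F p₁ p₂ p₃ p₄ p₅ p₆ u₁ u₂ u₃ v₁ v₂ v₃ lam2 bL b2 tx ty C S nx ny
    P x g q h x' g' q' h' N Δ Γ ex ey yt zx zy : ℝ}
    (hL2 : 0 ≤ L2) (hA : 0 ≤ A) (hB : 0 ≤ B) (hF : 0 ≤ F) (hp₂ : 0 ≤ p₂) (hp₄ : 0 ≤ p₄)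
    (hp₅ : 0 ≤ p₅) (hp₆ : 0 ≤ p₆) (hu₃ : 0 ≤ u₃) (hv₃ : 0 ≤ v₃) (hlam2 : 0 ≤ lam2) (hb2 : 0 ≤ b2)
    (htx : 0 < tx) (htx1 : tx ≤ 1) (hty : 0 < ty) (hty1 : ty ≤ 1) (hC : 0 ≤ C) (hP : 0 ≤ P)
    (hq0 : 0 ≤ q) (hh0 : 0 ≤ h) (hΔ0 : 0 ≤ Δ) (hyt0 : 0 ≤ yt) (hnx : 0 ≤ nx) (hny : 0 ≤ ny)
    (hx : x' ≤ (1 - κ) * x + p₁ * N + p₂ * ex)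
    (hg : g' ≤ (1 - τ) * g + p₃ * Δ + p₄ * ey)
    (hq : q' ≤ (1 + tx / 2) * zx + p₅ * (2 * Δ + 2 * (lam2 * Γ)))
    (hh : h' ≤ (1 + ty / 2) * zy + p₆ * (g + bL * Δ + b2 * ey))
    (hzx : zx ≤ (1 - tx) * q + nx) (hzy : zy ≤ (1 - ty) * yt + ny)
    (hyt : yt ≤ 2 * h + 2 * (L2 * Δ)) (hyt' : yt ≤ (1 + ty / 4) * h + (1 + 4 / ty) * (L2 * Δ))
    (hex : ex ≤ C * q + S) (hey : ey ≤ C * yt + S)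
    (hΓ : Γ ≤ u₁ * Δ + u₂ * g + u₃ * ey) (hΔ : Δ ≤ v₁ * N + v₂ * x + v₃ * ex)
    (hP' : A * p₃ + B * (p₅ * (2 + 2 * (lam2 * u₁))) + F * (4 / ty * L2) + F * (p₆ * bL)
      + (A * p₄ + B * (p₅ * (2 * (lam2 * u₃))) + F * (p₆ * b2)) * (2 * C) * L2 ≤ P) :
    L2 * x' + A * g' + B * q' + F * h'
      ≤ (L2 * (1 - κ) + P * v₂) * x + (L2 * p₁ + P * v₁) * N
        + (A * (1 - τ) + (B * (p₅ * (2 * (lam2 * u₂))) + F * p₆)) * g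
        + (B * (1 - tx / 2) + (L2 * p₂ + P * v₃) * C) * q
        + (F * (1 - ty / 4)
          + (A * p₄ + B * (p₅ * (2 * (lam2 * u₃))) + F * (p₆ * b2)) * (2 * C)) * h
        + (L2 * p₂ + P * v₃ + (A * p₄ + B * (p₅ * (2 * (lam2 * u₃))) + F * (p₆ * b2))) * S
        + B * (2 * nx) + F * (2 * ny) := by
  set Q := A * p₄ + B * (p₅ * (2 * (lam2 * u₃))) + F * (p₆ * b2) with hQ
  have hQ0 : 0 ≤ Q := by positivity
  have hzx' : (1 + tx / 2) * zx ≤ (1 - tx / 2) * q + 2 * nx := by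
    have h1 := mul_le_mul_of_nonneg_left hzx (by linarith : (0 : ℝ) ≤ 1 + tx / 2)
    have h2 : (1 + tx / 2) * ((1 - tx) * q + nx) = (1 - tx / 2) * q - tx ^ 2 / 2 * q
        + (1 + tx / 2) * nx := by ring
    have h3 : (1 + tx / 2) * nx ≤ 2 * nx := mul_le_mul_of_nonneg_right (by linarith) hnx
    have h4 := mul_nonneg (sq_nonneg tx) hq0
    rw [h2] at h1
    linarith
  have hzy' : (1 + ty / 2) * zy ≤ (1 - ty / 4) * h + 4 / ty * L2 * Δ + 2 * ny := by
    have h1 := mul_le_mul_of_nonneg_left hzy (by linarith : (0 : ℝ) ≤ 1 + ty / 2)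
    have h2 : (1 + ty / 2) * ((1 - ty) * yt + ny) = (1 - ty / 2) * yt - ty ^ 2 / 2 * yt
        + (1 + ty / 2) * ny := by ring
    have h3 := mul_le_mul_of_nonneg_left hyt' (by linarith : (0 : ℝ) ≤ 1 - ty / 2)
    have h4 : (1 - ty / 2) * ((1 + ty / 4) * h + (1 + 4 / ty) * (L2 * Δ))
        = (1 - ty / 4) * h - ty ^ 2 / 8 * h + 4 / ty * L2 * Δ - (1 + ty / 2) * (L2 * Δ) := by
      field_simp
      ring
    have h5 : 0 ≤ L2 * Δ := mul_nonneg hL2 hΔ0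
    have h6 : (1 + ty / 2) * ny ≤ 2 * ny := mul_le_mul_of_nonneg_right (by linarith) hny
    have h7 := mul_nonneg (sq_nonneg ty) hyt0
    have h8 := mul_nonneg (sq_nonneg ty) hh0
    have h9 : 0 ≤ (1 + ty / 2) * (L2 * Δ) := by positivity
    rw [h2] at h1
    rw [h4] at h3
    linarith
  have hey' : ey ≤ 2 * C * h + 2 * C * L2 * Δ + S := by
    have := mul_le_mul_of_nonneg_left hyt hC
    linarith
  have m1 := mul_le_mul_of_nonneg_left hx hL2
  have m2 := mul_le_mul_of_nonneg_left hg hA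
  have m3 := mul_le_mul_of_nonneg_left hq hB
  have m4 := mul_le_mul_of_nonneg_left hh hF
  have m5 := mul_le_mul_of_nonneg_left hzx' hB
  have m6 := mul_le_mul_of_nonneg_left hzy' hF
  have m7 := mul_le_mul_of_nonneg_left hΓ (by positivity : 0 ≤ B * (p₅ * (2 * lam2)))
  have m8 := mul_le_mul_of_nonneg_left hey' hQ0
  have m9 := mul_le_mul_of_nonneg_right hP' hΔ0
  have m10 := mul_le_mul_of_nonneg_left hΔ hP
  have m11 := mul_le_mul_of_nonneg_left hex (by positivity : 0 ≤ L2 * p₂ + P * v₃)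
  rw [hQ] at m8
  rw [hQ]
  linarith

section Coefficients

variable {L l a b θR θC γx γy C tx ty e₁ e₂ : ℝ}

lemma coef_tracking_le (hθR : 0 < θR) (hθC : 0 < θC) (hγx : 0 < γx) (hγy : 0 < γy) (he₁ : 0 < e₁)
    (he₂ : 0 < e₂) (hy1 : γy ≤ 1)
    (k3 : L ^ 2 * l ^ 2 * (1296 * e₁) ≤ (θC * γy) ^ 2) (k5 : γy * (432 * e₁) ≤ θC * e₂) :
    θR / γx * (L ^ 2 * l ^ 2 * γy ^ 2 / 8 + 3 * (θC * γy) * γy ^ 2 / (4 * e₂))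
      ≤ θR / γx * (19 * (θC * γy) ^ 2 / (10368 * e₁)) := by
  refine mul_le_mul_of_nonneg_left ?_ (by positivity)
  have h1 : L ^ 2 * l ^ 2 * γy ^ 2 / 8 ≤ (θC * γy) ^ 2 / (10368 * e₁) := by
    rw [div_le_div_iff₀ (by norm_num) (by positivity)]
    have h2 : γy ^ 2 ≤ 1 := pow_le_one₀ hγy.le hy1
    have h3 := mul_le_mul k3 h2 (sq_nonneg _) (sq_nonneg _)
    linarith
  have h2 : 3 * (θC * γy) * γy ^ 2 / (4 * e₂) ≤ 18 * (θC * γy) ^ 2 / (10368 * e₁) := by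
    rw [div_le_div_iff₀ (by positivity) (by positivity)]
    have h3 := mul_le_mul_of_nonneg_left k5 (by positivity : 0 ≤ θC * γy * γy)
    have h4 : θC * γy * γy * (θC * e₂) * 72 = 18 * (θC * γy) ^ 2 * (4 * e₂) := by ring
    nlinarith
  have h3 : 19 * (θC * γy) ^ 2 / (10368 * e₁) = (θC * γy) ^ 2 / (10368 * e₁)
      + 18 * (θC * γy) ^ 2 / (10368 * e₁) := by ring
  linarith

lemma coef_errY_eq (hθC : θC ≠ 0) (htx : tx ≠ 0) (hty : ty ≠ 0) (hγx : γx ≠ 0) (he₁ : e₁ ≠ 0)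
    (he₂ : e₂ ≠ 0) :
    θC * γy * θR / (108 * e₁ * γx) * (18 * γy * b ^ 2 / θC)
      + L ^ 2 * tx * θR / (1296 * γx) * (3 / tx * (2 * (l ^ 2 * (27 * γy ^ 2 * b ^ 2))))
      + θC * γy * ty * θR / (108 * e₂ * γx) * (3 / ty * (27 * γy ^ 2) * b ^ 2)
    = θR / γx * (γy ^ 2 * b ^ 2 / (6 * e₁)) + b ^ 2 * (θR / γx *
      (L ^ 2 * l ^ 2 * γy ^ 2 / 8 + 3 * (θC * γy) * γy ^ 2 / (4 * e₂))) := by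
  field_simp
  ring

lemma coef_errY_le (hθR : 0 < θR) (hθC : 0 < θC) (hθC1 : θC ≤ 1) (hγx : 0 < γx) (hγy : 0 < γy)
    (he₁ : 0 < e₁) (he₂ : 0 < e₂) (htx : 0 < tx) (hty : 0 < ty) (hy1 : γy ≤ 1)
    (k3 : L ^ 2 * l ^ 2 * (1296 * e₁) ≤ (θC * γy) ^ 2) (k5 : γy * (432 * e₁) ≤ θC * e₂) :
    θC * γy * θR / (108 * e₁ * γx) * (18 * γy * b ^ 2 / θC)
      + L ^ 2 * tx * θR / (1296 * γx) * (3 / tx * (2 * (l ^ 2 * (27 * γy ^ 2 * b ^ 2))))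
      + θC * γy * ty * θR / (108 * e₂ * γx) * (3 / ty * (27 * γy ^ 2) * b ^ 2)
    ≤ θR / γx * (γy ^ 2 * b ^ 2 / (5 * e₁)) := by
  rw [coef_errY_eq hθC.ne' htx.ne' hty.ne' hγx.ne' he₁.ne' he₂.ne']
  have h1 := mul_le_mul_of_nonneg_left
    (coef_tracking_le hθR hθC hγx hγy he₁ he₂ hy1 k3 k5) (sq_nonneg b)
  have h2 : b ^ 2 * (θR / γx * (19 * (θC * γy) ^ 2 / (10368 * e₁)))
      ≤ b ^ 2 * (θR / γx * (19 * γy ^ 2 / (10368 * e₁))) := by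
    have : (θC * γy) ^ 2 ≤ γy ^ 2 :=
      pow_le_pow_left₀ (by positivity) (mul_le_of_le_one_left hγy.le hθC1) 2
    gcongr
  have h3 : θR / γx * (γy ^ 2 * b ^ 2 / (5 * e₁)) - (θR / γx * (γy ^ 2 * b ^ 2 / (6 * e₁))
      + b ^ 2 * (θR / γx * (19 * γy ^ 2 / (10368 * e₁))))
      = θR / γx * (γy ^ 2 * b ^ 2 / e₁) * (1 / 5 - 1 / 6 - 19 / 10368) := by
    field_simp
    ring
  have h4 : 0 ≤ θR / γx * (γy ^ 2 * b ^ 2 / e₁) * (1 / 5 - 1 / 6 - 19 / 10368) := by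
    have : (0 : ℝ) ≤ 1 / 5 - 1 / 6 - 19 / 10368 := by norm_num
    positivity
  linarith

/-- The total coefficient of the squared movement of the `x`-variables. -/
lemma coef_move_le (hL : 0 < L) (hb : 0 < b) (hθR : 0 < θR) (hθC : 0 < θC)
    (hθC1 : θC ≤ 1) (hγx : 0 < γx) (hγy : 0 < γy) (hC : 0 ≤ C) (htx : 0 < tx) (hty : 0 < ty)
    (he₁ : e₁ = 2 * b ^ 2 * (1 + 18 * C)) (he₂ : e₂ = 108 * C + 112) (hy : γy ≤ 7 / 54)
    (k3 : L ^ 2 * l ^ 2 * (1296 * e₁) ≤ (θC * γy) ^ 2) (k5 : γy * (432 * e₁) ≤ θC * e₂) :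
    θC * γy * θR / (108 * e₁ * γx) * (2 * b ^ 2 / (θC * γy) * L ^ 2)
      + L ^ 2 * tx * θR / (1296 * γx) * (3 / tx * (2 + 2 * (l ^ 2 * (12 * b ^ 2 * L ^ 2))))
      + θC * γy * ty * θR / (108 * e₂ * γx) * (4 / ty * L ^ 2)
      + θC * γy * ty * θR / (108 * e₂ * γx) * (3 / ty * (27 * γy ^ 2) * (b ^ 2 * L ^ 2))
      + (θC * γy * θR / (108 * e₁ * γx) * (18 * γy * b ^ 2 / θC)
        + L ^ 2 * tx * θR / (1296 * γx) * (3 / tx * (2 * (l ^ 2 * (27 * γy ^ 2 * b ^ 2))))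
        + θC * γy * ty * θR / (108 * e₂ * γx) * (3 / ty * (27 * γy ^ 2) * b ^ 2)) * (2 * C) * L ^ 2
    ≤ L ^ 2 * θR / (64 * γx) := by
  have hw : 0 < 1 + 18 * C := by linarith
  have he₁' : 0 < e₁ := by rw [he₁]; positivity
  have he₂' : 0 < e₂ := by rw [he₂]; positivity
  have hτ0 : 0 < θC * γy := by positivity
  have hτ1 : θC * γy ≤ 7 / 54 := (mul_le_of_le_one_left hγy.le hθC1).trans hy
  have hψ : 0 ≤ θR / γx * L ^ 2 := by positivity
  have hbe : b ^ 2 / e₁ ≤ 1 / 2 := by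
    rw [div_le_div_iff₀ he₁' (by norm_num), he₁]
    nlinarith [mul_nonneg (sq_nonneg b) hC]
  have hbe' : b ^ 2 / e₁ * (1 + 18 * C) = 1 / 2 := by
    rw [he₁]
    field_simp
  have hbe0 : 0 ≤ b ^ 2 / e₁ := by positivity
  have t1 : θC * γy * θR / (108 * e₁ * γx) * (2 * b ^ 2 / (θC * γy) * L ^ 2)
      ≤ θR / γx * L ^ 2 * (1 / 108) := by
    have : θC * γy * θR / (108 * e₁ * γx) * (2 * b ^ 2 / (θC * γy) * L ^ 2)
        = θR / γx * L ^ 2 * (b ^ 2 / e₁ / 54) := by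
      field_simp
      ring
    rw [this]
    exact mul_le_mul_of_nonneg_left (by linarith) hψ
  have t2 : L ^ 2 * tx * θR / (1296 * γx) * (3 / tx * (2 + 2 * (l ^ 2 * (12 * b ^ 2 * L ^ 2))))
      ≤ θR / γx * L ^ 2 * (1 / 216 + 1 / 46656) := by
    have : L ^ 2 * tx * θR / (1296 * γx) * (3 / tx * (2 + 2 * (l ^ 2 * (12 * b ^ 2 * L ^ 2))))
        = θR / γx * L ^ 2 * (1 / 216 + L ^ 2 * l ^ 2 * b ^ 2 / 18) := by
      field_simp
      ring
    rw [this]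
    refine mul_le_mul_of_nonneg_left ?_ hψ
    have h1 : L ^ 2 * l ^ 2 * b ^ 2 = L ^ 2 * l ^ 2 * e₁ * (b ^ 2 / e₁) := by
      field_simp
    have h2 : L ^ 2 * l ^ 2 * e₁ ≤ 1 / 1296 := by
      have : (θC * γy) ^ 2 ≤ 1 := pow_le_one₀ hτ0.le (by linarith)
      linarith
    have h3 := mul_le_mul h2 hbe hbe0 (by norm_num)
    linarith
  have t3 : θC * γy * ty * θR / (108 * e₂ * γx) * (4 / ty * L ^ 2)
      ≤ θR / γx * L ^ 2 * (1 / 20000) := by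
    have : θC * γy * ty * θR / (108 * e₂ * γx) * (4 / ty * L ^ 2)
        = θR / γx * L ^ 2 * (θC * γy / (27 * e₂)) := by
      field_simp
      ring
    rw [this]
    refine mul_le_mul_of_nonneg_left ?_ hψ
    rw [div_le_div_iff₀ (by positivity) (by norm_num), he₂]
    linarith
  have t4 : θC * γy * ty * θR / (108 * e₂ * γx) * (3 / ty * (27 * γy ^ 2) * (b ^ 2 * L ^ 2))
      ≤ θR / γx * L ^ 2 * (1 / 1000) := by
    have : θC * γy * ty * θR / (108 * e₂ * γx) * (3 / ty * (27 * γy ^ 2) * (b ^ 2 * L ^ 2))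
        = θR / γx * L ^ 2 * (3 / 4 * (θC * γy) * γy * (γy * e₁ / e₂) * (b ^ 2 / e₁)) := by
      field_simp
      ring
    rw [this]
    refine mul_le_mul_of_nonneg_left ?_ hψ
    have h1 : γy * e₁ / e₂ ≤ 1 / 432 := by
      rw [div_le_div_iff₀ he₂' (by norm_num)]
      nlinarith
    calc 3 / 4 * (θC * γy) * γy * (γy * e₁ / e₂) * (b ^ 2 / e₁)
        ≤ 3 / 4 * (7 / 54) * (7 / 54) * (1 / 432) * (1 / 2) := by gcongr
      _ ≤ 1 / 1000 := by norm_num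
  have t5 : (θC * γy * θR / (108 * e₁ * γx) * (18 * γy * b ^ 2 / θC)
        + L ^ 2 * tx * θR / (1296 * γx) * (3 / tx * (2 * (l ^ 2 * (27 * γy ^ 2 * b ^ 2))))
        + θC * γy * ty * θR / (108 * e₂ * γx) * (3 / ty * (27 * γy ^ 2) * b ^ 2)) * (2 * C) * L ^ 2
      ≤ θR / γx * L ^ 2 * (1 / 5000) := by
    have h1 := coef_errY_le (b := b) hθR hθC hθC1 hγx hγy he₁' he₂' htx hty (by linarith) k3 k5
    have h2 := mul_le_mul_of_nonneg_right h1 (by positivity : 0 ≤ 2 * C * L ^ 2)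
    have h3 : θR / γx * (γy ^ 2 * b ^ 2 / (5 * e₁)) * (2 * C * L ^ 2)
        = θR / γx * L ^ 2 * (γy ^ 2 * (b ^ 2 / e₁ * (18 * C)) / 45) := by
      field_simp
      ring
    have h4 : γy ^ 2 * (b ^ 2 / e₁ * (18 * C)) / 45 ≤ 1 / 5000 := by
      have h5 : b ^ 2 / e₁ * (18 * C) ≤ 1 / 2 := by linarith
      calc γy ^ 2 * (b ^ 2 / e₁ * (18 * C)) / 45 ≤ (7 / 54) ^ 2 * (1 / 2) / 45 := by gcongr
        _ ≤ 1 / 5000 := by norm_num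
    have h6 := mul_le_mul_of_nonneg_left h4 hψ
    linarith
  have h7 : L ^ 2 * θR / (64 * γx) = θR / γx * L ^ 2 * (1 / 64) := by
    field_simp
  rw [h7]
  nlinarith

lemma coef_trackingErr_le (hθR : 0 < θR) (hθC : 0 < θC) (hγx : 0 < γx) (hγy : 0 < γy) (he₁ : 0 < e₁) (he₂ : 0 < e₂) (htx : 0 < tx) (hty : 0 < ty) (hy1 : γy ≤ 1)
    (k3 : L ^ 2 * l ^ 2 * (1296 * e₁) ≤ (θC * γy) ^ 2) (k5 : γy * (432 * e₁) ≤ θC * e₂) :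
    L ^ 2 * tx * θR / (1296 * γx) * (3 / tx * (2 * (l ^ 2 * (27 * γy ^ 2))))
      + θC * γy * ty * θR / (108 * e₂ * γx) * (3 / ty * (27 * γy ^ 2))
    ≤ 1 / 4 * (θC * γy * θR / (108 * e₁ * γx) * (θC * γy)) := by
  have h1 : L ^ 2 * tx * θR / (1296 * γx) * (3 / tx * (2 * (l ^ 2 * (27 * γy ^ 2))))
      + θC * γy * ty * θR / (108 * e₂ * γx) * (3 / ty * (27 * γy ^ 2))
      = θR / γx * (L ^ 2 * l ^ 2 * γy ^ 2 / 8 + 3 * (θC * γy) * γy ^ 2 / (4 * e₂)) := by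
    field_simp
    ring
  rw [h1]
  refine (coef_tracking_le hθR hθC hγx hγy he₁ he₂ hy1 k3 k5).trans ?_
  have h2 : 1 / 4 * (θC * γy * θR / (108 * e₁ * γx) * (θC * γy))
      - θR / γx * (19 * (θC * γy) ^ 2 / (10368 * e₁))
      = θR / γx * (θC * γy) ^ 2 / e₁ * (1 / 432 - 19 / 10368) := by
    field_simp
    ring
  have h3 : 0 ≤ θR / γx * (θC * γy) ^ 2 / e₁ * (1 / 432 - 19 / 10368) := by
    have : (0 : ℝ) ≤ 1 / 432 - 19 / 10368 := by norm_num
    positivity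
  linarith

lemma coef_compressY_le (hb : 0 < b) (hθR : 0 < θR) (hθC : 0 < θC) (hθC1 : θC ≤ 1) (hγx : 0 < γx)
    (hγy : 0 < γy) (hC : 0 ≤ C) (he₁ : e₁ = 2 * b ^ 2 * (1 + 18 * C)) (he₂ : 0 < e₂) (htx : 0 < tx)
    (hty : 0 < ty) (hy1 : γy ≤ 1)
    (k3 : L ^ 2 * l ^ 2 * (1296 * e₁) ≤ (θC * γy) ^ 2) (k5 : γy * (432 * e₁) ≤ θC * e₂)
    (k6 : γy * C * (432 * e₂) ≤ θC * ty ^ 2) :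
    (θC * γy * θR / (108 * e₁ * γx) * (18 * γy * b ^ 2 / θC)
      + L ^ 2 * tx * θR / (1296 * γx) * (3 / tx * (2 * (l ^ 2 * (27 * γy ^ 2 * b ^ 2))))
      + θC * γy * ty * θR / (108 * e₂ * γx) * (3 / ty * (27 * γy ^ 2) * b ^ 2)) * (2 * C)
    ≤ θC * γy * ty * θR / (108 * e₂ * γx) * (ty / 4) := by
  have he₁' : 0 < e₁ := by rw [he₁]; positivity
  have h1 := mul_le_mul_of_nonneg_right
    (coef_errY_le (b := b) hθR hθC hθC1 hγx hγy he₁' he₂ htx hty hy1 k3 k5)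
    (by positivity : 0 ≤ 2 * C)
  refine h1.trans ?_
  have hbe : b ^ 2 / e₁ ≤ 1 / 2 := by
    rw [div_le_div_iff₀ he₁' (by norm_num), he₁]
    nlinarith [mul_nonneg (sq_nonneg b) hC]
  have h2 : γy * C ≤ θC * ty ^ 2 / (432 * e₂) := by
    rw [le_div_iff₀ (by positivity)]
    exact k6
  calc θR / γx * (γy ^ 2 * b ^ 2 / (5 * e₁)) * (2 * C)
      = θR / γx * γy * (γy * C) * (b ^ 2 / e₁) * (2 / 5) := by
        field_simp
    _ ≤ θR / γx * γy * (θC * ty ^ 2 / (432 * e₂)) * (1 / 2) * (2 / 5) := by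
        gcongr
    _ ≤ θR / γx * γy * (θC * ty ^ 2 / (432 * e₂)) := by
        have : 0 ≤ θR / γx * γy * (θC * ty ^ 2 / (432 * e₂)) := by positivity
        linarith
    _ = θC * γy * ty * θR / (108 * e₂ * γx) * (ty / 4) := by
        field_simp
        ring

lemma coef_noiseY_le (hθR : 0 < θR) (hθC : 0 < θC) (hθC1 : θC ≤ 1) (hγx : 0 < γx)
    (hγy : 0 < γy) (he₁ : 0 < e₁) (he₂ : 0 < e₂) (htx : 0 < tx)
    (hty : 0 < ty) (hy : γy ≤ 7 / 54)
    (k3 : L ^ 2 * l ^ 2 * (1296 * e₁) ≤ (θC * γy) ^ 2) (k5 : γy * (432 * e₁) ≤ θC * e₂) :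
    θC * γy * θR / (108 * e₁ * γx) * (18 * γy * b ^ 2 / θC)
      + L ^ 2 * tx * θR / (1296 * γx) * (3 / tx * (2 * (l ^ 2 * (27 * γy ^ 2 * b ^ 2))))
      + θC * γy * ty * θR / (108 * e₂ * γx) * (3 / ty * (27 * γy ^ 2) * b ^ 2)
    ≤ θC * γy * θR / (108 * e₁ * γx) * (18 * b ^ 2 / θC) := by
  refine (coef_errY_le (b := b) hθR hθC hθC1 hγx hγy he₁ he₂ htx hty (by linarith) k3 k5).trans ?_
  have h1 : θC * γy * θR / (108 * e₁ * γx) * (18 * b ^ 2 / θC)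
      - θR / γx * (γy ^ 2 * b ^ 2 / (5 * e₁)) = θR / γx * (γy * b ^ 2 / e₁) * (1 / 6 - γy / 5) := by
    field_simp
    ring
  have h2 : 0 ≤ θR / γx * (γy * b ^ 2 / e₁) * (1 / 6 - γy / 5) := by
    have : 0 ≤ 1 / 6 - γy / 5 := by linarith
    positivity
  linarith

lemma coef_normY_le {E cc : ℝ} (hθR : 0 < θR) (hθR1 : θR ≤ 1) (hγx : 0 < γx) (hE : 0 < E)
    (hcc : 0 < cc) (hκ : θR * γx ≤ 1 / 14)
    (k2 : L ^ 2 * l ^ 2 * a ^ 2 * (1 - θR * γx) ^ 2 * (384 * E * cc ^ 2) ≤ (θR * γx) ^ 2) :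
    L ^ 2 * (2 * (1 - θR * γx) ^ 2 * a ^ 2 / (θR * γx) * l ^ 2)
      + L ^ 2 * θR / (64 * γx) * (12 * a ^ 2 * l ^ 2) ≤ θR * γx / (160 * E * cc ^ 2) := by
  set κ := θR * γx with hκdef
  have hκ0 : 0 < κ := by positivity
  set Z := L ^ 2 * l ^ 2 * a ^ 2 with hZ
  have hZ0 : 0 ≤ Z := by positivity
  have h1 : L ^ 2 * θR / (64 * γx) * (12 * a ^ 2 * l ^ 2) ≤ Z * (12 / 64) / κ := by
    have e : L ^ 2 * θR / (64 * γx) * (12 * a ^ 2 * l ^ 2) = Z * (12 / 64) / κ * θR ^ 2 := by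
      rw [hZ, hκdef]
      field_simp
    rw [e]
    exact mul_le_of_le_one_right (by positivity) (pow_le_one₀ hθR.le hθR1)
  have h2 : L ^ 2 * (2 * (1 - κ) ^ 2 * a ^ 2 / κ * l ^ 2) = Z * (2 * (1 - κ) ^ 2) / κ := by
    rw [hZ]
    ring
  have h3 : (12 / 64 : ℝ) ≤ 22 / 100 * (1 - κ) ^ 2 := by
    have : (13 / 14 : ℝ) ^ 2 ≤ (1 - κ) ^ 2 := pow_le_pow_left₀ (by norm_num) (by linarith) 2
    nlinarith
  have h4 : Z * (12 / 64) / κ ≤ Z * (22 / 100 * (1 - κ) ^ 2) / κ := by gcongr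
  have h5 : Z * (1 - κ) ^ 2 ≤ κ ^ 2 / (384 * E * cc ^ 2) := by
    rw [le_div_iff₀ (by positivity)]
    exact k2
  calc _ ≤ Z * (2 * (1 - κ) ^ 2) / κ + Z * (22 / 100 * (1 - κ) ^ 2) / κ := by linarith
    _ = 222 / 100 * (Z * (1 - κ) ^ 2) / κ := by ring
    _ ≤ 222 / 100 * (κ ^ 2 / (384 * E * cc ^ 2)) / κ := by gcongr
    _ = κ / (160 * E * cc ^ 2) * (222 / 240) := by
        field_simp
        norm_num
    _ ≤ κ / (160 * E * cc ^ 2) := mul_le_of_le_one_right (by positivity) (by norm_num)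

lemma coef_errX_eq (hθR : θR ≠ 0) (hγx : γx ≠ 0) :
    L ^ 2 * (18 * γx * a ^ 2 / θR) + L ^ 2 * θR / (64 * γx) * (27 * γx ^ 2 * a ^ 2)
      = L ^ 2 * a ^ 2 / θR * (γx * (18 + 27 / 64 * θR ^ 2)) := by
  field_simp

lemma coef_compressX_le (hθR : 0 < θR) (hθR1 : θR ≤ 1) (hγx : 0 < γx) (hC : 0 ≤ C)
    (k7 : γx ^ 2 * a ^ 2 * C * 373248 ≤ θR ^ 2 * tx ^ 2) :
    (L ^ 2 * (18 * γx * a ^ 2 / θR) + L ^ 2 * θR / (64 * γx) * (27 * γx ^ 2 * a ^ 2)) * C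
      ≤ L ^ 2 * tx * θR / (1296 * γx) * (tx / 2) := by
  rw [coef_errX_eq hθR.ne' hγx.ne']
  have h1 : 18 + 27 / 64 * θR ^ 2 ≤ 19 := by nlinarith
  have h2 : L ^ 2 * a ^ 2 / θR * (γx * (18 + 27 / 64 * θR ^ 2)) * C
      ≤ L ^ 2 * a ^ 2 / θR * (γx * 19) * C := by gcongr
  refine h2.trans ?_
  have h3 : L ^ 2 * a ^ 2 / θR * (γx * 19) * C
      = L ^ 2 / (θR * γx) * (19 * (γx ^ 2 * a ^ 2 * C)) := by
    field_simp
  have h4 : L ^ 2 * tx * θR / (1296 * γx) * (tx / 2)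
      = L ^ 2 / (θR * γx) * (θR ^ 2 * tx ^ 2 / 2592) := by
    field_simp
    ring
  rw [h3, h4]
  refine mul_le_mul_of_nonneg_left ?_ (by positivity)
  have : 0 ≤ γx ^ 2 * a ^ 2 * C := by positivity
  linarith

lemma coef_noiseX_le (hθR : 0 < θR) (hθR1 : θR ≤ 1) (hγx : 0 < γx) (hx : γx ≤ 1 / 14) :
    L ^ 2 * (18 * γx * a ^ 2 / θR) + L ^ 2 * θR / (64 * γx) * (27 * γx ^ 2 * a ^ 2)
      ≤ L ^ 2 * (18 * a ^ 2 / θR) := by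
  rw [coef_errX_eq hθR.ne' hγx.ne']
  have h1 : γx * (18 + 27 / 64 * θR ^ 2) ≤ 18 := by nlinarith
  have h2 : L ^ 2 * (18 * a ^ 2 / θR) = L ^ 2 * a ^ 2 / θR * 18 := by ring
  rw [h2]
  gcongr

/-- The tracking weight dominates the coupling between tracking and consensus. -/
lemma coef_coupling_le {M r cc n : ℝ} (hM : 0 < M) (hr : 0 < r) (hcc : 0 < cc)
    (hθR : 0 < θR) (hγx : 0 < γx) (he₁ : 0 < e₁) (hn : 0 < n) (hMn : n * M ≤ r * cc)
    (k4 : γx ^ 2 * (108 * r * e₁) ≤ M * cc * (θC * γy) ^ 2) :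
    θR * γx / (r * cc / (n ^ 2 * M) * cc ^ 2) ≤ θC * γy * θR / (108 * e₁ * γx) * (θC * γy) ∧
    r ^ 2 / (n ^ 2 * M) * (θR * γx)
      ≤ r * cc / (n ^ 2 * M) * M * (θC * γy * θR / (108 * e₁ * γx) * (θC * γy)) := by
  have h0 : θR * γx * (r / (M * cc)) ≤ θC * γy * θR / (108 * e₁ * γx) * (θC * γy) := by
    have h1 : γx ^ 2 * (r / (M * cc)) ≤ (θC * γy) ^ 2 / (108 * e₁) := by
      rw [mul_div_assoc', div_le_div_iff₀ (by positivity) (by positivity)]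
      linarith
    calc θR * γx * (r / (M * cc)) = θR / γx * (γx ^ 2 * (r / (M * cc))) := by
          field_simp
      _ ≤ θR / γx * ((θC * γy) ^ 2 / (108 * e₁)) := by gcongr
      _ = _ := by
          field_simp
  constructor
  · refine le_trans ?_ h0
    have e : θR * γx / (r * cc / (n ^ 2 * M) * cc ^ 2)
        = θR * γx * (r / (M * cc)) * ((n * M) ^ 2 / (r * cc) ^ 2) := by
      field_simp
    rw [e]
    refine mul_le_of_le_one_right (by positivity) ?_
    rw [div_le_one (by positivity)]
    exact pow_le_pow_left₀ (by positivity) hMn 2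
  · have h1 := mul_le_mul_of_nonneg_left h0 (by positivity : 0 ≤ r * cc / (n ^ 2 * M) * M)
    refine le_trans (le_of_eq ?_) h1
    field_simp

end Coefficients

/-! ### Absorption of the coupling terms -/

lemma lyapunov_absorb {L2 κ τ A B F E cc n N x g q h G Z Vn pN pG pQ pH w tx ty C : ℝ}
    (hL2 : 0 ≤ L2) (hκ : 0 < κ) (hE : 0 < E) (hcc : 0 < cc) (hn : 0 < n) (hnE : 1 ≤ n * E)
    (hAτ : 0 ≤ A * τ) (hx0 : 0 ≤ x) (hg0 : 0 ≤ g) (hq0 : 0 ≤ q) (hh0 : 0 ≤ h) (hN0 : 0 ≤ N)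
    (main : Vn ≤ (L2 * (1 - κ) + 27 / 64 * κ * L2) * x + pN * N + (A * (1 - τ) + pG) * g
      + (B * (1 - tx / 2) + pQ * C) * q + (F * (1 - ty / 4) + pH) * h + w)
    (hN : N ≤ 3 * (g + cc ^ 2 * G + cc ^ 2 * (L2 / n * x)))
    (cN : pN ≤ κ / (160 * E * cc ^ 2)) (cW : κ / (E * cc ^ 2) ≤ A * τ)
    (cG : pG ≤ 1 / 4 * (A * τ)) (cQ : pQ * C ≤ B * (tx / 2)) (cH : pH ≤ F * (ty / 4))
    (hw : w ≤ Z) :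
    Vn ≤ L2 * x + A * g + B * q + F * h - 1 / 2 * κ * L2 * x - 3 / 8 * (A * τ) * g
      + 3 * κ / (160 * E) * G + Z := by
  have hNle : pN * N ≤ 3 / 160 * (A * τ) * g + 3 * κ / (160 * E) * G + 3 / 160 * κ * L2 * x := by
    have h1 := mul_le_mul cN hN hN0 (by positivity)
    have h2 : κ / (160 * E * cc ^ 2) * (3 * (g + cc ^ 2 * G + cc ^ 2 * (L2 / n * x)))
        = 3 / 160 * (κ / (E * cc ^ 2)) * g + 3 * κ / (160 * E) * G
          + 3 / 160 * κ * L2 * x * (1 / (n * E)) := by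
      field_simp
    have h3 : 3 / 160 * (κ / (E * cc ^ 2)) * g ≤ 3 / 160 * (A * τ) * g := by gcongr
    have h4 : 3 / 160 * κ * L2 * x * (1 / (n * E)) ≤ 3 / 160 * κ * L2 * x := by
      refine mul_le_of_le_one_right (by positivity) ?_
      rw [div_le_one (by positivity)]
      exact hnE
    linarith
  have hgle := mul_le_mul_of_nonneg_right cG hg0
  have hqle := mul_le_mul_of_nonneg_right cQ hq0
  have hhle := mul_le_mul_of_nonneg_right cH hh0
  have h1 : 0 ≤ κ * L2 * x := by positivity
  have h2 : 0 ≤ A * τ * g := by positivity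
  linarith

lemma lyapunov_descent {o o' Vo Vn E M l κ L2 x g Aτ G Z r n rc φ : ℝ} (hE : 0 < E) (hM : 0 < M)
    (hl : 0 < l) (hκ : 0 < κ) (hn : 0 < n) (hL2 : 0 ≤ L2) (hx0 : 0 ≤ x) (hg0 : 0 ≤ g)
    (hφ0 : 0 ≤ φ) (hφκ : φ * κ = 8 * (E * M * l)) (hErc : E * (n ^ 2 * M) = rc)
    (cO : r ^ 2 / (n ^ 2 * M) * κ ≤ E * M * Aτ)
    (hV : Vn ≤ Vo - 1 / 2 * κ * L2 * x - 3 / 8 * Aτ * g + 3 * κ / (160 * E) * G + Z)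
    (ho : o' ≤ o - 2 / 5 * (M * l) * G + l * rc / n / 2 * (L2 / n * x)
      + 3 * (r ^ 2 * l / (n ^ 2 * M)) * g) :
    o' + φ * Vn ≤ o + φ * Vo - M * l / 4 * G + φ * Z := by
  have hV' := mul_le_mul_of_nonneg_left hV hφ0
  have hterm_x : l * rc / n / 2 * (L2 / n * x) ≤ φ * (1 / 2 * κ * L2 * x) := by
    have h1 : φ * (1 / 2 * κ * L2 * x) = 4 * (E * M * l) * (L2 * x) := by
      linear_combination (1 / 2 * L2 * x) * hφκ
    have h2 : l * rc / n / 2 * (L2 / n * x) = 1 / 2 * (E * M * l) * (L2 * x) := by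
      rw [← hErc]
      field_simp
    have h3 : 0 ≤ (E * M * l) * (L2 * x) := by positivity
    linarith
  have hterm_g : 3 * (r ^ 2 * l / (n ^ 2 * M)) * g ≤ φ * (3 / 8 * Aτ * g) := by
    have h1 : r ^ 2 / (n ^ 2 * M) ≤ E * M * Aτ / κ := by
      rw [le_div_iff₀ hκ]
      exact cO
    have h2 : φ = 8 * (E * M * l) / κ := by
      rw [eq_div_iff hκ.ne', hφκ]
    rw [h2]
    calc 3 * (r ^ 2 * l / (n ^ 2 * M)) * g = 3 * l * g * (r ^ 2 / (n ^ 2 * M)) := by ring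
      _ ≤ 3 * l * g * (E * M * Aτ / κ) := by gcongr
      _ = _ := by ring
  have hterm_G : φ * (3 * κ / (160 * E) * G) = 3 / 20 * (M * l) * G := by
    have : φ * (3 * κ / (160 * E) * G) = (φ * κ) * (3 / (160 * E) * G) := by ring
    rw [this, hφκ]
    field_simp
    ring
  linarith

/-! ### The recursion of the Lyapunov function -/

section Recursion

variable {n p : ℕ} {D : Input n p} {W : Aux n} {c : CompConst} {Θ Ω : Type*}
  [MeasurableSpace Θ] [MeasurableSpace Ω] {𝒞 : Θ → Stack n p → Stack n p} {ν : Measure Θ}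
  {P : Measure Ω} {ξ : ℕ → Fin 2 → Ω → Θ}

namespace RandomSetting

section

variable [NeZero n]

lemma lyapunov_nonneg (h : RandomSetting D W c 𝒞 ν P ξ) {xstar : Vec p}
    (hx : ∀ x, D.obj xstar ≤ D.obj x) (k : ℕ) : 0 ≤ lyapunov D W c 𝒞 P ξ xstar k := by
  have hC := h.compression.C_nonneg
  have hr := h.compression.r_pos
  have hδ := h.compression.δ_pos
  have hαx := h.αx_pos
  have hαy := h.αy_pos
  have hl := h.lamHat_pos
  have hγx := h.γx_pos
  have hγy := h.γy_pos
  have hM := h.M_pos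
  have hθR := h.valid.normR.θ_pos
  have hθC := h.valid.normC.θ_pos
  have hE := h.toSetting.coefE_pos
  have he₁ := h.toSetting.e1_pos hC
  have he₂ : 0 < e2 c := by
    rw [e2]
    linarith
  have h1 : 0 ≤ errO D W 𝒞 P ξ xstar k := integral_nonneg fun _ => sub_nonneg.2 (hx _)
  have h2 : 0 ≤ errC D W 𝒞 P ξ k := integral_nonneg fun _ => sq_nonneg _
  have h3 : 0 ≤ errG D W 𝒞 P ξ k := integral_nonneg fun _ => sq_nonneg _
  have h4 : 0 ≤ errCx D 𝒞 P ξ k := integral_nonneg fun _ => sq_nonneg _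
  have h5 : 0 ≤ errCy D 𝒞 P ξ k := integral_nonneg fun _ => sq_nonneg _
  rw [lyapunov, V, β, coefA, coefB, coefD]
  positivity

lemma zeta0_nonneg (h : RandomSetting D W c 𝒞 ν P ξ) : 0 ≤ zeta0 D W c := by
  have hC := h.compression.C_nonneg
  have hr := h.compression.r_pos
  have hδ := h.compression.δ_pos
  have hσ := h.compression.sigmaSq_nonneg
  have hσr := h.compression.sigmaRSq_nonneg
  have hαx := h.αx_pos
  have hαy := h.αy_pos
  have hγx := h.γx_pos
  have hγy := h.γy_pos
  have hθR := h.valid.normR.θ_pos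
  have hθC := h.valid.normC.θ_pos
  have he₁ := h.toSetting.e1_pos hC
  have he₂ : 0 < e2 c := by
    rw [e2]
    linarith
  rw [zeta0, coefA, coefB, coefD, zetaC, zetaG, zetaCx, zetaCy]
  positivity

end

variable [IsProbabilityMeasure ν] [IsProbabilityMeasure P]

lemma integrable_consensus (h : RandomSetting D W c 𝒞 ν P ξ) (k : ℕ) :
    Integrable (fun ω => consensus W (iterω D 𝒞 ξ k ω)) P :=
  integrable_sq_norm (memLp_mulStack (memLp_mulStack (h.squareIntegrable k).X _) _)

lemma integrable_trackingErr (h : RandomSetting D W c 𝒞 ν P ξ) (k : ℕ) :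
    Integrable (fun ω => trackingErr W (iterω D 𝒞 ξ k ω)) P :=
  integrable_sq_norm (memLp_mulStack (memLp_mulStack (h.squareIntegrable k).Y _) _)

lemma integral_yTilde_le (h : RandomSetting D W c 𝒞 ν P ξ) (k : ℕ) {t : ℝ} (ht : 0 < t) :
    ∫ ω, ‖yTilde D (iterω D 𝒞 ξ k ω) (iterω D 𝒞 ξ (k + 1) ω) - (iterω D 𝒞 ξ k ω).Hy‖ ^ 2 ∂P
      ≤ (1 + t) * errCy D 𝒞 P ξ k + (1 + 1 / t) * (D.L ^ 2
        * ∫ ω, ‖(iterω D 𝒞 ξ (k + 1) ω).X - (iterω D 𝒞 ξ k ω).X‖ ^ 2 ∂P) := by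
  have hk := h.squareIntegrable k
  have hk' := h.squareIntegrable (k + 1)
  refine (integral_le_three (a₁ := 1 + t) (a₂ := (1 + 1 / t) * D.L ^ 2) (a₃ := 0)
    (integrable_sq_norm ((h.memLp_yTilde hk).sub hk.Hy)) (integrable_sq_norm (hk.Y.sub hk.Hy))
    (integrable_sq_norm (hk'.X.sub hk.X)) (integrable_zero _ _ _) fun ω => ?_).trans_eq (by
      simp only [errCy, Pi.sub_apply]
      ring)
  exact (h.yTilde_sub_sq_le _ _ ht).trans_eq (by
    simp only [Pi.sub_apply]
    ring)

lemma errCx_succ_le (h : RandomSetting D W c 𝒞 ν P ξ) (k : ℕ) {t : ℝ} (ht : 0 < t)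
    (ht1 : t ≤ 1) :
    errCx D 𝒞 P ξ (k + 1)
      ≤ (1 + t / 2) * ∫ ω, ‖(iterω D 𝒞 ξ k ω).Xtilde D - (iterω D 𝒞 ξ (k + 1) ω).Hx‖ ^ 2 ∂P
        + 3 / t * (2 * ∫ ω, ‖(iterω D 𝒞 ξ (k + 1) ω).X - (iterω D 𝒞 ξ k ω).X‖ ^ 2 ∂P
          + 2 * (D.lamHat ^ 2
            * ∫ ω, ‖(iterω D 𝒞 ξ (k + 1) ω).Y - (iterω D 𝒞 ξ k ω).Y‖ ^ 2 ∂P)) := by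
  have hk := h.squareIntegrable k
  have hk' := h.squareIntegrable (k + 1)
  refine (integral_le_three (a₁ := 1 + t / 2) (a₂ := 3 / t * 2) (a₃ := 3 / t * (2 * D.lamHat ^ 2))
    (integrable_sq_norm ((hk'.xtilde (D := D)).sub hk'.Hx))
    (integrable_sq_norm ((hk.xtilde (D := D)).sub hk'.Hx)) (integrable_sq_norm (hk'.X.sub hk.X))
    (integrable_sq_norm (hk'.Y.sub hk.Y)) fun ω => ?_).trans_eq (by
      simp only [Pi.sub_apply]
      ring)
  have := h.compressX_step_le (s := D.s k) (cx := 𝒞 (ξ k 0 ω)) (cy := 𝒞 (ξ k 1 ω))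
    (S := iterω D 𝒞 ξ k ω) ht ht1
  rw [← iterω_succ] at this
  exact this.trans_eq (by
    simp only [Pi.sub_apply]
    ring)

variable [NeZero n]

lemma integrable_gradient (h : RandomSetting D W c 𝒞 ν P ξ) (k : ℕ) :
    Integrable (fun ω => ‖gradient D.obj (avg W.uR (iterω D 𝒞 ξ k ω).X)‖ ^ 2) P :=
  integrable_sq_norm (memLp_gradient_obj h.smooth h.L_pos.le
    (memLp_avg (h.squareIntegrable k).X _))

lemma integral_Y_le (h : RandomSetting D W c 𝒞 ν P ξ) (k : ℕ) :
    ∫ ω, ‖(iterω D 𝒞 ξ k ω).Y‖ ^ 2 ∂P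
      ≤ 3 * (errG D W 𝒞 P ξ k
        + ‖W.uC‖ ^ 2 * ∫ ω, ‖gradient D.obj (avg W.uR (iterω D 𝒞 ξ k ω).X)‖ ^ 2 ∂P
        + ‖W.uC‖ ^ 2 * (D.L ^ 2 / n * errC D W 𝒞 P ξ k)) := by
  refine (integral_le_three (a₁ := 3) (a₂ := 3 * ‖W.uC‖ ^ 2)
    (a₃ := 3 * (‖W.uC‖ ^ 2 * (D.L ^ 2 / n))) (integrable_sq_norm (h.squareIntegrable k).Y)
    (h.integrable_trackingErr k) (h.integrable_gradient k) (h.integrable_consensus k)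
    fun ω => (h.norm_Y_sq_le (h.invariant k ω)).trans_eq (by ring)).trans_eq ?_
  simp only [errG, errC, trackingErr, consensus]
  ring

lemma integral_move_le (h : RandomSetting D W c 𝒞 ν P ξ) (k : ℕ) :
    ∫ ω, ‖(iterω D 𝒞 ξ (k + 1) ω).X - (iterω D 𝒞 ξ k ω).X‖ ^ 2 ∂P
      ≤ 12 * W.δR ^ 2 * D.lamHat ^ 2 * ∫ ω, ‖(iterω D 𝒞 ξ k ω).Y‖ ^ 2 ∂P
        + 27 * D.γx ^ 2 * errC D W 𝒞 P ξ k
        + 27 * D.γx ^ 2 * W.δR ^ 2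
          * ∫ ω, ‖errX D (D.s k) (𝒞 (ξ k 0 ω)) (iterω D 𝒞 ξ k ω)‖ ^ 2 ∂P := by
  have hk := h.squareIntegrable k
  refine integral_le_three
    (integrable_sq_norm ((h.squareIntegrable (k + 1)).X.sub hk.X))
    (integrable_sq_norm hk.Y) (h.integrable_consensus k) (integrable_sq_norm (h.memLp_errX hk))
    fun ω => ?_
  rw [mul_assoc _ (D.lamHat ^ 2)]
  exact h.move_sq_le (h.invariant k ω)

lemma integral_moveY_le (h : RandomSetting D W c 𝒞 ν P ξ) (k : ℕ) :
    ∫ ω, ‖(iterω D 𝒞 ξ (k + 1) ω).Y - (iterω D 𝒞 ξ k ω).Y‖ ^ 2 ∂P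
      ≤ 12 * W.δC ^ 2 * D.L ^ 2
          * ∫ ω, ‖(iterω D 𝒞 ξ (k + 1) ω).X - (iterω D 𝒞 ξ k ω).X‖ ^ 2 ∂P
        + 27 * D.γy ^ 2 * errG D W 𝒞 P ξ k
        + 27 * D.γy ^ 2 * W.δC ^ 2
          * ∫ ω, ‖errY D (D.s k) (𝒞 (ξ k 1 ω)) (iterω D 𝒞 ξ k ω)
            (iterω D 𝒞 ξ (k + 1) ω)‖ ^ 2 ∂P := by
  have hk := h.squareIntegrable k
  have hk' := h.squareIntegrable (k + 1)
  refine integral_le_three (integrable_sq_norm (hk'.Y.sub hk.Y))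
    (integrable_sq_norm (hk'.X.sub hk.X)) (h.integrable_trackingErr k)
    (integrable_sq_norm (h.memLp_errY hk)) fun ω => ?_
  rw [mul_assoc _ (D.L ^ 2)]
  exact h.moveY_sq_le (h.invariant k ω)

lemma errC_succ_le (h : RandomSetting D W c 𝒞 ν P ξ) (k : ℕ) :
    errC D W 𝒞 P ξ (k + 1)
      ≤ (1 - W.θR * D.γx) * errC D W 𝒞 P ξ k
        + 2 * (1 - W.θR * D.γx) ^ 2 * W.δR ^ 2 / (W.θR * D.γx) * D.lamHat ^ 2
          * ∫ ω, ‖(iterω D 𝒞 ξ k ω).Y‖ ^ 2 ∂P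
        + 18 * D.γx * W.δR ^ 2 / W.θR
          * ∫ ω, ‖errX D (D.s k) (𝒞 (ξ k 0 ω)) (iterω D 𝒞 ξ k ω)‖ ^ 2 ∂P := by
  have hk := h.squareIntegrable k
  refine integral_le_three (h.integrable_consensus (k + 1)) (h.integrable_consensus k)
    (integrable_sq_norm hk.Y) (integrable_sq_norm (h.memLp_errX hk)) fun ω => ?_
  rw [mul_assoc _ (D.lamHat ^ 2)]
  exact h.consensus_step_le (h.invariant k ω)

lemma errG_succ_le (h : RandomSetting D W c 𝒞 ν P ξ) (k : ℕ) :
    errG D W 𝒞 P ξ (k + 1)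
      ≤ (1 - W.θC * D.γy) * errG D W 𝒞 P ξ k
        + 2 * W.δC ^ 2 / (W.θC * D.γy) * D.L ^ 2
          * ∫ ω, ‖(iterω D 𝒞 ξ (k + 1) ω).X - (iterω D 𝒞 ξ k ω).X‖ ^ 2 ∂P
        + 18 * D.γy * W.δC ^ 2 / W.θC
          * ∫ ω, ‖errY D (D.s k) (𝒞 (ξ k 1 ω)) (iterω D 𝒞 ξ k ω)
            (iterω D 𝒞 ξ (k + 1) ω)‖ ^ 2 ∂P := by
  have hk := h.squareIntegrable k
  refine integral_le_three (h.integrable_trackingErr (k + 1)) (h.integrable_trackingErr k)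
    (integrable_sq_norm ((h.squareIntegrable (k + 1)).X.sub hk.X))
    (integrable_sq_norm (h.memLp_errY hk)) fun ω => ?_
  rw [mul_assoc _ (D.L ^ 2)]
  exact h.trackingErr_step_le (h.invariant k ω)

lemma errCy_succ_le (h : RandomSetting D W c 𝒞 ν P ξ) (k : ℕ) {t : ℝ} (ht : 0 < t)
    (ht1 : t ≤ 1) :
    errCy D 𝒞 P ξ (k + 1)
      ≤ (1 + t / 2) * ∫ ω, ‖yTilde D (iterω D 𝒞 ξ k ω) (iterω D 𝒞 ξ (k + 1) ω)
          - (iterω D 𝒞 ξ (k + 1) ω).Hy‖ ^ 2 ∂P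
        + 3 / t * (27 * D.γy ^ 2) * (errG D W 𝒞 P ξ k
          + W.δC ^ 2 * D.L ^ 2
            * ∫ ω, ‖(iterω D 𝒞 ξ (k + 1) ω).X - (iterω D 𝒞 ξ k ω).X‖ ^ 2 ∂P
          + W.δC ^ 2 * ∫ ω, ‖errY D (D.s k) (𝒞 (ξ k 1 ω)) (iterω D 𝒞 ξ k ω)
            (iterω D 𝒞 ξ (k + 1) ω)‖ ^ 2 ∂P) := by
  have hk := h.squareIntegrable k
  have hk' := h.squareIntegrable (k + 1)
  refine (integral_le_four (a₁ := 1 + t / 2) (a₂ := 3 / t * (27 * D.γy ^ 2))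
    (a₃ := 3 / t * (27 * D.γy ^ 2) * (W.δC ^ 2 * D.L ^ 2))
    (a₄ := 3 / t * (27 * D.γy ^ 2) * W.δC ^ 2)
    (integrable_sq_norm (hk'.Y.sub hk'.Hy))
    (integrable_sq_norm ((h.memLp_yTilde hk).sub hk'.Hy)) (h.integrable_trackingErr k)
    (integrable_sq_norm (hk'.X.sub hk.X)) (integrable_sq_norm (h.memLp_errY hk))
    fun ω => ?_).trans_eq (by
      simp only [errG, trackingErr, Pi.sub_apply]
      ring)
  exact (h.compressY_step_le (h.invariant k ω) ht ht1).trans_eq (by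
    simp only [iterω_succ, Pi.sub_apply]
    ring)

lemma errO_succ_le (h : RandomSetting D W c 𝒞 ν P ξ) {xstar : Vec p}
    (hx : ∀ x, D.obj xstar ≤ D.obj x) (hLl : D.L * lamBar D W ≤ 1 / 2) (k : ℕ) :
    errO D W 𝒞 P ξ xstar (k + 1)
      ≤ errO D W 𝒞 P ξ xstar k
        - 2 / 5 * (W.M * D.lamHat)
          * ∫ ω, ‖gradient D.obj (avg W.uR (iterω D 𝒞 ξ k ω).X)‖ ^ 2 ∂P
        + D.lamHat * (‖W.uR‖ * ‖W.uC‖) / n / 2 * (D.L ^ 2 / n * errC D W 𝒞 P ξ k)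
        + 3 * (‖W.uR‖ ^ 2 * D.lamHat / (n ^ 2 * W.M)) * errG D W 𝒞 P ξ k := by
  have hk := h.squareIntegrable k
  have hk' := h.squareIntegrable (k + 1)
  refine (integral_le_four (a₁ := 1) (a₂ := -(2 / 5 * (W.M * D.lamHat)))
    (a₃ := D.lamHat * (‖W.uR‖ * ‖W.uC‖) / n / 2 * (D.L ^ 2 / n))
    (a₄ := 3 * (‖W.uR‖ ^ 2 * D.lamHat / (n ^ 2 * W.M)))
    (integrable_obj h.smooth hx (memLp_avg hk'.X W.uR))
    (integrable_obj h.smooth hx (memLp_avg hk.X W.uR)) (h.integrable_gradient k)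
    (h.integrable_consensus k) (h.integrable_trackingErr k) fun ω => ?_).trans_eq (by
      simp only [errO, errC, errG, consensus, trackingErr]
      ring)
  have := h.obj_step_le (s := D.s k) (cx := 𝒞 (ξ k 0 ω)) (cy := 𝒞 (ξ k 1 ω)) (h.invariant k ω) hLl
  rw [← iterω_succ] at this
  linarith

/-- Contraction of the weighted sum of the errors, up to gradients and compression noise. -/
lemma V_succ_le (h : RandomSetting D W c 𝒞 ν P ξ) (hc : StepSizeCondition D W c) (k : ℕ) :
    V D W c 𝒞 P ξ (k + 1)
      ≤ V D W c 𝒞 P ξ k - 1 / 2 * (W.θR * D.γx) * D.L ^ 2 * errC D W 𝒞 P ξ k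
        - 3 / 8 * (coefA D W c * (W.θC * D.γy)) * errG D W 𝒞 P ξ k
        + 3 * (W.θR * D.γx) / (160 * coefE W)
          * ∫ ω, ‖gradient D.obj (avg W.uR (iterω D 𝒞 ξ k ω).X)‖ ^ 2 ∂P
        + zeta0 D W c * D.s k ^ 2 := by
  have hC := h.compression.C_nonneg
  have hr := h.compression.r_pos
  have hδ := h.compression.δ_pos
  have hδ1 := h.compression.δ_le_one
  have hσ := h.compression.sigmaSq_nonneg
  have hσr := h.compression.sigmaRSq_nonneg
  have hαx := h.αx_pos
  have hαy := h.αy_pos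
  have htx : 0 < D.αx * c.r * c.δ := by positivity
  have hty : 0 < D.αy * c.r * c.δ := by positivity
  have htx1 : D.αx * c.r * c.δ ≤ 1 :=
    mul_le_one₀ ((le_div_iff₀ hr).1 h.αx_le) hδ.le hδ1
  have hty1 : D.αy * c.r * c.δ ≤ 1 :=
    mul_le_one₀ ((le_div_iff₀ hr).1 h.αy_le) hδ.le hδ1
  have hL := h.L_pos
  have hl := h.lamHat_pos
  have hγx := h.γx_pos
  have hγy := h.γy_pos
  have hM := h.M_pos
  have hn := h.toSetting.n_pos
  have hθR := h.valid.normR.θ_pos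
  have hθR1 := h.valid.normR.θ_le_one
  have hθC := h.valid.normC.θ_pos
  have hθC1 := h.valid.normC.θ_le_one
  have ha : 0 < W.δR := by linarith [h.toSetting.one_le_δR]
  have hb : 0 < W.δC := by linarith [h.toSetting.one_le_δC]
  have hur := h.toSetting.norm_uR_pos
  have huc := h.toSetting.norm_uC_pos
  have hE := h.toSetting.coefE_pos
  have he₁ := h.toSetting.e1_pos hC
  have he₂ : 0 < e2 c := by
    rw [e2]
    linarith
  have k1 := h.toSetting.γx_le hC hc
  have k1' := h.toSetting.θγx_le hC hc
  have k2 := h.toSetting.lamHat_sq_le_consensus hC hc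
  have k3 := h.toSetting.lamHat_sq_le_tracking hC hc
  have k4 := h.toSetting.γx_sq_le_of_step hC hc
  have k5 := h.toSetting.γy_mul_e1_le hC hc
  have k6 := hc.γy_mul_C_le hC hθC.le
  have k7 := h.toSetting.γx_sq_mul_C_le hC htx.le hc
  have ky := h.toSetting.γy_le hC hc
  have hκ : 0 < W.θR * D.γx := mul_pos hθR hγx
  set tx := D.αx * c.r * c.δ with htxdef
  set ty := D.αy * c.r * c.δ with htydef
  have hB' : coefB D W c = D.L ^ 2 * tx * W.θR / (1296 * D.γx) := by
    rw [coefB, htxdef]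
    ring
  have hF' : coefD D W c = W.θC * D.γy * ty * W.θR / (108 * e2 c * D.γx) := by
    rw [coefD, htydef]
    ring
  have hA' : coefA D W c = W.θC * D.γy * W.θR / (108 * e1 W c * D.γx) := rfl
  set x := errC D W 𝒞 P ξ k with hxdef
  set g := errG D W 𝒞 P ξ k with hgdef
  set q := errCx D 𝒞 P ξ k with hqdef
  set hh := errCy D 𝒞 P ξ k with hhdef
  have hx0 : 0 ≤ x := integral_nonneg fun _ => sq_nonneg _
  have hg0 : 0 ≤ g := integral_nonneg fun _ => sq_nonneg _
  have hq0 : 0 ≤ q := integral_nonneg fun _ => sq_nonneg _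
  have hh0 : 0 ≤ hh := integral_nonneg fun _ => sq_nonneg _
  have r1 := h.errC_succ_le k
  have r2 := h.errG_succ_le k
  have r3 := h.errCx_succ_le k htx htx1
  have r4 := h.errCy_succ_le k hty hty1
  have r5 := h.integral_contractX_le k
  have r6 := h.integral_contractY_le k
  have r7 := h.integral_yTilde_le k one_pos
  have r8 := h.integral_yTilde_le k (t := ty / 4) (by positivity)
  have r9 := h.integral_errX_le k
  have r10 := h.integral_errY_le k
  have r11 := h.integral_moveY_le k
  have r12 := h.integral_move_le k
  have r13 := h.integral_Y_le k
  rw [← hxdef] at r1 r12 r13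
  rw [← hgdef] at r2 r4 r11 r13
  rw [← hqdef] at r5 r9
  rw [← hhdef] at r7 r8
  set G := ∫ ω, ‖gradient D.obj (avg W.uR (iterω D 𝒞 ξ k ω).X)‖ ^ 2 ∂P with hGdef
  set N := ∫ ω, ‖(iterω D 𝒞 ξ k ω).Y‖ ^ 2 ∂P with hNdef
  set Δ := ∫ ω, ‖(iterω D 𝒞 ξ (k + 1) ω).X - (iterω D 𝒞 ξ k ω).X‖ ^ 2 ∂P with hΔdef
  have hG0 : 0 ≤ G := integral_nonneg fun _ => sq_nonneg _
  have hN0 : 0 ≤ N := integral_nonneg fun _ => sq_nonneg _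
  have hΔ0 : 0 ≤ Δ := integral_nonneg fun _ => sq_nonneg _
  set S := D.s k ^ 2 * c.sigmaSq with hS
  set Sr := D.s k ^ 2 * c.sigmaRSq with hSr
  have hS0 : 0 ≤ S := by positivity
  have hSr0 : 0 ≤ Sr := by positivity
  rw [show (1 : ℝ) + 1 = 2 by norm_num, div_one, show (1 : ℝ) + 1 = 2 by norm_num] at r7
  rw [one_div_div] at r8
  set A := coefA D W c with hA
  set B := coefB D W c with hB
  set F := coefD D W c with hF
  have hA0 : 0 < A := by
    rw [hA']
    positivity
  have hB0 : 0 < B := by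
    rw [hB']
    positivity
  have hF0 : 0 < F := by
    rw [hF']
    positivity
  have cP := coef_move_le hL hb hθR hθC hθC1 hγx hγy hC htx hty (rfl : e1 W c = _)
    (rfl : e2 c = _) ky k3 k5
  have cG := coef_trackingErr_le hθR hθC hγx hγy he₁ he₂ htx hty (by linarith) k3 k5
  have cH := coef_compressY_le hb hθR hθC hθC1 hγx hγy hC (rfl : e1 W c = _) he₂ htx hty
    (by linarith) k3 k5 k6
  have cS := coef_noiseY_le (b := W.δC) hθR hθC hθC1 hγx hγy he₁ he₂ htx hty ky k3 k5
  have cN := coef_normY_le hθR hθR1 hγx hE huc k1' k2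
  have cQ := coef_compressX_le (L := D.L) hθR hθR1 hγx hC k7
  have cSx := coef_noiseX_le (L := D.L) (a := W.δR) hθR hθR1 hγx k1
  have cW := (coef_coupling_le hM hur huc hθR hγx he₁ hn h.toSetting.n_mul_M_le k4).1
  rw [← hA', ← hB', ← hF'] at cP cG cH cS
  rw [← hB'] at cQ
  rw [← hA'] at cW
  have hEdef : ‖W.uR‖ * ‖W.uC‖ / (n ^ 2 * W.M) = coefE W := rfl
  rw [hEdef] at cW
  have main := lyapunov_combine (L2 := D.L ^ 2) (P := D.L ^ 2 * W.θR / (64 * D.γx))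
    (sq_nonneg _) hA0.le hB0.le hF0.le (by positivity) (by positivity) (by positivity)
    (by positivity) (by positivity) (by positivity) (sq_nonneg D.lamHat) (by positivity)
    htx htx1 hty hty1 hC (by positivity) hq0 hh0 hΔ0 (integral_nonneg fun _ => sq_nonneg _)
    (by positivity) (by positivity) r1 r2 r3 r4 r5 r6 r7 r8 r9 r10 r11 r12 cP
  have hnoise : (D.L ^ 2 * (18 * D.γx * W.δR ^ 2 / W.θR)
      + D.L ^ 2 * W.θR / (64 * D.γx) * (27 * D.γx ^ 2 * W.δR ^ 2)
      + (A * (18 * D.γy * W.δC ^ 2 / W.θC)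
        + B * (3 / tx * (2 * (D.lamHat ^ 2 * (27 * D.γy ^ 2 * W.δC ^ 2))))
        + F * (3 / ty * (27 * D.γy ^ 2) * W.δC ^ 2))) * S
      + B * (2 * (D.αx * c.r * Sr)) + F * (2 * (D.αy * c.r * Sr)) ≤ zeta0 D W c * D.s k ^ 2 := by
    have h1 := mul_le_mul_of_nonneg_right (add_le_add cSx cS) hS0
    have hz : zeta0 D W c * D.s k ^ 2
        = (D.L ^ 2 * (18 * W.δR ^ 2 / W.θR) + A * (18 * W.δC ^ 2 / W.θC)) * S
          + B * (2 * (D.αx * c.r * Sr)) + F * (2 * (D.αy * c.r * Sr))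
          + (A * (108 * W.δC ^ 2 * (1 + 18 * c.C) * D.L ^ 2 / W.θC)
            + B * ((1 / (4 * D.L ^ 2) + 18) * (18 / tx))
            + F * ((18 + 9 * e2 c * D.L ^ 2) * (3 / ty))) * S := by
      rw [zeta0, zetaC, zetaG, zetaCx, zetaCy, ← hA, ← hB, ← hF, ← htxdef, ← htydef, hS, hSr]
      ring
    have h2 : 0 ≤ (A * (108 * W.δC ^ 2 * (1 + 18 * c.C) * D.L ^ 2 / W.θC)
            + B * ((1 / (4 * D.L ^ 2) + 18) * (18 / tx))
            + F * ((18 + 9 * e2 c * D.L ^ 2) * (3 / ty))) * S := by positivity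
    rw [hz]
    linarith
  have hxc : D.L ^ 2 * W.θR / (64 * D.γx) * (27 * D.γx ^ 2)
      = 27 / 64 * (W.θR * D.γx) * D.L ^ 2 := by
    field_simp
  rw [hxc] at main
  refine lyapunov_absorb (sq_nonneg D.L) hκ hE huc hn h.toSetting.one_le_n_mul_coefE
    (mul_pos hA0 (mul_pos hθC hγy)).le hx0 hg0 hq0 hh0 hN0 (main.trans_eq ?_) r13 cN cW cG cQ cH
    hnoise
  ring

/-- The Lyapunov function decreases up to the compression noise. -/
lemma lyapunov_succ_le (h : RandomSetting D W c 𝒞 ν P ξ) (hc : StepSizeCondition D W c)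
    {xstar : Vec p} (hx : ∀ x, D.obj xstar ≤ D.obj x) (k : ℕ) :
    lyapunov D W c 𝒞 P ξ xstar (k + 1)
      ≤ lyapunov D W c 𝒞 P ξ xstar k
        - W.M * D.lamHat / 4
          * ∫ ω, ‖gradient D.obj (avg W.uR (iterω D 𝒞 ξ k ω).X)‖ ^ 2 ∂P
        + coefE W * W.M * D.lamHat / β D W * (zeta0 D W c * D.s k ^ 2) := by
  have hC := h.compression.C_nonneg
  have hM := h.M_pos
  have hl := h.lamHat_pos
  have hE := h.toSetting.coefE_pos
  have hκ : 0 < W.θR * D.γx := mul_pos h.valid.normR.θ_pos h.γx_pos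
  have hβ : β D W = W.θR * D.γx / 8 := rfl
  have cO := (coef_coupling_le hM h.toSetting.norm_uR_pos h.toSetting.norm_uC_pos
    h.valid.normR.θ_pos h.γx_pos (h.toSetting.e1_pos hC) h.toSetting.n_pos
    h.toSetting.n_mul_M_le (h.toSetting.γx_sq_le_of_step hC hc)).2
  refine lyapunov_descent hE hM hl hκ h.toSetting.n_pos (sq_nonneg D.L)
    (integral_nonneg fun _ => sq_nonneg _) (integral_nonneg fun _ => sq_nonneg _) ?_ ?_
    h.toSetting.coefE_mul cO (h.V_succ_le hc k)
    (h.errO_succ_le hx (h.toSetting.L_mul_lamBar_le hC hc) k)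
  · rw [hβ]
    positivity
  · rw [hβ]
    field_simp
    exact div_self hκ.ne'

/-- The sublinear rate. -/
theorem sublinearRate (h : RandomSetting D W c 𝒞 ν P ξ) (hc : StepSizeCondition D W c)
    {xstar : Vec p} (hx : ∀ x, D.obj xstar ≤ D.obj x) {a₀ a : ℝ} (ha₀ : 0 < a₀) (ha : 0 < a)
    (ha1 : a < 1) (hs : ∀ k, D.s k ^ 2 = a₀ * a ^ k) : SublinearRate D W c 𝒞 P ξ xstar a₀ a := by
  refine ⟨h.integrable_gradient, fun K hK => ?_⟩
  have hK0 : (0 : ℝ) < K := by exact_mod_cast hK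
  have hM := h.M_pos
  have hl := h.lamHat_pos
  have hE := h.toSetting.coefE_pos
  have hβ : 0 < β D W := by
    have := mul_pos h.valid.normR.θ_pos h.γx_pos
    rw [β]
    positivity
  set G : ℕ → ℝ := fun k => ∫ ω, ‖gradient D.obj (avg W.uR (iterω D 𝒞 ξ k ω).X)‖ ^ 2 ∂P with hG
  set φ := coefE W * W.M * D.lamHat / β D W with hφ
  have hφ0 : 0 < φ := by positivity
  have hsum : ∀ K : ℕ, W.M * D.lamHat / 4 * ∑ k ∈ Finset.range K, G k
      + lyapunov D W c 𝒞 P ξ xstar K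
      ≤ lyapunov D W c 𝒞 P ξ xstar 0 + φ * zeta0 D W c * ∑ k ∈ Finset.range K, a₀ * a ^ k := by
    intro K
    induction K with
    | zero => simp
    | succ K ih =>
      have h1 := h.lyapunov_succ_le hc hx K
      rw [hs] at h1
      rw [Finset.sum_range_succ, Finset.sum_range_succ]
      change _ ≤ _ - W.M * D.lamHat / 4 * G K + _ at h1
      linarith
  have hgeom : ∑ k ∈ Finset.range K, a₀ * a ^ k ≤ a₀ / (1 - a) := by
    rw [← Finset.mul_sum, div_eq_mul_inv]
    refine mul_le_mul_of_nonneg_left ?_ ha₀.le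
    rw [← tsum_geometric_of_lt_one ha.le ha1]
    exact (summable_geometric_of_lt_one ha.le ha1).sum_le_tsum _ fun _ _ => by positivity
  have h1 := hsum K
  have h2 := h.lyapunov_nonneg hx K
  have h3 := mul_le_mul_of_nonneg_left hgeom (mul_nonneg hφ0.le h.zeta0_nonneg)
  have h4 : W.M * D.lamHat / 4 * ∑ k ∈ Finset.range K, G k
      ≤ lyapunov D W c 𝒞 P ξ xstar 0 + φ * zeta0 D W c * (a₀ / (1 - a)) := by linarith
  have h5 : ∑ k ∈ Finset.range K, G k ≤ 4 / (W.M * D.lamHat)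
      * (lyapunov D W c 𝒞 P ξ xstar 0 + φ * zeta0 D W c * (a₀ / (1 - a))) := by
    rw [div_mul_eq_mul_div, le_div_iff₀ (by positivity)]
    linarith
  have h6 := mul_le_mul_of_nonneg_left h5 (by positivity : (0 : ℝ) ≤ 1 / K)
  refine h6.trans_eq ?_
  have h1a : 1 - a ≠ 0 := by linarith
  rw [hφ]
  field_simp

end RandomSetting

end Recursion

/-! ### Row stochastic matrices with a spanning tree -/

section Stochastic

variable {n : ℕ} {R S Q : Matrix (Fin n) (Fin n) ℝ}

lemma exists_isPerronVector_transpose [NeZero n] (hR : R ∈ Matrix.rowStochastic ℝ (Fin n)) :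
    ∃ u : Vec n, IsPerronVector R.transpose u := by
  have hdet : (R - 1).det = 0 := by
    refine Matrix.exists_mulVec_eq_zero_iff.1 ⟨1, one_ne_zero, ?_⟩
    rw [Matrix.sub_mulVec, Matrix.one_mulVec, Matrix.one_vecMul_of_mem_rowStochastic hR, sub_self]
  obtain ⟨w, hw0, hw⟩ := Matrix.exists_vecMul_eq_zero_iff.2 hdet
  rw [Matrix.vecMul_sub, Matrix.vecMul_one, sub_eq_zero] at hw
  have hfix : ∀ j, ∑ i, w i * R i j = w j := fun j => congrFun hw j
  have hle : ∀ j ∈ Finset.univ, |w j| ≤ ∑ i, |w i| * R i j := fun j _ => by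
    conv_lhs => rw [← hfix j]
    refine (Finset.abs_sum_le_sum_abs _ _).trans_eq (Finset.sum_congr rfl fun i _ => ?_)
    rw [abs_mul, abs_of_nonneg (Matrix.nonneg_of_mem_rowStochastic hR)]
  have hsum : ∑ j, |w j| = ∑ j, ∑ i, |w i| * R i j := by
    rw [Finset.sum_comm]
    simp [← Finset.mul_sum, Matrix.sum_row_of_mem_rowStochastic hR]
  have habs := (Finset.sum_eq_sum_iff_of_le hle).1 hsum
  have hpos : 0 < ∑ i, |w i| := by
    obtain ⟨i, hi⟩ := Function.ne_iff.1 hw0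
    exact Finset.sum_pos' (fun i _ => abs_nonneg _) ⟨i, Finset.mem_univ _, abs_pos.2 hi⟩
  refine ⟨WithLp.toLp 2 fun i => n / (∑ i, |w i|) * |w i|, fun i => ?_, fun i => ?_, ?_⟩
  · exact mul_nonneg (div_nonneg (Nat.cast_nonneg _) hpos.le) (abs_nonneg _)
  · simp only [Matrix.transpose_apply]
    rw [habs i (Finset.mem_univ _), Finset.mul_sum]
    exact Finset.sum_congr rfl fun j _ => by ring
  · simp only [← Finset.mul_sum]
    exact div_mul_cancel₀ _ hpos.ne'

lemma relaxed_mem_rowStochastic (hR : R ∈ Matrix.rowStochastic ℝ (Fin n)) {γ : ℝ} (h0 : 0 ≤ γ)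
    (h1 : γ ≤ 1) : relaxed R γ ∈ Matrix.rowStochastic ℝ (Fin n) := by
  have h : relaxed R γ = (1 - γ) • 1 + γ • R := by
    rw [relaxed, sub_smul, one_smul, smul_sub]
    abel
  rw [h]
  exact Matrix.convex_rowStochastic (one_mem _) hR (by linarith) h0 (by ring)

lemma relaxed_apply_self_pos (hR : R ∈ Matrix.rowStochastic ℝ (Fin n)) {γ : ℝ} (h0 : 0 ≤ γ)
    (h1 : γ < 1) (i : Fin n) : 0 < relaxed R γ i i := by
  have h := mul_nonneg h0 (Matrix.nonneg_of_mem_rowStochastic hR (i := i) (j := i))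
  simp only [relaxed, Matrix.sub_apply, Matrix.smul_apply, Matrix.one_apply_eq, smul_eq_mul]
  linarith

lemma relaxed_apply_pos (hR : R ∈ Matrix.rowStochastic ℝ (Fin n)) {γ : ℝ} (h0 : 0 < γ)
    (h1 : γ < 1) {i j : Fin n} (hij : 0 < R i j) : 0 < relaxed R γ i j := by
  rcases eq_or_ne i j with rfl | hne
  · exact relaxed_apply_self_pos hR h0.le h1 i
  · simp only [relaxed, Matrix.sub_apply, Matrix.smul_apply, Matrix.one_apply_ne hne, smul_eq_mul]
    linarith [mul_pos h0 hij]

lemma pow_succ_apply_pos (hS : S ∈ Matrix.rowStochastic ℝ (Fin n)) {i j l : Fin n} {m : ℕ}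
    (h1 : 0 < S j l) (h2 : 0 < (S ^ m) l i) : 0 < (S ^ (m + 1)) j i := by
  rw [pow_succ', Matrix.mul_apply]
  exact Finset.sum_pos' (fun q _ => mul_nonneg (Matrix.nonneg_of_mem_rowStochastic hS)
    (Matrix.nonneg_of_mem_rowStochastic (pow_mem hS m))) ⟨l, Finset.mem_univ _, mul_pos h1 h2⟩

lemma exists_pow_apply_pos (hS : S ∈ Matrix.rowStochastic ℝ (Fin n)) (hd : ∀ j, 0 < S j j)
    {i : Fin n} (hi : IsSpanningTreeRoot S i) : ∃ m : ℕ, ∀ j, 0 < (S ^ m) j i := by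
  obtain ⟨par, hpar, hroot⟩ := hi
  have key : ∀ (m : ℕ) (j : Fin n), par^[m] j = i → 0 < (S ^ m) j i := by
    intro m
    induction m with
    | zero =>
      rintro j rfl
      simp
    | succ m ih =>
      intro j hj
      rcases eq_or_ne j i with rfl | hne
      · clear hj ih
        induction m + 1 with
        | zero => simp
        | succ k ih => exact pow_succ_apply_pos hS (hd j) ih
      · exact pow_succ_apply_pos hS (hpar j hne) (ih _ hj)
  choose m hm using hroot
  refine ⟨∑ j, m j, fun j => ?_⟩
  exact Nat.le_induction (key _ j (hm j)) (fun k _ ih => pow_succ_apply_pos hS (hd j) ih) _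
    (Finset.single_le_sum (fun _ _ => Nat.zero_le _) (Finset.mem_univ j))

lemma mulVec_mem_Icc (hQ : Q ∈ Matrix.rowStochastic ℝ (Fin n)) {i : Fin n} {ε : ℝ}
    (hε : ∀ j, ε ≤ Q j i) {v : Fin n → ℝ} {lo hi : ℝ} (hv : ∀ j, v j ∈ Set.Icc lo hi)
    (j : Fin n) :
    (Q.mulVec v) j ∈ Set.Icc (lo + ε * (v i - lo)) (hi - ε * (hi - v i)) := by
  have h0 : ∀ l, 0 ≤ Q j l := fun l => Matrix.nonneg_of_mem_rowStochastic hQ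
  have h1 : ∀ t : ℝ, ∑ l, Q j l * t = t := fun t => by
    rw [← Finset.sum_mul, Matrix.sum_row_of_mem_rowStochastic hQ, one_mul]
  constructor
  · have h : Q j i * (v i - lo) ≤ ∑ l, Q j l * (v l - lo) :=
      Finset.single_le_sum (f := fun l => Q j l * (v l - lo))
        (fun l _ => mul_nonneg (h0 l) (sub_nonneg.2 (hv l).1)) (Finset.mem_univ i)
    have h' := mul_le_mul_of_nonneg_right (hε j) (sub_nonneg.2 (hv i).1)
    simp only [mul_sub, Finset.sum_sub_distrib, h1] at h h' ⊢
    simp only [Matrix.mulVec, dotProduct]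
    linarith
  · have h : Q j i * (hi - v i) ≤ ∑ l, Q j l * (hi - v l) :=
      Finset.single_le_sum (f := fun l => Q j l * (hi - v l))
        (fun l _ => mul_nonneg (h0 l) (sub_nonneg.2 (hv l).2)) (Finset.mem_univ i)
    have h' := mul_le_mul_of_nonneg_right (hε j) (sub_nonneg.2 (hv i).2)
    simp only [mul_sub, Finset.sum_sub_distrib, h1] at h h' ⊢
    simp only [Matrix.mulVec, dotProduct]
    linarith

lemma exists_pow_mulVec_mem_Icc (hQ : Q ∈ Matrix.rowStochastic ℝ (Fin n)) {i : Fin n} {ε : ℝ}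
    (hε : ∀ j, ε ≤ Q j i) {v : Fin n → ℝ} {lo hi : ℝ} (hv : ∀ j, v j ∈ Set.Icc lo hi)
    (k : ℕ) :
    ∃ lo' hi' : ℝ, hi' - lo' = (1 - ε) ^ k * (hi - lo) ∧
      ∀ j, ((Q ^ k).mulVec v) j ∈ Set.Icc lo' hi' := by
  induction k with
  | zero => exact ⟨lo, hi, by simp, by simpa using hv⟩
  | succ k ih =>
    obtain ⟨lo', hi', hw, hmem⟩ := ih
    refine ⟨lo' + ε * (((Q ^ k).mulVec v) i - lo'), hi' - ε * (hi' - ((Q ^ k).mulVec v) i), ?_,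
      fun j => ?_⟩
    · rw [pow_succ]
      linear_combination (1 - ε) * hw
    · rw [pow_succ', ← Matrix.mulVec_mulVec]
      exact mulVec_mem_Icc hQ hε hmem j

lemma vecMul_pow {w : Fin n → ℝ} (hw : Matrix.vecMul w S = w) (k : ℕ) :
    Matrix.vecMul w (S ^ k) = w := by
  induction k with
  | zero => simp
  | succ k ih => rw [pow_succ, ← Matrix.vecMul_vecMul, ih, hw]

/-- Some power of an aperiodic row stochastic matrix with a spanning tree has a positive column. -/
lemma exists_scrambling_pow [NeZero n] (hS : S ∈ Matrix.rowStochastic ℝ (Fin n))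
    (hd : ∀ j, 0 < S j j) {i : Fin n} (hi : IsSpanningTreeRoot S i) :
    ∃ (m : ℕ) (ε : ℝ), 0 < ε ∧ ε ≤ 1 ∧ ∀ j, ε ≤ (S ^ m) j i := by
  obtain ⟨m, hm⟩ := exists_pow_apply_pos hS hd hi
  obtain ⟨j₀, -, hj₀⟩ := Finset.exists_min_image Finset.univ (fun j => (S ^ m) j i)
    Finset.univ_nonempty
  exact ⟨m, (S ^ m) j₀ i, hm j₀, Matrix.le_one_of_mem_rowStochastic (pow_mem hS m),
    fun j => hj₀ j (Finset.mem_univ _)⟩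

lemma eq_zero_of_vecMul_eq [NeZero n] (hS : S ∈ Matrix.rowStochastic ℝ (Fin n))
    (hd : ∀ j, 0 < S j j) {i : Fin n} (hi : IsSpanningTreeRoot S i) {w : Fin n → ℝ}
    (hw : Matrix.vecMul w S = w) (hsum : ∑ j, w j = 0) : w = 0 := by
  obtain ⟨m, ε, hε0, hε1, hε⟩ := exists_scrambling_pow hS hd hi
  set B : ℝ := ∑ j, |w j| with hB
  have hmem : ∀ j, w j ∈ Set.Icc (-B) B := fun j =>
    abs_le.1 (Finset.single_le_sum (f := fun j => |w j|) (fun _ _ => abs_nonneg _)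
      (Finset.mem_univ j))
  have hbound : ∀ k : ℕ, ∑ j, w j * w j ≤ (1 - ε) ^ k * (B * (2 * B)) := fun k => by
    obtain ⟨lo, hi', hwid, hv⟩ := exists_pow_mulVec_mem_Icc (pow_mem hS m) hε hmem k
    have h1 : ∑ j, w j * w j = ∑ j, w j * (((S ^ m) ^ k).mulVec w) j := by
      have := Matrix.dotProduct_mulVec w ((S ^ m) ^ k) w
      rw [vecMul_pow (vecMul_pow hw m) k] at this
      exact this.symm
    calc ∑ j, w j * w j = ∑ j, w j * ((((S ^ m) ^ k).mulVec w) j - lo) := by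
          rw [h1]
          simp only [mul_sub, Finset.sum_sub_distrib, ← Finset.sum_mul, hsum]
          ring
      _ ≤ ∑ j, |w j| * (hi' - lo) := Finset.sum_le_sum fun j _ =>
          mul_le_mul (le_abs_self _) (by linarith [(hv j).2]) (by linarith [(hv j).1])
            (abs_nonneg _)
      _ = _ := by
          rw [← Finset.sum_mul, hwid]
          ring
  have hlim : Filter.Tendsto (fun k : ℕ => (1 - ε) ^ k * (B * (2 * B))) Filter.atTop (nhds 0) := by
    simpa using (tendsto_pow_atTop_nhds_zero_of_lt_one (by linarith : 0 ≤ 1 - ε)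
      (by linarith)).mul_const (B * (2 * B))
  have h0 := ge_of_tendsto' hlim hbound
  have h0' : ∑ j, w j * w j = 0 :=
    le_antisymm h0 (Finset.sum_nonneg fun _ _ => mul_self_nonneg _)
  funext j
  exact mul_self_eq_zero.1
    ((Finset.sum_eq_zero_iff_of_nonneg fun _ _ => mul_self_nonneg _).1 h0' j (Finset.mem_univ j))

lemma exists_pow_contraction [NeZero n] (hS : S ∈ Matrix.rowStochastic ℝ (Fin n))
    (hd : ∀ j, 0 < S j j) {i : Fin n} (hi : IsSpanningTreeRoot S i) {u : Vec n}
    (hu : IsPerronVector S.transpose u) :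
    ∃ N : ℕ, 1 ≤ N ∧ ∀ v : Vec n, ∑ j, u j * v j = 0 →
      ‖Matrix.toEuclideanCLM (n := Fin n) (𝕜 := ℝ) (S ^ N) v‖ ^ 2 ≤ 1 / 2 * ‖v‖ ^ 2 := by
  obtain ⟨m, ε, hε0, hε1, hε⟩ := exists_scrambling_pow hS hd hi
  have hn : (0 : ℝ) < n := Nat.cast_pos.2 (NeZero.pos n)
  have hlim : Filter.Tendsto (fun k : ℕ => n * ((1 - ε) ^ k * 2) ^ 2) Filter.atTop (nhds 0) := by
    simpa using (((tendsto_pow_atTop_nhds_zero_of_lt_one (by linarith : 0 ≤ 1 - ε)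
      (by linarith)).mul_const 2).pow 2).const_mul (n : ℝ)
  obtain ⟨k, hk, hk1⟩ := ((hlim.eventually (gt_mem_nhds (by norm_num : (0 : ℝ) < 1 / 2))).and
    (Filter.eventually_ge_atTop 1)).exists
  have huS : Matrix.vecMul u S = u := funext fun j => by
    simpa [Matrix.vecMul, dotProduct, mul_comm] using hu.eigen j
  have key : ∀ v : Vec n, ∑ j, u j * v j = 0 →
      ‖Matrix.toEuclideanCLM (n := Fin n) (𝕜 := ℝ) ((S ^ m) ^ k) v‖ ^ 2 ≤ 1 / 2 * ‖v‖ ^ 2 := by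
    intro v hv
    have hmem : ∀ j, v j ∈ Set.Icc (-‖v‖) ‖v‖ := fun j => abs_le.1 (PiLp.norm_apply_le v j)
    obtain ⟨lo, hi', hwid, hQ⟩ := exists_pow_mulVec_mem_Icc (pow_mem hS m) hε hmem k
    have h0 : ∑ j, u j * (((S ^ m) ^ k).mulVec v) j = 0 := by
      have := Matrix.dotProduct_mulVec u ((S ^ m) ^ k) v
      rw [vecMul_pow (vecMul_pow huS m) k] at this
      exact this.trans hv
    have hlo : n * lo ≤ 0 := by
      rw [← hu.sum_eq, Finset.sum_mul, ← h0]
      exact Finset.sum_le_sum fun j _ => mul_le_mul_of_nonneg_left (hQ j).1 (hu.nonneg j)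
    have hhi : 0 ≤ n * hi' := by
      rw [← hu.sum_eq, Finset.sum_mul, ← h0]
      exact Finset.sum_le_sum fun j _ => mul_le_mul_of_nonneg_left (hQ j).2 (hu.nonneg j)
    have hlo' : lo ≤ 0 := by
      by_contra! h
      exact absurd hlo (not_le.2 (mul_pos hn h))
    have hhi' : 0 ≤ hi' := by
      by_contra! h
      exact absurd hhi (not_le.2 (mul_neg_of_pos_of_neg hn h))
    calc ‖Matrix.toEuclideanCLM (n := Fin n) (𝕜 := ℝ) ((S ^ m) ^ k) v‖ ^ 2
        = ∑ j, ((((S ^ m) ^ k).mulVec v) j) ^ 2 := by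
          rw [EuclideanSpace.real_norm_sq_eq]
          rfl
      _ ≤ ∑ _j : Fin n, (hi' - lo) ^ 2 := Finset.sum_le_sum fun j _ =>
          sq_le_sq' (by linarith [(hQ j).1]) (by linarith [(hQ j).2])
      _ = n * ((1 - ε) ^ k * 2) ^ 2 * ‖v‖ ^ 2 := by
          rw [hwid, Finset.sum_const, Finset.card_univ, Fintype.card_fin, nsmul_eq_mul]
          ring
      _ ≤ 1 / 2 * ‖v‖ ^ 2 := by gcongr
  rcases eq_or_ne m 0 with rfl | hm
  · refine ⟨1, le_rfl, fun v hv => ?_⟩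
    have h := key v hv
    simp only [pow_zero, one_pow, map_one, one_apply_eq_self] at h
    have : ‖v‖ = 0 := by nlinarith [norm_nonneg v, sq_nonneg ‖v‖]
    simp [norm_eq_zero.1 this]
  · exact ⟨m * k, Nat.one_le_iff_ne_zero.2 (mul_ne_zero hm (by omega)), by simpa [pow_mul] using key⟩

end Stochastic

/-! ### Weighted norms for mixing matrices -/

section WeightedNorm

open scoped Matrix.Norms.L2Operator

variable {n : ℕ} {R S T : Matrix (Fin n) (Fin n) ℝ}

lemma indNorm_eq_norm (T A : Matrix (Fin n) (Fin n) ℝ) : indNorm T A = ‖T * A * T⁻¹‖ := rfl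

lemma indNorm_add_le (T A B : Matrix (Fin n) (Fin n) ℝ) :
    indNorm T (A + B) ≤ indNorm T A + indNorm T B := by
  simp only [indNorm_eq_norm, Matrix.mul_add, Matrix.add_mul]
  exact norm_add_le _ _

lemma indNorm_sub_le (T A B : Matrix (Fin n) (Fin n) ℝ) :
    indNorm T (A - B) ≤ indNorm T A + indNorm T B := by
  simp only [indNorm_eq_norm, Matrix.mul_sub, Matrix.sub_mul]
  exact norm_sub_le _ _

lemma indNorm_smul (T A : Matrix (Fin n) (Fin n) ℝ) (t : ℝ) :
    indNorm T (t • A) = |t| * indNorm T A := by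
  simp only [indNorm_eq_norm, Matrix.mul_smul, Matrix.smul_mul, norm_smul, Real.norm_eq_abs]

lemma indNorm_one_le (hT : IsUnit T) : indNorm T 1 ≤ 1 :=
  indNorm_le_of_forall hT zero_le_one fun v => by simp

lemma indNorm_smul_left {s : ℝ} (hs : s ≠ 0) (hT : IsUnit T) (A : Matrix (Fin n) (Fin n) ℝ) :
    indNorm (s • T) A = indNorm T A := by
  have hinv : (s • T)⁻¹ = s⁻¹ • T⁻¹ := by
    refine Matrix.inv_eq_right_inv ?_
    rw [Matrix.smul_mul, Matrix.mul_smul, smul_smul, mul_inv_cancel₀ hs, one_smul,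
      Matrix.mul_nonsing_inv _ ((Matrix.isUnit_iff_isUnit_det T).1 hT)]
  simp only [indNorm_eq_norm, hinv, Matrix.smul_mul, Matrix.mul_smul, smul_smul]
  rw [inv_mul_cancel₀ hs, one_smul]

lemma indNorm_transpose (hT : IsUnit T) (A : Matrix (Fin n) (Fin n) ℝ) :
    indNorm T⁻¹.transpose A.transpose = indNorm T A := by
  have h : T⁻¹.transpose * A.transpose * (T⁻¹.transpose)⁻¹ = star (T * A * T⁻¹) := by
    rw [← Matrix.transpose_nonsing_inv,
      Matrix.nonsing_inv_nonsing_inv _ ((Matrix.isUnit_iff_isUnit_det T).1 hT)]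
    simp [Matrix.star_eq_conjTranspose, Matrix.conjTranspose_eq_transpose_of_trivial,
      Matrix.transpose_mul, Matrix.mul_assoc]
  rw [indNorm_eq_norm, h, norm_star, ← indNorm_eq_norm]

lemma exists_weight_of_quadratic {M : Matrix (Fin n) (Fin n) ℝ} (hM : M.PosDef) :
    ∃ T : Matrix (Fin n) (Fin n) ℝ, IsUnit T ∧ ∀ v : Vec n,
      ‖Matrix.toEuclideanCLM (n := Fin n) (𝕜 := ℝ) T v‖ ^ 2
        = inner ℝ v (Matrix.toEuclideanCLM (n := Fin n) (𝕜 := ℝ) M v) := by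
  open scoped MatrixOrder in
  obtain ⟨T, hT, rfl⟩ := CStarAlgebra.isStrictlyPositive_iff_eq_star_mul_self.1
    (Matrix.isStrictlyPositive_iff_posDef.2 hM)
  refine ⟨T, hT, fun v => ?_⟩
  rw [map_mul, mul_apply_eq_comp, map_star, ContinuousLinearMap.star_eq_adjoint,
    ContinuousLinearMap.adjoint_inner_right, real_inner_self_eq_norm_sq]

/-- `T` has the properties of a weighted norm for `W` and the projection `Pi`, apart from its
normalization, for all step-sizes up to `Γ`. -/
structure IsWeight (W Pi T : Matrix (Fin n) (Fin n) ℝ) (θ Γ : ℝ) : Prop where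
  isUnit : IsUnit T
  θ_pos : 0 < θ
  θ_le_one : θ ≤ 1
  contraction : ∀ γ, 0 < γ → γ ≤ Γ → indNorm T (Pi * relaxed W γ) ≤ 1 - θ * γ
  proj_le : indNorm T Pi ≤ 1
  mixing_le : indNorm T W ≤ 2
  relaxed_le : ∀ γ, 0 < γ → γ ≤ Γ → indNorm T (relaxed W γ) ≤ 2
  sub_le : indNorm T (1 - W) ≤ 3

lemma IsWeight.exists_isWeightedNorm {W Pi : Matrix (Fin n) (Fin n) ℝ} {θ Γ : ℝ}
    (h : IsWeight W Pi T θ Γ) :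
    ∃ (T' : Matrix (Fin n) (Fin n) ℝ) (d : ℝ), ∀ γ, 0 < γ → γ ≤ Γ →
      IsWeightedNorm W Pi T' d θ γ := by
  set s : ℝ := ‖T⁻¹‖ + 1 with hs
  have hs0 : 0 < s := by positivity
  have hT := h.isUnit
  have hdet := (Matrix.isUnit_iff_isUnit_det T).1 hT
  refine ⟨s • T, ‖s • T‖, fun γ h0 h1 => ?_⟩
  have hsT : IsUnit (s • T) := by
    rw [Matrix.isUnit_iff_isUnit_det, Matrix.det_smul]
    exact ((isUnit_iff_ne_zero.2 hs0.ne').pow _).mul hdet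
  constructor
  · exact hsT
  · intro v
    have hv : v = Matrix.toEuclideanCLM (n := Fin n) (𝕜 := ℝ) T⁻¹
        (Matrix.toEuclideanCLM (n := Fin n) (𝕜 := ℝ) T v) := by
      rw [← mul_apply_eq_comp, ← map_mul, Matrix.nonsing_inv_mul _ hdet, map_one,
        one_apply_eq_self]
    rw [map_smul, smul_apply, norm_smul, Real.norm_of_nonneg hs0.le]
    calc ‖v‖ ≤ ‖T⁻¹‖ * ‖Matrix.toEuclideanCLM (n := Fin n) (𝕜 := ℝ) T v‖ := by
          conv_lhs => rw [hv]
          exact ContinuousLinearMap.le_opNorm _ _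
      _ ≤ s * ‖Matrix.toEuclideanCLM (n := Fin n) (𝕜 := ℝ) T v‖ := by
          gcongr
          linarith
  · exact fun v => ContinuousLinearMap.le_opNorm _ _
  · exact h.θ_pos
  · exact h.θ_le_one
  all_goals rw [indNorm_smul_left hs0.ne' hT]
  exacts [h.contraction γ h0 h1, h.proj_le, h.mixing_le, h.relaxed_le γ h0 h1, h.sub_le]

lemma IsWeight.transpose {W Pi : Matrix (Fin n) (Fin n) ℝ} {θ Γ : ℝ}
    (h : IsWeight W Pi T θ Γ) (hcomm : Pi * W = W * Pi) :
    IsWeight W.transpose Pi.transpose T⁻¹.transpose θ Γ := by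
  have hT := h.isUnit
  have hdet := (Matrix.isUnit_iff_isUnit_det T).1 hT
  constructor
  · rw [Matrix.isUnit_iff_isUnit_det, Matrix.det_transpose]
    exact Matrix.isUnit_nonsing_inv_det _ hdet
  · exact h.θ_pos
  · exact h.θ_le_one
  · intro γ h0 h1
    rw [relaxed_transpose, ← Matrix.transpose_mul, ← relaxed_comm hcomm, indNorm_transpose hT]
    exact h.contraction γ h0 h1
  · exact (indNorm_transpose hT _).trans_le h.proj_le
  · exact (indNorm_transpose hT _).trans_le h.mixing_le
  · intro γ h0 h1
    rw [relaxed_transpose, indNorm_transpose hT]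
    exact h.relaxed_le γ h0 h1
  · rw [show (1 - W.transpose) = (1 - W).transpose by simp, indNorm_transpose hT]
    exact h.sub_le

/-- Bounds for one relaxation `S = I - Γ (I - W)` give the bounds for all smaller step-sizes. -/
lemma isWeight_of_relaxed {W Pi : Matrix (Fin n) (Fin n) ℝ} (hT : IsUnit T) {Γ Γ' ρ : ℝ}
    (hΓ : 2 / 3 ≤ Γ') (hΓΓ : Γ ≤ Γ') (hΓ1 : Γ' ≤ 1) (hρ : ρ < 1) (hPi : indNorm T Pi ≤ 1)
    (hS : indNorm T (relaxed W Γ') ≤ 1) (hPS : indNorm T (Pi * relaxed W Γ') ≤ ρ) :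
    IsWeight W Pi T (min 1 ((1 - ρ) / Γ')) Γ := by
  have hΓ0 : 0 < Γ' := by linarith
  have hone := indNorm_one_le hT
  have hinv : 1 ≤ Γ'⁻¹ := (one_le_inv₀ hΓ0).2 hΓ1
  have hinv' : Γ'⁻¹ ≤ 3 / 2 := by
    rw [inv_le_comm₀ hΓ0 (by norm_num)]
    linarith
  have hW : Γ'⁻¹ • relaxed W Γ' = Γ'⁻¹ • 1 - (1 - W) := by
    rw [relaxed, smul_sub, smul_smul, inv_mul_cancel₀ hΓ0.ne', one_smul]
  have hrel : ∀ γ, relaxed W γ = (1 - γ * Γ'⁻¹) • 1 + (γ * Γ'⁻¹) • relaxed W Γ' := fun γ => by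
    rw [relaxed, relaxed, smul_sub (γ * Γ'⁻¹), smul_smul, mul_assoc, inv_mul_cancel₀ hΓ0.ne',
      mul_one, sub_smul, one_smul]
    abel
  have ht : ∀ γ, 0 < γ → γ ≤ Γ → 0 ≤ γ * Γ'⁻¹ ∧ γ * Γ'⁻¹ ≤ 1 := fun γ h0 h1 =>
    ⟨by positivity, by rw [← div_eq_mul_inv, div_le_one hΓ0]; linarith⟩
  constructor
  · exact hT
  · exact lt_min one_pos (div_pos (by linarith) hΓ0)
  · exact min_le_left _ _
  · intro γ h0 h1
    obtain ⟨t0, t1⟩ := ht γ h0 h1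
    rw [hrel γ, Matrix.mul_add, Matrix.mul_smul, Matrix.mul_smul, Matrix.mul_one]
    refine (indNorm_add_le _ _ _).trans ?_
    rw [indNorm_smul, indNorm_smul, abs_of_nonneg t0, abs_of_nonneg (sub_nonneg.2 t1)]
    have h2 : min 1 ((1 - ρ) / Γ') * γ ≤ (1 - ρ) / Γ' * γ := by
      gcongr
      exact min_le_right _ _
    have h3 := mul_le_mul_of_nonneg_left hPi (sub_nonneg.2 t1)
    have h4 := mul_le_mul_of_nonneg_left hPS t0
    have h5 : (1 - ρ) / Γ' * γ = (1 - ρ) * (γ * Γ'⁻¹) := by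
      rw [div_eq_mul_inv]
      ring
    linarith
  · exact hPi
  · have : W = Γ'⁻¹ • relaxed W Γ' - (Γ'⁻¹ - 1) • 1 := by
      rw [hW, sub_smul, one_smul]
      abel
    rw [this]
    refine (indNorm_sub_le _ _ _).trans ?_
    rw [indNorm_smul, indNorm_smul, abs_of_nonneg (by linarith), abs_of_nonneg (by linarith)]
    nlinarith
  · intro γ h0 h1
    obtain ⟨t0, t1⟩ := ht γ h0 h1
    rw [hrel γ]
    refine (indNorm_add_le _ _ _).trans ?_
    rw [indNorm_smul, indNorm_smul, abs_of_nonneg t0, abs_of_nonneg (sub_nonneg.2 t1)]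
    nlinarith
  · have : 1 - W = Γ'⁻¹ • 1 - Γ'⁻¹ • relaxed W Γ' := by
      rw [hW]
      abel
    rw [this]
    refine (indNorm_sub_le _ _ _).trans ?_
    rw [indNorm_smul, indNorm_smul, abs_of_nonneg (by linarith)]
    nlinarith

/-- If a power of `S` is a contraction on the range of a projection that commutes with `S`, then
some weighted norm makes `S` itself one. -/
lemma exists_contracting_weight {u : Vec n} {Pi : Matrix (Fin n) (Fin n) ℝ}
    (hPi : Pi * Pi = Pi) (hcomm : Pi * S = S * Pi)
    (huPi : Matrix.vecMul u Pi = 0) (huS : Matrix.vecMul u S = u)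
    (hker : ∀ v : Vec n, Matrix.toEuclideanCLM (n := Fin n) (𝕜 := ℝ) Pi v = 0 →
      inner ℝ u v = (0 : ℝ) → v = 0)
    {N : ℕ} (hN : 1 ≤ N)
    (hcontr : ∀ v : Vec n, inner ℝ u v = (0 : ℝ) →
      ‖Matrix.toEuclideanCLM (n := Fin n) (𝕜 := ℝ) (S ^ N) v‖ ^ 2 ≤ 1 / 2 * ‖v‖ ^ 2) :
    ∃ (T : Matrix (Fin n) (Fin n) ℝ) (ρ : ℝ), IsUnit T ∧ ρ < 1 ∧ indNorm T Pi ≤ 1 ∧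
      indNorm T S ≤ 1 ∧ indNorm T (Pi * S) ≤ ρ := by
  set Φ := Matrix.toEuclideanCLM (n := Fin n) (𝕜 := ℝ) with hΦ
  set M : Matrix (Fin n) (Fin n) ℝ := Matrix.vecMulVec u u
    + ∑ k ∈ Finset.range N, (S ^ k * Pi).transpose * (S ^ k * Pi) with hM
  set a : ℕ → Vec n → ℝ := fun k v => ‖Φ (S ^ k) (Φ Pi v)‖ ^ 2 with ha
  have hquad : ∀ v : Vec n,
      inner ℝ v (Φ M v) = inner ℝ u v ^ 2 + ∑ k ∈ Finset.range N, a k v := by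
    intro v
    have h1 : ∀ A : Matrix (Fin n) (Fin n) ℝ,
        inner ℝ v (Φ (A.transpose * A) v) = ‖Φ A v‖ ^ 2 := fun A => by
      rw [← Matrix.conjTranspose_eq_transpose_of_trivial, ← Matrix.star_eq_conjTranspose, map_mul,
        mul_apply_eq_comp, map_star, ContinuousLinearMap.star_eq_adjoint,
        ContinuousLinearMap.adjoint_inner_right, real_inner_self_eq_norm_sq]
    have h2 : inner ℝ v (Φ (Matrix.vecMulVec u u) v) = (inner ℝ u v : ℝ) ^ 2 := by
      rw [hΦ, Matrix.inner_toEuclideanCLM, Matrix.vecMulVec_mulVec, EuclideanSpace.inner_eq_star_dotProduct]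
      simp [dotProduct_comm, sq]
    rw [hM, map_add, map_sum, add_apply, sum_apply,
      inner_add_right, inner_sum, h2]
    simp only [h1]
    simp only [ha, map_mul, mul_apply_eq_comp]
  have ha0 : ∀ k v, 0 ≤ a k v := fun k v => sq_nonneg _
  have hpos : M.PosDef := by
    refine Matrix.PosDef.of_dotProduct_mulVec_pos ?_ fun x hx => ?_
    · rw [Matrix.IsHermitian, Matrix.conjTranspose_eq_transpose_of_trivial, hM,
        Matrix.transpose_add, Matrix.transpose_sum]
      congr 1
      · ext i j
        simp [Matrix.vecMulVec_apply, mul_comm]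
      · simp
    · have h := hquad (WithLp.toLp 2 x)
      rw [hΦ, Matrix.inner_toEuclideanCLM] at h
      have h' : star x ⬝ᵥ M.mulVec x = x ⬝ᵥ M.mulVec x := by simp
      rw [h', h]
      by_contra! hle
      have hs := Finset.sum_nonneg fun k (_ : k ∈ Finset.range N) => ha0 k (WithLp.toLp 2 x)
      have hs0 : a 0 (WithLp.toLp 2 x) ≤ ∑ k ∈ Finset.range N, a k (WithLp.toLp 2 x) :=
        Finset.single_le_sum (f := fun k => a k (WithLp.toLp 2 x)) (fun k _ => ha0 k _)
          (Finset.mem_range.2 hN)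
      have hsq := sq_nonneg (inner ℝ u (WithLp.toLp 2 x) : ℝ)
      have e1 : (inner ℝ u (WithLp.toLp 2 x) : ℝ) = 0 := pow_eq_zero_iff two_ne_zero |>.1 (by linarith)
      have e2 : a 0 (WithLp.toLp 2 x) = 0 := le_antisymm (by linarith) (ha0 _ _)
      simp only [ha, pow_zero, map_one, one_apply_eq_self] at e2
      refine hx ?_
      have := hker (WithLp.toLp 2 x) (norm_eq_zero.1 (pow_eq_zero_iff two_ne_zero |>.1 e2)) e1
      exact congrArg WithLp.ofLp this
  obtain ⟨T, hT, hTq⟩ := exists_weight_of_quadratic hpos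
  simp only [← hΦ, hquad] at hTq
  have hinner : ∀ (A : Matrix (Fin n) (Fin n) ℝ) (v : Vec n),
      (inner ℝ u (Φ A v) : ℝ) = Matrix.vecMul u A ⬝ᵥ v := fun A v => by
    rw [hΦ, Matrix.inner_toEuclideanCLM, Matrix.dotProduct_mulVec]
  have hu_proj : ∀ v, (inner ℝ u (Φ Pi v) : ℝ) = 0 := fun v => by simp [hinner, huPi]
  have hu_mix : ∀ v, (inner ℝ u (Φ S v) : ℝ) = inner ℝ u v := fun v => by
    rw [hinner, huS, EuclideanSpace.inner_eq_star_dotProduct]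
    simp [dotProduct_comm]
  have hPiv : ∀ v, Φ Pi (Φ Pi v) = Φ Pi v := fun v => by
    rw [← mul_apply_eq_comp, ← map_mul, hPi]
  have hPS : ∀ v, Φ Pi (Φ S v) = Φ S (Φ Pi v) := fun v => by
    rw [← mul_apply_eq_comp, ← map_mul, hcomm, map_mul, mul_apply_eq_comp]
  have haS : ∀ k v, a k (Φ S v) = a (k + 1) v := fun k v => by
    simp only [ha]
    rw [hPS, pow_succ S k, map_mul, mul_apply_eq_comp]
  have haPi : ∀ k v, a k (Φ Pi v) = a k v := fun k v => by
    simp only [ha]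
    rw [hPiv]
  have hsumS : ∀ v, ∑ k ∈ Finset.range N, a k (Φ S v)
      ≤ ∑ k ∈ Finset.range N, a k v - 1 / 2 * a 0 v := fun v => by
    have h1 := Finset.sum_range_succ (fun k => a k v) N
    rw [Finset.sum_range_succ'] at h1
    have h2 : a N v ≤ 1 / 2 * a 0 v := by
      simp only [ha, pow_zero, map_one, one_apply_eq_self]
      exact hcontr _ (hu_proj v)
    simp only [haS]
    linarith
  set K : ℝ := ∑ k ∈ Finset.range N, ‖Φ (S ^ k)‖ ^ 2 + 1 with hK
  have hK1 : 1 ≤ K := by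
    have := Finset.sum_nonneg fun k (_ : k ∈ Finset.range N) => sq_nonneg ‖Φ (S ^ k)‖
    linarith
  have hsumK : ∀ v, ∑ k ∈ Finset.range N, a k v ≤ K * a 0 v := fun v => by
    have h1 : ∑ k ∈ Finset.range N, a k v ≤ ∑ k ∈ Finset.range N, ‖Φ (S ^ k)‖ ^ 2 * a 0 v :=
      Finset.sum_le_sum fun k _ => by
        simp only [ha, pow_zero, map_one, one_apply_eq_self]
        rw [← mul_pow]
        gcongr
        exact ContinuousLinearMap.le_opNorm _ _
    rw [← Finset.sum_mul] at h1
    have := ha0 0 v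
    rw [hK, add_mul]
    linarith
  have hρ : 0 ≤ 1 - 1 / (2 * K) := by
    rw [sub_nonneg, div_le_one (by positivity)]
    linarith
  refine ⟨T, √(1 - 1 / (2 * K)), hT, ?_, ?_, ?_, ?_⟩
  · rw [Real.sqrt_lt' one_pos]
    have : 0 < 1 / (2 * K) := by positivity
    linarith
  · refine indNorm_le_of_forall hT zero_le_one fun v => ?_
    rw [one_mul, ← sq_le_sq₀ (norm_nonneg _) (norm_nonneg _), map_mul, mul_apply_eq_comp, ← hΦ, hTq, hTq,
      hu_proj]
    simp only [haPi]
    nlinarith [sq_nonneg (inner ℝ u v : ℝ)]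
  · refine indNorm_le_of_forall hT zero_le_one fun v => ?_
    rw [one_mul, ← sq_le_sq₀ (norm_nonneg _) (norm_nonneg _), map_mul, mul_apply_eq_comp, ← hΦ, hTq, hTq,
      hu_mix]
    linarith [hsumS v, ha0 0 v]
  · refine indNorm_le_of_forall hT (Real.sqrt_nonneg _) fun v => ?_
    rw [← sq_le_sq₀ (norm_nonneg _) (by positivity), mul_pow, Real.sq_sqrt hρ, map_mul, map_mul,
      mul_apply_eq_comp, mul_apply_eq_comp, ← hΦ, hTq, hTq, hu_proj]
    simp only [haPi]
    have h1 := hsumS v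
    have h2 : 1 / (2 * K) * ∑ k ∈ Finset.range N, a k v ≤ 1 / 2 * a 0 v := by
      have := mul_le_mul_of_nonneg_left (hsumK v) (by positivity : 0 ≤ 1 / (2 * K))
      refine this.trans_eq ?_
      field_simp
    have h3 := mul_nonneg hρ (sq_nonneg (inner ℝ u v : ℝ))
    nlinarith

lemma IsPerronVector.relaxed {u : Vec n} (hu : IsPerronVector R.transpose u) (γ : ℝ) :
    IsPerronVector (relaxed R γ).transpose u := by
  refine ⟨hu.nonneg, fun i => ?_, hu.sum_eq⟩
  have h : ∀ j, (RCPP.relaxed R γ).transpose i j * u j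
      = (1 - γ) * ((1 : Matrix (Fin n) (Fin n) ℝ) i j * u j) + γ * (R.transpose i j * u j) :=
    fun j => by
      simp only [RCPP.relaxed, Matrix.transpose_apply, Matrix.sub_apply, Matrix.smul_apply,
        smul_eq_mul, Matrix.one_apply, eq_comm (a := j) (b := i)]
      ring
  simp only [h, Finset.sum_add_distrib, ← Finset.mul_sum, hu.eigen]
  simp only [Matrix.one_apply, ite_mul, one_mul, zero_mul, Finset.sum_ite_eq, Finset.mem_univ,
    if_true]
  ring

lemma IsSpanningTreeRoot.relaxed (hR : R ∈ Matrix.rowStochastic ℝ (Fin n)) {i : Fin n}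
    (hi : IsSpanningTreeRoot R i) {γ : ℝ} (h0 : 0 < γ) (h1 : γ < 1) :
    IsSpanningTreeRoot (relaxed R γ) i := by
  obtain ⟨par, hpar, hroot⟩ := hi
  exact ⟨par, fun j hj => relaxed_apply_pos hR h0 h1 (hpar j hj), hroot⟩

lemma IsPerronVector.unique [NeZero n] (hR : R ∈ Matrix.rowStochastic ℝ (Fin n)) {i : Fin n}
    (hi : IsSpanningTreeRoot R i) {u u' : Vec n} (hu : IsPerronVector R.transpose u)
    (hu' : IsPerronVector R.transpose u') : u = u' := by
  have h0 : (0 : ℝ) < 1 / 2 := by norm_num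
  have h1 : (1 / 2 : ℝ) < 1 := by norm_num
  have hv : ∀ {w : Vec n}, IsPerronVector R.transpose w →
      Matrix.vecMul w (RCPP.relaxed R (1 / 2)) = w := fun {w} hw => funext fun j => by
    simpa [Matrix.vecMul, dotProduct, mul_comm] using (hw.relaxed (1 / 2)).eigen j
  have h := eq_zero_of_vecMul_eq (relaxed_mem_rowStochastic hR h0.le h1.le)
    (relaxed_apply_self_pos hR h0.le h1) (hi.relaxed hR h0 h1) (w := u - u') ?_ ?_
  · exact PiLp.ext fun j => sub_eq_zero.1 (congrFun h j)
  · exact (Matrix.sub_vecMul _ _ _).trans (by rw [hv hu, hv hu'])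
  · simp [Finset.sum_sub_distrib, hu.sum_eq, hu'.sum_eq]

lemma exists_isWeight [NeZero n] (hR : R ∈ Matrix.rowStochastic ℝ (Fin n)) {i : Fin n}
    (hi : IsSpanningTreeRoot R i) {u : Vec n} (hu : IsPerronVector R.transpose u) {Γ : ℝ}
    (hΓ : Γ < 1) : ∃ (T : Matrix (Fin n) (Fin n) ℝ) (θ : ℝ), IsWeight R (projR u) T θ Γ := by
  set Γ' : ℝ := max Γ (2 / 3) with hΓ'
  have g0 : 2 / 3 ≤ Γ' := le_max_right _ _
  have g1 : Γ' < 1 := max_lt hΓ (by norm_num)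
  have gpos : 0 < Γ' := by linarith
  have hn : (n : ℝ) ≠ 0 := NeZero.ne _
  have hinner : ∀ v : Vec n, (inner ℝ u v : ℝ) = ∑ j, u j * v j := fun v => by
    simp [PiLp.inner_apply, mul_comm]
  obtain ⟨N, hN, hcontr⟩ := exists_pow_contraction (relaxed_mem_rowStochastic hR gpos.le g1.le)
    (relaxed_apply_self_pos hR gpos.le g1) (hi.relaxed hR gpos g1) (hu.relaxed Γ')
  have huS : Matrix.vecMul u (relaxed R Γ') = u := funext fun j => by
    simpa [Matrix.vecMul, dotProduct, mul_comm] using (hu.relaxed Γ').eigen j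
  have hcomm : projR u * relaxed R Γ' = relaxed R Γ' * projR u :=
    relaxed_comm (projR_comm (fun i => Matrix.sum_row_of_mem_rowStochastic hR i) fun j => by
      simpa [mul_comm] using hu.eigen j) Γ'
  have hpr : ∀ (v : Vec n) (j : Fin n), Matrix.toEuclideanCLM (n := Fin n) (𝕜 := ℝ) (projR u) v j
      = v j - 1 / n * ∑ l, u l * v l := fun v j => by
    rw [show Matrix.toEuclideanCLM (n := Fin n) (𝕜 := ℝ) (projR u) v j
      = ∑ l, projR u j l * v l from rfl]
    simp only [projR_apply, sub_mul, Finset.sum_sub_distrib, mul_assoc, ← Finset.mul_sum]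
    simp [Matrix.one_apply]
  have huPi : Matrix.vecMul u (projR u) = 0 := funext fun j => by
    simp only [Matrix.vecMul, dotProduct, projR_apply, mul_sub, Finset.sum_sub_distrib,
      ← Finset.sum_mul, hu.sum_eq, Pi.zero_apply]
    simp [Matrix.one_apply, hn]
  have hker : ∀ v : Vec n, Matrix.toEuclideanCLM (n := Fin n) (𝕜 := ℝ) (projR u) v = 0 →
      inner ℝ u v = (0 : ℝ) → v = 0 := fun v hv huv => PiLp.ext fun j => by
    have := hpr v j
    rw [hv, ← hinner, huv] at this
    simpa using this.symm
  obtain ⟨T, ρ, hT, hρ, h1, h2, h3⟩ := exists_contracting_weight (projR_mul_self hu.sum_eq) hcomm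
    huPi huS hker hN (fun v hv => hcontr v ((hinner v).symm.trans hv))
  exact ⟨T, _, isWeight_of_relaxed hT g0 (le_max_left _ _) g1.le hρ h1 h2 h3⟩

/-- The eigenvectors and the weighted norms exist. -/
theorem exists_aux_valid [NeZero n] {C : Matrix (Fin n) (Fin n) ℝ} {G : Digraph (Fin n)}
    (hnet : NetworkAssumption G R C) {Γ : ℝ} (hΓ : Γ < 1) :
    ∃ W : Aux n, ∀ γx γy : ℝ, 0 < γx → γx ≤ Γ → 0 < γy → γy ≤ Γ → W.Valid R C γx γy := by
  obtain ⟨i, hiR, hiC⟩ := hnet.common_root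
  have hC := Matrix.transpose_mem_rowStochastic_iff_mem_colStochastic.2 hnet.col_stochastic
  obtain ⟨uR, huR⟩ := exists_isPerronVector_transpose hnet.row_stochastic
  obtain ⟨uC, huC⟩ := exists_isPerronVector_transpose hC
  obtain ⟨T, θR, hT⟩ := exists_isWeight hnet.row_stochastic hiR huR hΓ
  obtain ⟨T', θC, hT'⟩ := exists_isWeight hC hiC huC hΓ
  have hT'' := hT'.transpose
    (projR_comm (fun i => Matrix.sum_row_of_mem_rowStochastic hC i) fun j => by
      simpa [mul_comm] using huC.eigen j)
  rw [Matrix.transpose_transpose, ← projC_eq_transpose] at hT''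
  obtain ⟨TR, dR, hTR⟩ := hT.exists_isWeightedNorm
  obtain ⟨TC, dC, hTC⟩ := hT''.exists_isWeightedNorm
  exact ⟨⟨uR, uC, TR, TC, dR, dC, θR, θC, 1⟩, fun γx γy hx hx' hy hy' =>
    ⟨huR, by simpa using huC, hTR γx hx hx', hTC γy hy hy'⟩⟩

theorem existsUnique_isPerronVector_transpose [NeZero n]
    (hR : R ∈ Matrix.rowStochastic ℝ (Fin n)) {i : Fin n} (hi : IsSpanningTreeRoot R i) :
    ∃! u, IsPerronVector R.transpose u := by
  obtain ⟨u, hu⟩ := exists_isPerronVector_transpose hR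
  exact ⟨u, hu, fun u' hu' => hu'.unique hR hi hu⟩

end WeightedNorm

/-! ### Compression of the rows -/

lemma CompressionAssumption.rowwise {n p : ℕ} [NeZero n] {Θ : Type*} [MeasurableSpace Θ]
    {ν : Measure Θ} [IsProbabilityMeasure ν] {κ : Fin n → Θ → Vec p → Vec p} {c : CompConst}
    (h : ∀ i, CompressionAssumption ν (κ i) c) :
    CompressionAssumption ν (RCPP.rowwise κ) (c.total n) := by
  have h0 := h 0
  have hn : (0 : ℝ) ≤ n := Nat.cast_nonneg n
  have herr : ∀ (Z : Stack n p) (θ : Θ),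
      ‖RCPP.rowwise κ θ Z - Z‖ ^ 2 = ∑ i, ‖κ i θ (Z i) - Z i‖ ^ 2 := fun Z θ =>
    PiLp.norm_sq_eq_of_L2 _ _
  have hscal : ∀ (Z : Stack n p) (θ : Θ),
      ‖c.r⁻¹ • RCPP.rowwise κ θ Z - Z‖ ^ 2 = ∑ i, ‖c.r⁻¹ • κ i θ (Z i) - Z i‖ ^ 2 := fun Z θ =>
    PiLp.norm_sq_eq_of_L2 _ _
  have hsum : ∀ (t s : ℝ) (Z : Stack n p),
      ∑ i, (t * ‖Z i‖ ^ 2 + s) = t * ‖Z‖ ^ 2 + n * s := fun t s Z => by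
    rw [Finset.sum_add_distrib, ← Finset.mul_sum, PiLp.norm_sq_eq_of_L2]
    simp
  constructor
  · refine (WithLp.measurable_toLp 2 _).comp (measurable_pi_lambda _ fun i => ?_)
    exact (h i).measurable.comp (measurable_fst.prodMk
      ((measurable_pi_apply i).comp ((WithLp.measurable_ofLp 2 _).comp measurable_snd)))
  · exact h0.C_nonneg
  · exact mul_nonneg hn h0.sigmaSq_nonneg
  · exact h0.r_pos
  · exact h0.δ_pos
  · exact h0.δ_le_one
  · exact mul_nonneg hn h0.sigmaRSq_nonneg
  · intro Z
    simp only [herr]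
    exact integrable_finsetSum _ fun i _ => (h i).integrable (Z i)
  · intro Z
    simp only [herr]
    rw [integral_finsetSum _ fun i _ => (h i).integrable (Z i)]
    exact (Finset.sum_le_sum fun i _ => (h i).error_le (Z i)).trans_eq (hsum _ _ Z)
  · intro Z
    change ∫ θ, ‖c.r⁻¹ • RCPP.rowwise κ θ Z - Z‖ ^ 2 ∂ν ≤ (1 - c.δ) * ‖Z‖ ^ 2 + n * c.sigmaRSq
    simp only [hscal]
    rw [integral_finsetSum _ fun i _ => (h i).integrable_scaled (Z i)]
    exact (Finset.sum_le_sum fun i _ => (h i).scaled_error_le (Z i)).trans_eq (hsum _ _ Z)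

lemma StepSizeCondition.total {n p : ℕ} {D : Input n p} {W : Aux n} {c : CompConst}
    (h : StepSizeCondition D W c) (m : ℕ) : StepSizeCondition D W (c.total m) :=
  ⟨h.lam_1, h.lam_2, h.lam_3, h.lam_4, h.lam_5, h.lam_6, h.γx_1, h.γx_2, h.γx_3, h.γy_1, h.γy_2,
    h.γy_3, h.γy_4⟩

end RCPP

theorem theorem1 {n p : ℕ} {G : Digraph (Fin n)} (D : RCPP.Input n p)
    -- the network, the objective functions, and the ranges of the parameters
    (hnet : RCPP.NetworkAssumption G D.R D.C)
    (hsmooth : D.SmoothAssumption) (hL : 0 < D.L)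
    (xstar : RCPP.Vec p) (hxstar : ∀ x, D.obj xstar ≤ D.obj x)
    (hlam : ∀ i, 0 ≤ D.lam i) (hlamHat : 0 < D.lamHat)
    (hγx : 0 < D.γx) (hγy : 0 < D.γy)
    (a₀ a : ℝ) (ha₀ : 0 < a₀) (ha : 0 < a) (ha1 : a < 1)
    (hs : ∀ k, D.s k ^ 2 = a₀ * a ^ k)
    -- independent seeds with law `ν`, two for each iteration
    {Θ Ω : Type*} [MeasurableSpace Θ] [MeasurableSpace Ω]
    (ν : MeasureTheory.Measure Θ) [MeasureTheory.IsProbabilityMeasure ν]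
    (P : MeasureTheory.Measure Ω) [MeasureTheory.IsProbabilityMeasure P]
    (ξ : ℕ → Fin 2 → Ω → Θ) (hξ : ∀ k j, Measurable (ξ k j))
    (hlaw : ∀ k j, P.map (ξ k j) = ν)
    (hindep : ProbabilityTheory.iIndepFun (fun q : ℕ × Fin 2 => ξ q.1 q.2) P) :
    -- the eigenvectors and the weighted norms, on which the bound depends, exist
    ((∃! uR, RCPP.IsPerronVector D.R.transpose uR) ∧ (∃! uC, RCPP.IsPerronVector D.C uC) ∧
      ∀ Γ : ℝ, 0 < Γ → Γ < 1 → ∃ W : RCPP.Aux n,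
        ∀ γx γy : ℝ, 0 < γx → γx ≤ Γ → 0 < γy → γy ≤ Γ → W.Valid D.R D.C γx γy) ∧
    -- the rate, for every choice of them
    ∀ (W : RCPP.Aux n) (c : RCPP.CompConst),
      W.Valid D.R D.C D.γx D.γy →
      0 < W.M → W.M * D.lamHat ≤ RCPP.lamBar D W →
      0 < D.αx → D.αx ≤ 1 / c.r → 0 < D.αy → D.αy ≤ 1 / c.r →
      RCPP.StepSizeCondition D W c →
      -- a compression operator on stacked variables
      (∀ 𝒞 : Θ → RCPP.Stack n p → RCPP.Stack n p, RCPP.CompressionAssumption ν 𝒞 c →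
        RCPP.SublinearRate D W c 𝒞 P ξ xstar a₀ a) ∧
      -- each agent compresses its own row: the absolute errors of the `n` rows add up
      (∀ κ : Fin n → Θ → RCPP.Vec p → RCPP.Vec p,
        (∀ i, RCPP.CompressionAssumption ν (κ i) c) →
        RCPP.SublinearRate D W (c.total n) (RCPP.rowwise κ) P ξ xstar a₀ a) := by
  obtain ⟨i, hiR, hiC⟩ := hnet.common_root
  have : NeZero n := ⟨i.pos.ne'⟩
  have hC := Matrix.transpose_mem_rowStochastic_iff_mem_colStochastic.2 hnet.col_stochastic
  refine ⟨⟨RCPP.existsUnique_isPerronVector_transpose hnet.row_stochastic hiR, ?_,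
    fun Γ _ hΓ => RCPP.exists_aux_valid hnet hΓ⟩, ?_⟩
  · simpa using RCPP.existsUnique_isPerronVector_transpose hC hiC
  intro W c hW hM hMl hαx hαx' hαy hαy' hc
  have hs0 : ∀ k, D.s k ≠ 0 := fun k h => by
    have h1 := hs k
    rw [h, zero_pow two_ne_zero] at h1
    exact (mul_pos ha₀ (pow_pos ha k)).ne h1
  have hset : RCPP.Setting D W :=
    { smooth := hsmooth
      L_pos := hL
      lam_nonneg := hlam
      lamHat_pos := hlamHat
      γx_pos := hγx
      γy_pos := hγy
      row_sum := fun i => Matrix.sum_row_of_mem_rowStochastic hnet.row_stochastic i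
      col_sum := fun j => Matrix.sum_col_of_mem_colStochastic hnet.col_stochastic j
      valid := hW
      M_pos := hM
      M_le := hMl }
  have key : ∀ (c' : RCPP.CompConst) (𝒞 : Θ → RCPP.Stack n p → RCPP.Stack n p), c'.r = c.r →
      RCPP.StepSizeCondition D W c' → RCPP.CompressionAssumption ν 𝒞 c' →
      RCPP.SublinearRate D W c' 𝒞 P ξ xstar a₀ a := fun c' 𝒞 hr hc' h𝒞 =>
    RCPP.RandomSetting.sublinearRate (ν := ν)
      { toSetting := hset
        compression := h𝒞
        s_ne_zero := hs0
        seed_measurable := hξ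
        law := hlaw
        indep := hindep
        αx_pos := hαx
        αx_le := hr ▸ hαx'
        αy_pos := hαy
        αy_le := hr ▸ hαy' } hc' hxstar ha₀ ha ha1 hs
  exact ⟨fun 𝒞 h𝒞 => key c 𝒞 rfl hc h𝒞, fun κ hκ => key (c.total n) (RCPP.rowwise κ) rfl
    (hc.total n) (RCPP.CompressionAssumption.rowwise hκ)⟩
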